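/- Let $\mathbb{D}=\{z\in\mathbb{C}:|z|<1\}$ and let $dA=\frac{dx\,dy}{\pi}$ be the normalized area measure on $\mathbb{D}$. Let $0<p\le q<\infty$ and let $\mu$ be a finite positive Borel measure on $\mathbb{D}$. Let $\omega:\mathbb{D}\to[0,\infty)$ be integrable and radial, $\omega(z)=\omega(|z|)$, such that $\widehat{\omega}(r)=\int_r^1\omega(s)\,ds>0$ for all $0\le r<1$, and suppose $\omega\in\mathcal{D}$, that is, there exist constants $C_1\ge1$, $K>1$ and $C_2>1$ such that $$\widehat{\omega}(r)\le C_1\,\widehat{\omega}\left(\tfrac{1+r}{2}\right)\quad\text{and}\quad \widehat{\omega}(r)\ge C_2\,\widehat{\omega}\left(1-\tfrac{1-r}{K}\right),\qquad 0\le r<1.$$ Let $\Phi,\Psi\in\mathcal{L}$, where $\mathcal{L}$ is the class of functions $\Psi:[0,\infty)\to(0,\infty)$ that are essentially monotonic (there is a constant $C>0$ such that $\Psi(x)\le C\Psi(y)$ for all $0\le x\le y$, or there is a constant $C>0$ such that $\Psi(y)\le C\Psi(x)$ for all $0\le x\le y$) and satisfy $\Psi(x)\asymp\Psi(x^2)$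 for $0\le x<\infty$, i.e. each of the two sides is at most a constant times the other, the constant being independent of $x$. Let $L^q_{\mu,\Phi}$ be the space of all measurable functions $f$ on $\mathbb{D}$ (identified if equal $\mu$-almost everywhere) with $\|f\|_{L^q_{\mu,\Phi}}=\left(\int_{\mathbb{D}}|f|^q\,\Phi(|f|)\,d\mu\right)^{1/q}<\infty$, with the topology given by this quasinorm, and let $A^p_{\omega,\Psi}$ be the space of all analytic functions $f$ in $\mathbb{D}$ with $\|f\|_{A^p_{\omega,\Psi}}=\left(\int_{\mathbb{D}}|f|^p\,\Psi(|f|)\,\omega\,dA\right)^{1/p}<\infty$, with the topology given by its quasinorm. Call the identity mapping $I:A^p_{\omega,\Psi}\to L^q_{\mu,\Phi}$ bounded if $A^p_{\omega,\Psi}\subset L^q_{\mu,\Phi}$ and $I$ maps bounded sets to bounded sets, and compact if $A^p_{\omega,\Psi}\subset L^q_{\mu,\Phi}$ and $I$ maps some neighborhood of the origin onto a relatively compact set. For $a\in\mathbb{D}\setminus\{0\}$ let $S(a)=\{z\in\mathbb{D}:|z|\ge|a|,\ |\arg a-\arg z|<\frac12(1-|a|)\}$, where the difference of the arguments is taken modulo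 $2\pi$, let $S(0)=\mathbb{D}$, and write $\omega(S(a))=\int_{S(a)}\omega\,dA$. Then the following statements hold: (i) $I:A^p_{\omega,\Psi}\to L^q_{\mu,\Phi}$ is bounded if and only if $$\sup_{a\in\mathbb{D}}\frac{\mu(S(a))\,\Phi\left(\frac{1}{\omega(S(a))}\right)}{\left(\omega(S(a))\,\Psi\left(\frac{1}{\omega(S(a))}\right)\right)^{q/p}}<\infty;$$ (ii) $I:A^p_{\omega,\Psi}\to L^q_{\mu,\Phi}$ is compact if and only if $$\lim_{|a|\to1^-}\frac{\mu(S(a))\,\Phi\left(\frac{1}{\omega(S(a))}\right)}{\left(\omega(S(a))\,\Psi\left(\frac{1}{\omega(S(a))}\right)\right)^{q/p}}=0.$$ -/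

import Mathlib

open MeasureTheory Filter Topology
open scoped ENNReal NNReal

noncomputable section

namespace DiscSpaces

/-- The open unit disc of the complex plane. -/
def disc : Set ℂ := Metric.ball (0 : ℂ) 1

/-! ### The class of inducing functions

A function `[0, ∞) → (0, ∞)` is given as `Ψ : ℝ → ℝ`; only its values on `[0, ∞)` are ever used. -/

/-- `Ψ` is essentially increasing on `[0, ∞)`. -/
def EssIncreasing (Ψ : ℝ → ℝ) : Prop :=
  ∃ C : ℝ, 0 < C ∧ ∀ x y : ℝ, 0 ≤ x → x ≤ y → Ψ x ≤ C * Ψ y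

/-- `Ψ` is essentially decreasing on `[0, ∞)`. -/
def EssDecreasing (Ψ : ℝ → ℝ) : Prop :=
  ∃ C : ℝ, 0 < C ∧ ∀ x y : ℝ, 0 ≤ x → x ≤ y → Ψ y ≤ C * Ψ x

/-- The class `𝓛`: positive, essentially monotonic, and `Ψ x ≍ Ψ (x ^ 2)` on `[0, ∞)`. -/
structure ClassL (Ψ : ℝ → ℝ) : Prop where
  pos : ∀ x : ℝ, 0 ≤ x → 0 < Ψ x
  ess_monotonic : EssIncreasing Ψ ∨ EssDecreasing Ψ
  comparable_sq : ∃ C : ℝ, 0 < C ∧ ∀ x : ℝ, 0 ≤ x →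
    Ψ x ≤ C * Ψ (x ^ 2) ∧ Ψ (x ^ 2) ≤ C * Ψ x

/-! ### Radial doubling weights

A weight on the disc is given as `ω : ℂ → ℝ`; only its values on the disc are ever used. -/

/-- `ω` is a radial weight: nonnegative, integrable and radial on the disc. -/
structure IsRadialWeight (ω : ℂ → ℝ) : Prop where
  nonneg : ∀ z ∈ disc, 0 ≤ ω z
  integrable : IntegrableOn ω disc volume
  radial : ∀ z ∈ disc, ω z = ω ((‖z‖ : ℝ) : ℂ)

/-- The tail integral `∫_r^1 ω(s) ds`, with values in `[0, ∞]`. -/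
def tail (ω : ℂ → ℝ) (r : ℝ) : ℝ≥0∞ :=
  ∫⁻ s in Set.Ioo r 1, ENNReal.ofReal (ω (s : ℂ))

/-- The upper doubling condition on the tail integral. -/
def UpperDoubling (ω : ℂ → ℝ) : Prop :=
  ∃ C : ℝ, 1 ≤ C ∧ ∀ r : ℝ, 0 ≤ r → r < 1 →
    tail ω r ≤ ENNReal.ofReal C * tail ω ((1 + r) / 2)

/-- The lower (reverse) doubling condition on the tail integral. -/
def LowerDoubling (ω : ℂ → ℝ) : Prop :=
  ∃ K C : ℝ, 1 < K ∧ 1 < C ∧ ∀ r : ℝ, 0 ≤ r → r < 1 →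
    ENNReal.ofReal C * tail ω (1 - (1 - r) / K) ≤ tail ω r

/-- The class `𝓓` of radial weights with positive tail integral that satisfy both doubling
conditions. -/
structure ClassD (ω : ℂ → ℝ) : Prop where
  weight : IsRadialWeight ω
  tail_pos : ∀ r : ℝ, 0 ≤ r → r < 1 → 0 < tail ω r
  upper : UpperDoubling ω
  lower : LowerDoubling ω

/-- The measure `ω dA` on the disc, where `dA = dx dy / π` is the normalized area measure. -/
def weightMeasure (ω : ℂ → ℝ) : Measure ℂ :=
  (volume.restrict disc).withDensity fun z => ENNReal.ofReal (ω z / Real.pi)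

/-! ### The spaces -/

/-- The quasinorm `(∫_𝔻 |f|^p Ψ(|f|) dμ)^(1/p)`, with values in `[0, ∞]`. -/
def zygmundNorm (p : ℝ) (Ψ : ℝ → ℝ) (μ : Measure ℂ) (f : ℂ → ℂ) : ℝ≥0∞ :=
  (∫⁻ z in disc, ENNReal.ofReal (‖f z‖ ^ p * Ψ ‖f z‖) ∂μ) ^ (1 / p)

theorem zygmundNorm_congr {p : ℝ} {Ψ : ℝ → ℝ} {μ : Measure ℂ} {f g : ℂ → ℂ}
    (h : f =ᵐ[μ.restrict disc] g) : zygmundNorm p Ψ μ f = zygmundNorm p Ψ μ g := by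
  unfold zygmundNorm
  congr 1
  refine lintegral_congr_ae ?_
  filter_upwards [h] with z hz
  rw [hz]

/-- The Lebesgue--Zygmund space: classes, modulo equality `μ`-almost everywhere on the disc, of
measurable functions on the disc with finite quasinorm. -/
def LebesgueZygmund (p : ℝ) (Ψ : ℝ → ℝ) (μ : Measure ℂ) : Type :=
  {F : ℂ →ₘ[μ.restrict disc] ℂ // zygmundNorm p Ψ μ F < ∞}

/-- The quasinorm topology: a set is open if it contains with each of its points `F` a ball
`{G | ‖G - F‖ < ε}`. -/
instance (p : ℝ) (Ψ : ℝ → ℝ) (μ : Measure ℂ) : TopologicalSpace (LebesgueZygmund p Ψ μ) where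
  IsOpen U := ∀ F ∈ U, ∃ ε : ℝ≥0∞, 0 < ε ∧
    ∀ G : LebesgueZygmund p Ψ μ, zygmundNorm p Ψ μ ⇑(G.1 - F.1) < ε → G ∈ U
  isOpen_univ := fun _ _ => ⟨1, one_pos, fun _ _ => Set.mem_univ _⟩
  isOpen_inter := by
    intro U V hU hV F hF
    obtain ⟨ε, hε, h1⟩ := hU F hF.1
    obtain ⟨δ, hδ, h2⟩ := hV F hF.2
    exact ⟨min ε δ, lt_min hε hδ, fun G hG =>
      ⟨h1 G (hG.trans_le (min_le_left _ _)), h2 G (hG.trans_le (min_le_right _ _))⟩⟩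
  isOpen_sUnion := by
    intro S hS F hF
    obtain ⟨U, hU, hFU⟩ := hF
    obtain ⟨ε, hε, h⟩ := hS U hU F hFU
    exact ⟨ε, hε, fun G hG => ⟨U, hU, h G hG⟩⟩

/-- The weighted Bergman--Zygmund space: functions that are analytic in the disc and have finite
quasinorm with respect to `ω dA`. (Values outside the disc play no role.) -/
def BergmanZygmund (p : ℝ) (Ψ : ℝ → ℝ) (ω : ℂ → ℝ) : Type :=
  {f : ℂ → ℂ // DifferentiableOn ℂ f disc ∧ zygmundNorm p Ψ (weightMeasure ω) f < ∞}

/-- Every element of the Bergman--Zygmund space lies in the Lebesgue--Zygmund space, so that the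
identity mapping between the two makes sense. -/
def Contained (p q : ℝ) (Φ Ψ : ℝ → ℝ) (ω : ℂ → ℝ) (μ : Measure ℂ) : Prop :=
  ∀ f : BergmanZygmund p Ψ ω, zygmundNorm q Φ μ f.1 < ∞

/-- The identity mapping from the Bergman--Zygmund space to the Lebesgue--Zygmund space. -/
def identityMap {p q : ℝ} {Φ Ψ : ℝ → ℝ} {ω : ℂ → ℝ} {μ : Measure ℂ}
    (h : Contained p q Φ Ψ ω μ) (f : BergmanZygmund p Ψ ω) : LebesgueZygmund q Φ μ :=
  ⟨AEEqFun.mk f.1 (f.2.1.continuousOn.aestronglyMeasurable Metric.isOpen_ball.measurableSet), by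
    rw [zygmundNorm_congr (AEEqFun.coeFn_mk f.1 _)]
    exact h f⟩

/-- The identity mapping is (well defined and) bounded: it maps bounded sets to bounded sets. -/
def IdentityBounded (p q : ℝ) (Φ Ψ : ℝ → ℝ) (ω : ℂ → ℝ) (μ : Measure ℂ) : Prop :=
  ∃ h : Contained p q Φ Ψ ω μ, ∀ B : Set (BergmanZygmund p Ψ ω),
    (∃ M : ℝ≥0, ∀ f ∈ B, zygmundNorm p Ψ (weightMeasure ω) f.1 ≤ M) →
    ∃ N : ℝ≥0, ∀ F ∈ identityMap h '' B, zygmundNorm q Φ μ F.1 ≤ N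

/-- The identity mapping is (well defined and) compact: it maps some neighbourhood of the origin
onto a relatively compact set. -/
def IdentityCompact (p q : ℝ) (Φ Ψ : ℝ → ℝ) (ω : ℂ → ℝ) (μ : Measure ℂ) : Prop :=
  ∃ h : Contained p q Φ Ψ ω μ, ∃ U : Set (BergmanZygmund p Ψ ω),
    (∃ δ : ℝ, 0 < δ ∧ ∀ f : BergmanZygmund p Ψ ω,
      zygmundNorm p Ψ (weightMeasure ω) f.1 < ENNReal.ofReal δ → f ∈ U) ∧
    IsCompact (closure (identityMap h '' U))

/-! ### Carleson squares -/

open Classical in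
/-- The Carleson square of `a`. For `z, a ≠ 0` the number `|arg (z / a)|` is the distance of the
arguments of `z` and `a` modulo `2π`. -/
def carlesonSquare (a : ℂ) : Set ℂ :=
  if a = 0 then disc
  else {z : ℂ | z ∈ disc ∧ ‖a‖ ≤ ‖z‖ ∧ |Complex.arg (z / a)| < (1 - ‖a‖) / 2}

/-- `ω(S(a)) = ∫_{S(a)} ω dA`. -/
def squareMass (ω : ℂ → ℝ) (a : ℂ) : ℝ := (weightMeasure ω).real (carlesonSquare a)

/-- The quantity `μ(S(a)) Φ(1/ω(S(a))) / (ω(S(a)) Ψ(1/ω(S(a))))^(q/p)`. -/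
def carlesonQuotient (p q : ℝ) (Φ Ψ : ℝ → ℝ) (ω : ℂ → ℝ) (μ : Measure ℂ) (a : ℂ) : ℝ :=
  μ.real (carlesonSquare a) * Φ (1 / squareMass ω a) /
    (squareMass ω a * Ψ (1 / squareMass ω a)) ^ (q / p)

end DiscSpaces

end

noncomputable section

namespace DiscSpaces

/-! A function of the class 𝓛 varies more slowly than any power: up to constants it takes the same
value at polynomially related arguments, and for large x it lies between x^(-ε) and x^ε. Such
functions may be replaced by measurable comparable ones (`ClassL.exists_isSlow`). Write t = 1 - |z|,
let τ(t) be the integral of ω over (1 - t, 1), and put W(t) = t τ(t) Ψ(1/t). The doubling conditions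
give ω(S(a)) ≍ t τ(t) for t = 1 - |a| and squeeze W(t) between two powers of t. Hence the quotient
of the theorem is comparable to μ(S(a)) Φ(1/t) / W(t)^(q/p) (`carlesonQuotient_comparable`).

Sufficiency. A bound on the modular ∫ |f|^p Ψ(|f|) ω dA forces polynomial growth |f(z)| ≤ A t^(-B).
At each point |f(z)| is then either polynomially related to 1/t, so that Ψ(|f|) ≍ Ψ(1/t), or so
small that |f|^p Ψ is O(t^(-ε)) with either argument (`IsSlow.rpow_mul_split`). The error t^(-ε) is
integrable for ω dA, and for μ under the Carleson condition, so the slow factors can be frozen at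
1/t. What remains is a weighted Carleson embedding (`carleson_embedding`). Its ingredients are the
sub-mean value property of |f|^p on discs of radius t/8, and the fact that in integrals of |f|^p the
smooth density τ(t)/t is dominated by ω, which follows from reverse doubling and the monotonicity of
circular means (`setLIntegral_tail_le`). The exponent q/p ≥ 1 is brought down to 1 by the pointwise
bound on |f|^p W; after Tonelli, the inner μ-integral lives on a single Carleson square.

If the condition vanishes at the boundary, the embedding has a small constant on thin annuli, and
normal families deal with the compact part (`tendsto_modular_zero`). Sequences suffice for
compactness, because the modular of a difference is a quasi-metric and its uniformity is countably
generated (`IsQuasiMetric.isCompact_closure`).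

Necessity. With t = 1 - |a| and n large, the functions F_a(z) = W(t)^(-1/p) (t / (1 - āz))^n have
bounded modular, are at least a constant times W(t)^(-1/p) in modulus on S(a), and tend to 0
pointwise as |a| → 1 (`exists_testFunctions`). Boundedness tested on F_a gives the Carleson
condition. If the map is compact, every sequence r F_a with |a| → 1 has a subsequence converging in
the modular; the limit can only be 0, which is the vanishing condition. -/

/-! ### Slowly varying functions -/

theorem le_pow_two_pow_of_sq_le {Ψ : ℝ → ℝ} {C : ℝ} (hC : 0 < C)
    (h : ∀ x : ℝ, 0 ≤ x → Ψ (x ^ 2) ≤ C * Ψ x) (n : ℕ) {x : ℝ} (hx : 0 ≤ x) :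
    Ψ (x ^ (2 ^ n)) ≤ C ^ n * Ψ x := by
  induction n with
  | zero => simp
  | succ n ih =>
    have h1 := h (x ^ (2 ^ n)) (by positivity)
    rw [← pow_mul, ← pow_succ] at h1
    calc _ ≤ _ := h1
      _ ≤ C * (C ^ n * Ψ x) := by gcongr
      _ = _ := by ring

/-- For y ≥ 2 any polynomial in y is at most y^(2^n) with n fixed, and each squaring costs one
factor of the constant. For y < 2 all values are compared with Ψ 0. -/
theorem EssIncreasing.le_of_le_rpow {Ψ : ℝ → ℝ} (hpos : ∀ x : ℝ, 0 ≤ x → 0 < Ψ x)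
    (hinc : EssIncreasing Ψ) (hsq : ∃ C : ℝ, 0 < C ∧ ∀ x : ℝ, 0 ≤ x → Ψ (x ^ 2) ≤ C * Ψ x)
    (A k : ℝ) : ∃ C : ℝ, 0 < C ∧ ∀ x y : ℝ, 0 ≤ x → 0 ≤ y → x ≤ A * (1 + y) ^ k →
      Ψ x ≤ C * Ψ y := by
  obtain ⟨C₀, hC₀, hi⟩ := hinc
  obtain ⟨C, hC, hs⟩ := hsq
  obtain ⟨m, hm⟩ := pow_unbounded_of_one_lt A (one_lt_two : (1 : ℝ) < 2)
  obtain ⟨j, hj⟩ := exists_nat_gt k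
  -- For y ≥ 2 one has 2 ≤ y and 1 + y ≤ y ^ 2, whence the exponent m + 2j; for y < 2 the bound 1 +
  -- y ≤ 3 leads to X.
  set n := m + 2 * j
  set X : ℝ := 2 ^ m * 3 ^ j with hX
  have h0 := hpos 0 le_rfl
  have hXp := hpos X (by positivity)
  have key : ∀ y : ℝ, 0 ≤ y → A * (1 + y) ^ k ≤ 2 ^ m * (1 + y) ^ j := by
    intro y hy
    have h1 : (1 + y) ^ k ≤ (1 + y) ^ j := by
      rw [← Real.rpow_natCast]
      exact Real.rpow_le_rpow_of_exponent_le (by linarith) hj.le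
    have h2 : (0:ℝ) ≤ (1 + y) ^ k := by positivity
    calc A * (1 + y) ^ k ≤ 2 ^ m * (1 + y) ^ k := by gcongr
      _ ≤ _ := by gcongr
  refine ⟨C₀ * C ^ n + C₀ * Ψ X * C₀ / Ψ 0, by positivity, fun x y hx hy hxy => ?_⟩
  have hy' := hpos y hy
  rcases le_or_gt 2 y with h2 | h2
  · have hle : x ≤ y ^ (2 ^ n) := by
      refine (hxy.trans (key y hy)).trans ?_
      calc (2:ℝ) ^ m * (1 + y) ^ j ≤ y ^ m * (y ^ 2) ^ j := by gcongr; nlinarith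
        _ = y ^ n := by rw [← pow_mul, ← pow_add]
        _ ≤ _ := pow_le_pow_right₀ (by linarith) Nat.lt_two_pow_self.le
    calc Ψ x ≤ C₀ * Ψ (y ^ (2 ^ n)) := hi _ _ hx hle
      _ ≤ C₀ * (C ^ n * Ψ y) := by gcongr; exact le_pow_two_pow_of_sq_le hC hs n hy
      _ ≤ _ := by
        rw [add_mul, mul_assoc]
        exact le_add_of_nonneg_right (by positivity)
  · have hle : x ≤ X := by
      refine (hxy.trans (key y hy)).trans ?_
      rw [hX]; gcongr; linarith
    have h3 := hi 0 y le_rfl hy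
    calc Ψ x ≤ C₀ * Ψ X := hi _ _ hx hle
      _ ≤ C₀ * Ψ X * C₀ / Ψ 0 * Ψ y := by
        rw [div_mul_eq_mul_div, le_div_iff₀ h0, mul_assoc (C₀ * Ψ X)]
        gcongr
      _ ≤ _ := by
        rw [add_mul]
        exact le_add_of_nonneg_left (by positivity)

/-- Passing from x to √x costs a constant C and turns x^ε into x^(ε/2). Beyond a threshold X the
gained x^(ε/2) exceeds C, so the bound on [0, X] propagates to X^(2^n) for every n. -/
theorem EssIncreasing.le_rpow {Ψ : ℝ → ℝ} (hpos : ∀ x : ℝ, 0 ≤ x → 0 < Ψ x)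
    (hinc : EssIncreasing Ψ) (hsq : ∃ C : ℝ, 0 < C ∧ ∀ x : ℝ, 0 ≤ x → Ψ (x ^ 2) ≤ C * Ψ x)
    {ε : ℝ} (hε : 0 < ε) : ∃ C : ℝ, 0 < C ∧ ∀ x : ℝ, 0 ≤ x → Ψ x ≤ C * (1 + x) ^ ε := by
  obtain ⟨C₀, hC₀, hi⟩ := hinc
  obtain ⟨C, hC, hs⟩ := hsq
  set X : ℝ := max 2 (C ^ (2 / ε)) with hX
  have hX2 : 2 ≤ X := le_max_left _ _
  have hXC : C ≤ X ^ (ε / 2) := by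
    calc C = (C ^ (2 / ε)) ^ (ε / 2) := by
          rw [← Real.rpow_mul hC.le, div_mul_div_cancel₀ hε.ne', div_self two_ne_zero,
            Real.rpow_one]
      _ ≤ _ := by gcongr; exact le_max_right _ _
  set D := C₀ * Ψ X
  have hD : 0 < D := mul_pos hC₀ (hpos X (by linarith))
  have key : ∀ n : ℕ, ∀ x : ℝ, 0 ≤ x → x ≤ X ^ (2 ^ n) → Ψ x ≤ D * (max 1 x) ^ ε := by
    have small : ∀ x : ℝ, 0 ≤ x → x ≤ X → Ψ x ≤ D * (max 1 x) ^ ε := by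
      intro x hx hxX
      have : 1 ≤ (max 1 x) ^ ε := Real.one_le_rpow (le_max_left _ _) hε.le
      calc Ψ x ≤ D := hi _ _ hx hxX
        _ ≤ _ := le_mul_of_one_le_right hD.le this
    intro n
    induction n with
    | zero => intro x hx hxX; exact small x hx (by simpa using hxX)
    | succ n ih =>
      intro x hx hxX
      rcases le_or_gt x X with h | h
      · exact small x hx h
      have h1 : √x ≤ X ^ (2 ^ n) := by
        rw [Real.sqrt_le_left (by positivity), ← pow_mul, ← pow_succ]; exact hxX
      have h2 := ih _ (Real.sqrt_nonneg x) h1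
      have hx1 : 1 ≤ x := by linarith
      rw [max_eq_right (Real.one_le_sqrt.2 hx1)] at h2
      rw [max_eq_right hx1]
      have h3 : (√x) ^ ε = x ^ (ε / 2) := by
        rw [Real.sqrt_eq_rpow, ← Real.rpow_mul hx]; ring_nf
      have h4 : C ≤ x ^ (ε / 2) := hXC.trans (by gcongr)
      have h5 := hpos _ (Real.sqrt_nonneg x)
      calc Ψ x = Ψ ((√x) ^ 2) := by rw [Real.sq_sqrt hx]
        _ ≤ C * Ψ (√x) := hs _ (Real.sqrt_nonneg x)
        _ ≤ x ^ (ε / 2) * (D * x ^ (ε / 2)) := by rw [← h3] at h4 ⊢; gcongr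
        _ = D * (x ^ (ε / 2) * x ^ (ε / 2)) := by ring
        _ = D * x ^ ε := by rw [← Real.rpow_add (by linarith), add_halves]
  refine ⟨D, hD, fun x hx => ?_⟩
  obtain ⟨n, hn⟩ := pow_unbounded_of_one_lt x (by linarith : 1 < X)
  refine (key n x hx (hn.le.trans (pow_le_pow_right₀ (by linarith) Nat.lt_two_pow_self.le))).trans ?_
  gcongr
  exact max_le (by linarith) (by linarith)

/-- Measurable positive functions that vary slower than any power. -/
structure IsSlow (Ψ : ℝ → ℝ) : Prop where
  measurable : Measurable Ψ
  pos : ∀ x : ℝ, 0 ≤ x → 0 < Ψ x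
  comparable : ∀ A k : ℝ, ∃ C : ℝ, 0 < C ∧ ∀ x y : ℝ, 0 ≤ x → 0 ≤ y →
    x ≤ A * (1 + y) ^ k → y ≤ A * (1 + x) ^ k → Ψ x ≤ C * Ψ y
  upper : ∀ ε : ℝ, 0 < ε → ∃ C : ℝ, 0 < C ∧ ∀ x : ℝ, 0 ≤ x → Ψ x ≤ C * (1 + x) ^ ε
  lower : ∀ ε : ℝ, 0 < ε → ∃ C : ℝ, 0 < C ∧ ∀ x : ℝ, 0 ≤ x → 1 ≤ C * (1 + x) ^ ε * Ψ x

theorem EssDecreasing.inv {Ψ : ℝ → ℝ} (hpos : ∀ x : ℝ, 0 ≤ x → 0 < Ψ x)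
    (h : EssDecreasing Ψ) : EssIncreasing fun x => (Ψ x)⁻¹ := by
  obtain ⟨C, hC, h⟩ := h
  refine ⟨C, hC, fun x y hx hxy => ?_⟩
  have := h x y hx hxy
  have hy := hpos y (hx.trans hxy)
  have hx' := hpos x hx
  rw [← div_eq_mul_inv, le_div_iff₀ hy, inv_mul_le_iff₀ hx']
  linarith

/-- An essentially monotonic function need not be measurable, but its lower envelope, the infimum
over [x, ∞) or over [0, x], is monotone and comparable to it. The growth properties then transfer
through the comparison. -/
theorem ClassL.exists_isSlow {Ψ : ℝ → ℝ} (h : ClassL Ψ) :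
    ∃ Ψ₀ : ℝ → ℝ, IsSlow Ψ₀ ∧ ∃ C : ℝ, 0 < C ∧ ∀ x : ℝ, 0 ≤ x →
      Ψ x ≤ C * Ψ₀ x ∧ Ψ₀ x ≤ C * Ψ x := by
  have hpos := h.pos
  have hcomp : (∀ A k : ℝ, ∃ C : ℝ, 0 < C ∧ ∀ x y : ℝ, 0 ≤ x → 0 ≤ y →
      x ≤ A * (1 + y) ^ k → y ≤ A * (1 + x) ^ k → Ψ x ≤ C * Ψ y) ∧
      (∀ ε : ℝ, 0 < ε → ∃ C : ℝ, 0 < C ∧ ∀ x : ℝ, 0 ≤ x → Ψ x ≤ C * (1 + x) ^ ε) ∧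
      (∀ ε : ℝ, 0 < ε → ∃ C : ℝ, 0 < C ∧ ∀ x : ℝ, 0 ≤ x → 1 ≤ C * (1 + x) ^ ε * Ψ x) := by
    obtain ⟨S, hS, hsq⟩ := h.comparable_sq
    rcases h.ess_monotonic with hm | hm
    · have hs : ∃ C : ℝ, 0 < C ∧ ∀ x : ℝ, 0 ≤ x → Ψ (x ^ 2) ≤ C * Ψ x :=
        ⟨S, hS, fun x hx => (hsq x hx).2⟩
      refine ⟨fun A k => ?_, fun ε hε => hm.le_rpow hpos hs hε, fun ε hε => ?_⟩
      · obtain ⟨C, hC, hh⟩ := hm.le_of_le_rpow hpos hs A k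
        exact ⟨C, hC, fun x y hx hy h1 _ => hh x y hx hy h1⟩
      · obtain ⟨C, hC, hm⟩ := hm
        refine ⟨C / Ψ 0, div_pos hC (hpos 0 le_rfl), fun x hx => ?_⟩
        have h1 := hm 0 x le_rfl hx
        have h2 : 1 ≤ (1 + x) ^ ε := Real.one_le_rpow (by linarith) hε.le
        have h0 := hpos 0 le_rfl
        have hx' := hpos x hx
        rw [div_mul_eq_mul_div, div_mul_eq_mul_div, one_le_div h0]
        calc Ψ 0 ≤ C * 1 * Ψ x := by simpa using h1
          _ ≤ _ := by gcongr
    -- The decreasing case is the increasing one for 1/Ψ; upper and lower bounds change roles.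
    · have hm' := hm.inv hpos
      have hpos' : ∀ x : ℝ, 0 ≤ x → 0 < (Ψ x)⁻¹ := fun x hx => inv_pos.2 (hpos x hx)
      have hs : ∃ C : ℝ, 0 < C ∧ ∀ x : ℝ, 0 ≤ x → (Ψ (x ^ 2))⁻¹ ≤ C * (Ψ x)⁻¹ := by
        refine ⟨S, hS, fun x hx => ?_⟩
        have h1 := (hsq x hx).1
        have h2 := hpos x hx
        have h3 := hpos (x ^ 2) (by positivity)
        rw [← div_eq_mul_inv, le_div_iff₀ h2, inv_mul_le_iff₀ h3]
        linarith
      refine ⟨fun A k => ?_, fun ε hε => ?_, fun ε hε => ?_⟩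
      · obtain ⟨C, hC, hh⟩ := hm'.le_of_le_rpow hpos' hs A k
        refine ⟨C, hC, fun x y hx hy _ h1 => ?_⟩
        have := hh y x hy hx h1
        have h2 := hpos x hx
        have h3 := hpos y hy
        rw [← div_eq_mul_inv, le_div_iff₀ h2, inv_mul_le_iff₀ h3] at this
        linarith
      · obtain ⟨C, hC, hm⟩ := hm
        have h0 := hpos 0 le_rfl
        refine ⟨C * Ψ 0, by positivity, fun x hx => ?_⟩
        have h2 : 1 ≤ (1 + x) ^ ε := Real.one_le_rpow (by linarith) hε.le
        exact (hm 0 x le_rfl hx).trans (le_mul_of_one_le_right (by positivity) h2)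
      · obtain ⟨C, hC, hh⟩ := hm'.le_rpow hpos' hs hε
        refine ⟨C, hC, fun x hx => ?_⟩
        have := hh x hx
        rwa [inv_le_iff_one_le_mul₀ (hpos x hx)] at this
  have hmeas : ∃ Ψ₀ : ℝ → ℝ, Measurable Ψ₀ ∧ ∃ C : ℝ, 0 < C ∧ ∀ x : ℝ, 0 ≤ x →
      Ψ x ≤ C * Ψ₀ x ∧ Ψ₀ x ≤ C * Ψ x := by
    rcases h.ess_monotonic with ⟨C, hC, hm⟩ | ⟨C, hC, hm⟩
    · have hne : ∀ x : ℝ, (Ψ '' Set.Ici (max x 0)).Nonempty := fun x =>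
        ⟨_, Set.mem_image_of_mem _ Set.self_mem_Ici⟩
      have hbdd : ∀ x : ℝ, BddBelow (Ψ '' Set.Ici (max x 0)) := by
        intro x
        refine ⟨0, ?_⟩
        rintro _ ⟨y, hy, rfl⟩
        exact (hpos y ((le_max_right _ _).trans hy)).le
      refine ⟨fun x => sInf (Ψ '' Set.Ici (max x 0)), ?_, max C 1, by positivity,
        fun x hx => ⟨?_, ?_⟩⟩
      · refine Monotone.measurable fun x y hxy => ?_
        exact csInf_le_csInf (hbdd x) (hne y)
          (Set.image_mono (Set.Ici_subset_Ici.2 (max_le_max_right 0 hxy)))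
      · rw [← inv_mul_le_iff₀ (by positivity)]
        refine le_csInf (hne x) ?_
        rintro _ ⟨y, hy, rfl⟩
        rw [max_eq_left hx] at hy
        rw [inv_mul_le_iff₀ (by positivity)]
        refine (hm x y hx hy).trans ?_
        have := hpos y (hx.trans hy)
        gcongr
        exact le_max_left _ _
      · refine (csInf_le (hbdd x) ⟨x, by simp [hx], rfl⟩).trans ?_
        exact le_mul_of_one_le_left (hpos x hx).le (le_max_right _ _)
    · have hne : ∀ x : ℝ, (Ψ '' Set.Icc 0 (max x 0)).Nonempty := fun x =>
        ⟨_, Set.mem_image_of_mem _ (Set.left_mem_Icc.2 (le_max_right _ _))⟩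
      have hbdd : ∀ x : ℝ, BddBelow (Ψ '' Set.Icc 0 (max x 0)) := by
        intro x
        refine ⟨0, ?_⟩
        rintro _ ⟨y, hy, rfl⟩
        exact (hpos y hy.1).le
      refine ⟨fun x => sInf (Ψ '' Set.Icc 0 (max x 0)), ?_, max C 1, by positivity,
        fun x hx => ⟨?_, ?_⟩⟩
      · refine Antitone.measurable fun x y hxy => ?_
        exact csInf_le_csInf (hbdd y) (hne x)
          (Set.image_mono (Set.Icc_subset_Icc_right (max_le_max_right 0 hxy)))
      · rw [← inv_mul_le_iff₀ (by positivity)]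
        refine le_csInf (hne x) ?_
        rintro _ ⟨y, hy, rfl⟩
        rw [max_eq_left hx] at hy
        rw [inv_mul_le_iff₀ (by positivity)]
        refine (hm y x hy.1 hy.2).trans ?_
        have := hpos y hy.1
        gcongr
        exact le_max_left _ _
      · refine (csInf_le (hbdd x) ⟨x, by simp [hx], rfl⟩).trans ?_
        exact le_mul_of_one_le_left (hpos x hx).le (le_max_right _ _)
  obtain ⟨Ψ₀, hΨ₀, D, hD, hcmp⟩ := hmeas
  have hpos₀ : ∀ x : ℝ, 0 ≤ x → 0 < Ψ₀ x := fun x hx =>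
    pos_of_mul_pos_right ((hpos x hx).trans_le (hcmp x hx).1) hD.le
  refine ⟨Ψ₀, ⟨hΨ₀, hpos₀, fun A k => ?_, fun ε hε => ?_, fun ε hε => ?_⟩, D, hD, hcmp⟩
  · obtain ⟨C, hC, hh⟩ := hcomp.1 A k
    refine ⟨D * (C * D), by positivity, fun x y hx hy h1 h2 => ?_⟩
    calc Ψ₀ x ≤ D * Ψ x := (hcmp x hx).2
      _ ≤ D * (C * (D * Ψ₀ y)) := by
        gcongr
        exact (hh x y hx hy h1 h2).trans (by gcongr; exact (hcmp y hy).1)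
      _ = _ := by ring
  · obtain ⟨C, hC, hh⟩ := hcomp.2.1 ε hε
    refine ⟨D * C, by positivity, fun x hx => (hcmp x hx).2.trans ?_⟩
    rw [mul_assoc]; gcongr; exact hh x hx
  · obtain ⟨C, hC, hh⟩ := hcomp.2.2 ε hε
    refine ⟨D * C, by positivity, fun x hx => (hh x hx).trans ?_⟩
    calc C * (1 + x) ^ ε * Ψ x ≤ C * (1 + x) ^ ε * (D * Ψ₀ x) := by
          have : (0:ℝ) ≤ (1 + x) ^ ε := by positivity
          gcongr; exact (hcmp x hx).1
      _ = _ := by ring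

namespace IsSlow

variable {Ψ : ℝ → ℝ}

theorem comparable_of_le (h : IsSlow Ψ) {A A' k k' : ℝ} :
    ∃ C : ℝ, 0 < C ∧ ∀ x y : ℝ, 0 ≤ x → 0 ≤ y →
      x ≤ A * (1 + y) ^ k → y ≤ A' * (1 + x) ^ k' → Ψ x ≤ C * Ψ y ∧ Ψ y ≤ C * Ψ x := by
  obtain ⟨C, hC, hh⟩ := h.comparable (max A A') (max k k')
  refine ⟨C, hC, fun x y hx hy h1 h2 => ?_⟩
  have e1 : x ≤ max A A' * (1 + y) ^ max k k' := by
    have p1 : (1 + y) ^ k ≤ (1 + y) ^ max k k' :=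
      Real.rpow_le_rpow_of_exponent_le (by linarith) (le_max_left _ _)
    have p0 : 0 < (1 + y) ^ k := by positivity
    have : 0 ≤ A := by
      by_contra! hA
      nlinarith [mul_neg_of_neg_of_pos hA p0]
    refine h1.trans ?_
    gcongr
    exact le_max_left _ _
  have e2 : y ≤ max A A' * (1 + x) ^ max k k' := by
    have p1 : (1 + x) ^ k' ≤ (1 + x) ^ max k k' :=
      Real.rpow_le_rpow_of_exponent_le (by linarith) (le_max_right _ _)
    have p0 : 0 < (1 + x) ^ k' := by positivity
    have : 0 ≤ A' := by
      by_contra! hA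
      nlinarith [mul_neg_of_neg_of_pos hA p0]
    refine h2.trans ?_
    gcongr
    exact le_max_right _ _
  exact ⟨hh x y hx hy e1 e2, hh y x hy hx e2 e1⟩

/-- `x ^ ε * Ψ x` is almost increasing. -/
theorem rpow_mul_le (h : IsSlow Ψ) {ε : ℝ} (hε : 0 < ε) : ∃ C : ℝ, 0 < C ∧ ∀ x y : ℝ, 0 ≤ x →
    x ≤ y → x ^ ε * Ψ x ≤ C * (y ^ ε * Ψ y) := by
  obtain ⟨C₁, hC₁, h1⟩ := h.comparable_of_le (A := 1) (A' := 1) (k := 0) (k' := 0)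
  obtain ⟨C₂, hC₂, h2⟩ := h.comparable_of_le (A := 1) (A' := 1) (k := 2) (k' := 2)
  obtain ⟨C₃, hC₃, h3⟩ := h.upper (ε / 4) (by positivity)
  obtain ⟨C₄, hC₄, h4⟩ := h.lower (ε / 4) (by positivity)
  have h2ε : (0:ℝ) < 2 ^ (ε / 2) := by positivity
  refine ⟨C₁ + C₂ + C₃ * C₄ * 2 ^ (ε / 2), by positivity, fun x y hx hxy => ?_⟩
  have hy : 0 ≤ y := hx.trans hxy
  have hΨx := h.pos x hx
  have hΨy := h.pos y hy
  have hxe : x ^ ε ≤ y ^ ε := by gcongr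
  have hxe0 : 0 ≤ x ^ ε := by positivity
  have hye0 : 0 ≤ y ^ ε := by positivity
  have step : ∀ D : ℝ, 0 < D → Ψ x ≤ D * Ψ y → x ^ ε * Ψ x ≤ D * (y ^ ε * Ψ y) := by
    intro D hD hle
    calc x ^ ε * Ψ x ≤ y ^ ε * (D * Ψ y) := by gcongr
      _ = _ := by ring
  have hyΨ : 0 ≤ y ^ ε * Ψ y := by positivity
  rcases le_or_gt y 1 with hy1 | hy1
  · refine (step C₁ hC₁ (h1 x y hx hy ?_ ?_).1).trans ?_
    · simpa using hxy.trans hy1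
    · simpa using hy1
    · gcongr
      nlinarith [mul_pos (mul_pos hC₃ hC₄) h2ε]
  rcases le_or_gt y (x ^ 2) with hyx | hyx
  · refine (step C₂ hC₂ (h2 x y hx hy ?_ ?_).1).trans ?_
    · rw [one_mul, Real.rpow_two]; nlinarith
    · rw [one_mul, Real.rpow_two]; nlinarith
    · gcongr
      nlinarith [mul_pos (mul_pos hC₃ hC₄) h2ε]
  -- Here y > x², so x^ε uses up only half of y^ε. The two slow factors cost y^(ε/4) each and fill
  -- the other half.
  · have e1 : x ^ ε ≤ y ^ (ε / 2) := by
      calc x ^ ε = (x ^ 2) ^ (ε / 2) := by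
            rw [← Real.rpow_two, ← Real.rpow_mul hx]; ring_nf
        _ ≤ _ := by gcongr
    have e2 : (1 + x) ^ (ε / 4) ≤ (2 * y) ^ (ε / 4) := by gcongr; linarith
    have e3 : (1 + y) ^ (ε / 4) ≤ (2 * y) ^ (ε / 4) := by gcongr; linarith
    have e4 : (2 * y) ^ (ε / 4) * (2 * y) ^ (ε / 4) = 2 ^ (ε / 2) * y ^ (ε / 2) := by
      rw [← Real.rpow_add (by linarith), ← Real.mul_rpow (by norm_num) hy]; ring_nf
    have e5 : y ^ (ε / 2) * y ^ (ε / 2) = y ^ ε := by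
      rw [← Real.rpow_add (by linarith), add_halves]
    calc x ^ ε * Ψ x ≤ y ^ (ε / 2) * (C₃ * (2 * y) ^ (ε / 4)) := by
          gcongr
          exact (h3 x hx).trans (by gcongr)
      _ ≤ y ^ (ε / 2) * (C₃ * (2 * y) ^ (ε / 4)) * (C₄ * (2 * y) ^ (ε / 4) * Ψ y) := by
          refine le_mul_of_one_le_right (by positivity) ((h4 y hy).trans (by gcongr))
      _ = C₃ * C₄ * ((2 * y) ^ (ε / 4) * (2 * y) ^ (ε / 4)) * y ^ (ε / 2) * Ψ y := by ring
      _ = C₃ * C₄ * 2 ^ (ε / 2) * ((y ^ (ε / 2) * y ^ (ε / 2)) * Ψ y) := by rw [e4]; ring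
      _ = C₃ * C₄ * 2 ^ (ε / 2) * (y ^ ε * Ψ y) := by rw [e5]
      _ ≤ _ := by gcongr; linarith

theorem rpow_mul_le_of_le_mul (h : IsSlow Ψ) {ε : ℝ} (hε : 0 < ε) {L : ℝ} (hL : 1 ≤ L) :
    ∃ C : ℝ, 0 < C ∧ ∀ x y : ℝ, 0 ≤ x → 0 ≤ y → x ≤ L * y →
      x ^ ε * Ψ x ≤ C * (y ^ ε * Ψ y) := by
  obtain ⟨C, hC, hh⟩ := h.rpow_mul_le hε
  obtain ⟨D, hD, hd⟩ := h.comparable_of_le (A := L) (A' := L) (k := 1) (k' := 1)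
  refine ⟨C * (L ^ ε * D), by positivity, fun x y hx hy hxy => (hh x _ hx hxy).trans ?_⟩
  have h1 := (hd (L * y) y (by positivity) hy (by rw [Real.rpow_one]; nlinarith)
    (by rw [Real.rpow_one]; nlinarith [mul_nonneg (by linarith : 0 ≤ L) hy])).1
  rw [Real.mul_rpow (by linarith) hy]
  have h2 : 0 ≤ L ^ ε := by positivity
  have h3 : 0 ≤ y ^ ε := by positivity
  calc C * (L ^ ε * y ^ ε * Ψ (L * y)) ≤ C * (L ^ ε * y ^ ε * (D * Ψ y)) := by gcongr
    _ = _ := by ring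

/-- An x between powers t^(-ε) and t^(-B) is polynomially related to 1/t. Through this lemma |f(z)|,
1/ω(S(a)) and the test amplitudes are all exchanged for 1/t. -/
theorem comparable_inv_of_between (h : IsSlow Ψ) {a A ε B : ℝ} (ha : 0 < a) (hε : 0 < ε)
    (hB : 0 ≤ B) : ∃ C : ℝ, 0 < C ∧ ∀ t x : ℝ, 0 < t → t ≤ 1 →
      a * t ^ (-ε) ≤ x → x ≤ A * t ^ (-B) → Ψ x ≤ C * Ψ (1 / t) ∧ Ψ (1 / t) ≤ C * Ψ x := by
  obtain ⟨C, hC, hh⟩ := h.comparable_of_le (A := max A 0) (A' := a⁻¹ ^ (1 / ε)) (k := B)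
    (k' := 1 / ε)
  refine ⟨C, hC, fun t x ht ht1 h1 h2 => ?_⟩
  have hx : 0 ≤ x := le_trans (by positivity) h1
  refine hh x (1 / t) hx (by positivity) ?_ ?_
  · calc x ≤ A * t ^ (-B) := h2
      _ ≤ max A 0 * (1 / t) ^ B := by
        rw [one_div, Real.inv_rpow ht.le, Real.rpow_neg ht.le]
        gcongr
        exact le_max_left _ _
      _ ≤ _ := by gcongr; linarith
  · calc 1 / t = (t ^ (-ε)) ^ (1 / ε) := by
          rw [← Real.rpow_mul ht.le, neg_mul, mul_one_div_cancel hε.ne', Real.rpow_neg_one, one_div]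
      _ ≤ (a⁻¹ * (1 + x)) ^ (1 / ε) := by
          gcongr
          rw [inv_mul_eq_div, le_div_iff₀ ha]
          linarith
      _ = _ := by rw [Real.mul_rpow (by positivity) (by linarith)]

theorem comparable_inv (h : IsSlow Ψ) (L : ℝ) : ∃ C : ℝ, 0 < C ∧ ∀ s t : ℝ, 0 < s → 0 < t →
    s ≤ L * t → t ≤ L * s → Ψ (1 / s) ≤ C * Ψ (1 / t) := by
  obtain ⟨C, hC, hh⟩ := h.comparable_of_le (A := L) (A' := L) (k := 1) (k' := 1)
  refine ⟨C, hC, fun s t hs ht h1 h2 => (hh _ _ (by positivity) (by positivity) ?_ ?_).1⟩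
  all_goals
    have hL : 0 ≤ L := by
      by_contra! hL
      nlinarith [mul_neg_of_neg_of_pos hL ht]
    rw [Real.rpow_one]
  · calc 1 / s ≤ L * (1 / t) := by
          rw [mul_one_div, div_le_div_iff₀ hs ht]; linarith
      _ ≤ _ := by gcongr; linarith
  · calc 1 / t ≤ L * (1 / s) := by
          rw [mul_one_div, div_le_div_iff₀ ht hs]; linarith
      _ ≤ _ := by gcongr; linarith

theorem inv_le (h : IsSlow Ψ) {ε : ℝ} (hε : 0 < ε) : ∃ C : ℝ, 0 < C ∧ ∀ t : ℝ, 0 < t → t ≤ 1 →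
    Ψ (1 / t) ≤ C * t ^ (-ε) := by
  obtain ⟨C, hC, hh⟩ := h.upper ε hε
  refine ⟨C * 2 ^ ε, by positivity, fun t ht ht1 => (hh _ (by positivity)).trans ?_⟩
  rw [mul_assoc, Real.rpow_neg ht.le, ← Real.inv_rpow ht.le,
    ← Real.mul_rpow (by norm_num) (by positivity)]
  gcongr
  have : 1 ≤ t⁻¹ := (one_le_inv₀ ht).2 ht1
  rw [one_div]; linarith

theorem le_inv (h : IsSlow Ψ) {ε : ℝ} (hε : 0 < ε) : ∃ C : ℝ, 0 < C ∧ ∀ t : ℝ, 0 < t → t ≤ 1 →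
    t ^ ε ≤ C * Ψ (1 / t) := by
  obtain ⟨C, hC, hh⟩ := h.lower ε hε
  refine ⟨C * 2 ^ ε, by positivity, fun t ht ht1 => ?_⟩
  have h1 := hh (1 / t) (by positivity)
  have hp := h.pos (1 / t) (by positivity)
  have h2 : (1 + 1 / t) ^ ε ≤ (2 / t) ^ ε := by
    gcongr
    rw [add_div' _ _ _ ht.ne', div_le_div_iff_of_pos_right ht]; linarith
  calc t ^ ε = t ^ ε * 1 := by ring
    _ ≤ t ^ ε * (C * (2 / t) ^ ε * Ψ (1 / t)) := by
      gcongr; exact h1.trans (by gcongr)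
    _ = _ := by
      rw [Real.div_rpow (by norm_num) ht.le]
      have : t ^ ε ≠ 0 := by positivity
      field_simp

end IsSlow

/-! ### Subharmonicity of |f|^p and monotonicity of circular means -/

-- Where f(z) ≠ 0, the quotient f / f(z) stays near 1, hence in the slit plane, and its principal
-- p-th power is analytic; the mean value property and the triangle inequality finish. Zeros are
-- trivial. Small radii are enough for the maximum principle.
open Metric in
theorem eventually_norm_rpow_le_circleAverage {f : ℂ → ℂ} {U : Set ℂ} (hU : IsOpen U)
    (hf : DifferentiableOn ℂ f U) {p : ℝ} (hp : 0 < p) {z : ℂ} (hz : z ∈ U) :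
    ∀ᶠ r : ℝ in 𝓝[>] 0, ‖f z‖ ^ p ≤ Real.circleAverage (fun w => ‖f w‖ ^ p) z r := by
  by_cases h0 : f z = 0
  · refine Eventually.of_forall fun r => ?_
    rw [h0, norm_zero, Real.zero_rpow hp.ne']
    exact Real.circleAverage_nonneg_of_nonneg fun w _ => by positivity
  have hcont : ContinuousAt f z := (hf.differentiableAt (hU.mem_nhds hz)).continuousAt
  have h1 : ∀ᶠ w in 𝓝 z, f w / f z ∈ Complex.slitPlane := by
    have : ContinuousAt (fun w => f w / f z) z := hcont.div_const _
    refine this.eventually_mem (Complex.isOpen_slitPlane.mem_nhds ?_)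
    rw [div_self h0]; exact Complex.one_mem_slitPlane
  obtain ⟨δ, hδ, hball⟩ := Metric.eventually_nhds_iff_ball.1 (h1.and (hU.mem_nhds hz))
  have hmem : Set.Ioo (0 : ℝ) δ ∈ 𝓝[>] (0 : ℝ) := Ioo_mem_nhdsGT hδ
  filter_upwards [hmem] with r hr
  set G : ℂ → ℂ := fun w => (f w / f z) ^ (p : ℂ) with hG
  have hsub : closedBall z |r| ⊆ ball z δ := by
    rw [abs_of_pos hr.1]; exact closedBall_subset_ball hr.2
  have hGd : DifferentiableOn ℂ G (closedBall z |r|) := by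
    intro w hw
    have hw' := hball w (hsub hw)
    have hfw := (hf.differentiableAt (hU.mem_nhds hw'.2))
    exact ((hfw.div_const _).cpow_const hw'.1).differentiableWithinAt
  have hGc : DiffContOnCl ℂ G (ball z |r|) := by
    refine DifferentiableOn.diffContOnCl (hGd.mono ?_)
    exact closure_ball_subset_closedBall
  have havg : Real.circleAverage G z r = 1 := by
    rw [hGc.circleAverage, hG]
    simp [div_self h0]
  have hGcont : ContinuousOn G (sphere z |r|) := hGd.continuousOn.mono sphere_subset_closedBall
  have hle : ‖Real.circleAverage G z r‖ ≤ Real.circleAverage (fun w => ‖G w‖) z r := by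
    rw [Real.circleAverage_def, Real.circleAverage_def, norm_smul, smul_eq_mul,
      Real.norm_of_nonneg (by positivity)]
    gcongr
    exact intervalIntegral.norm_integral_le_integral_norm Real.two_pi_pos.le
  rw [havg, norm_one] at hle
  have hGn : (fun w => ‖f w‖ ^ p) = fun w => ‖f z‖ ^ p • ‖G w‖ := by
    ext w
    rw [hG]
    simp only [Complex.norm_cpow_real, norm_div, smul_eq_mul]
    rw [Real.div_rpow (norm_nonneg _) (norm_nonneg _)]
    have : ‖f z‖ ^ p ≠ 0 := (Real.rpow_pos_of_pos (norm_pos_iff.2 h0) p).ne'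
    field_simp
  rw [hGn, Real.circleAverage_fun_smul, smul_eq_mul]
  exact le_mul_of_one_le_right (by positivity) hle

open Metric in
/-- Maximum principle for continuous functions with the local sub-mean value property. -/
theorem exists_mem_sphere_le_of_subMean {u : ℂ → ℝ} {ρ : ℝ}
    (hu : ContinuousOn u (closedBall 0 ρ))
    (hsub : ∀ z ∈ ball (0 : ℂ) ρ, ∀ᶠ r : ℝ in 𝓝[>] 0, u z ≤ Real.circleAverage u z r)
    {z : ℂ} (hz : z ∈ closedBall (0 : ℂ) ρ) : ∃ w ∈ sphere (0 : ℂ) ρ, u z ≤ u w := by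
  obtain ⟨m, hm, hmax⟩ := (isCompact_closedBall (0 : ℂ) ρ).exists_isMaxOn ⟨z, hz⟩ hu
  set S : Set ℂ := closedBall 0 ρ ∩ u ⁻¹' {u m} with hS
  have hSc : IsCompact S :=
    (isCompact_closedBall (0 : ℂ) ρ).of_isClosed_subset
      (hu.preimage_isClosed_of_isClosed isClosed_closedBall isClosed_singleton)
      Set.inter_subset_left
  -- Among all maximum points take one of largest modulus. If it were interior, every small circle
  -- around it would reach further out, where u is strictly below its maximum, so the mean over that
  -- circle would be too small.
  obtain ⟨w, hw, hwmax⟩ := hSc.exists_isMaxOn ⟨m, hm, rfl⟩ continuous_norm.continuousOn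
  have hwm : u w = u m := hw.2
  refine ⟨w, ?_, hwm ▸ hmax hz⟩
  by_contra hns
  have hwb : w ∈ ball (0 : ℂ) ρ := by
    have h1 := hw.1
    rw [mem_closedBall_zero_iff] at h1
    rw [mem_sphere_zero_iff_norm] at hns
    rw [mem_ball_zero_iff]
    exact lt_of_le_of_ne h1 hns
  have hwρ := mem_ball_zero_iff.1 hwb
  have hmem : Set.Ioo (0 : ℝ) (ρ - ‖w‖) ∈ 𝓝[>] (0 : ℝ) := Ioo_mem_nhdsGT (by linarith)
  obtain ⟨r, hr, hrs⟩ := ((eventually_mem_set.2 hmem).and (hsub w hwb)).exists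
  have hin : ∀ θ : ℝ, circleMap w r θ ∈ closedBall (0 : ℂ) ρ := by
    intro θ
    rw [mem_closedBall_zero_iff, circleMap]
    refine (norm_add_le _ _).trans ?_
    rw [norm_mul, Complex.norm_exp_ofReal_mul_I, Complex.norm_real, Real.norm_of_nonneg hr.1.le]
    linarith [hr.2]
  have hcont : Continuous fun θ => u (circleMap w r θ) :=
    hu.comp_continuous (continuous_circleMap w r) hin
  obtain ⟨θ₀, hθ₀, hnorm⟩ : ∃ θ ∈ Set.Icc (0 : ℝ) (2 * Real.pi), ‖w‖ < ‖circleMap w r θ‖ := by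
    obtain ⟨θ, hθ, hmap⟩ :=
      (periodic_circleMap w r).exists_mem_Ioc Real.two_pi_pos w.arg 0
    refine ⟨θ, ⟨hθ.1.le, by linarith [hθ.2]⟩, ?_⟩
    have : circleMap w r θ = ((‖w‖ + r : ℝ) : ℂ) * Complex.exp (w.arg * Complex.I) := by
      rw [← hmap, circleMap]
      nth_rw 1 [← Complex.norm_mul_exp_arg_mul_I w]
      push_cast; ring
    rw [this, norm_mul, Complex.norm_exp_ofReal_mul_I, Complex.norm_real,
      Real.norm_of_nonneg (by linarith [norm_nonneg w, hr.1])]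
    linarith [hr.1]
  have hlt : u (circleMap w r θ₀) < u m := by
    refine lt_of_le_of_ne (hmax (hin θ₀)) fun heq => ?_
    have : ‖circleMap w r θ₀‖ ≤ ‖w‖ := hwmax ⟨hin θ₀, heq⟩
    linarith
  have hint := intervalIntegral.integral_lt_integral_of_continuousOn_of_le_of_exists_lt
    Real.two_pi_pos hcont.continuousOn (continuousOn_const (c := u m))
    (fun θ _ => hmax (hin θ)) ⟨θ₀, hθ₀, hlt⟩
  rw [intervalIntegral.integral_const, smul_eq_mul, sub_zero] at hint
  rw [Real.circleAverage_def, smul_eq_mul, hwm, ← div_eq_inv_mul,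
    le_div_iff₀ Real.two_pi_pos] at hrs
  linarith

/-- Uniformity in the starting angle α is the point: it will be evaluated at an angle that depends
on N. -/
theorem riemann_sum_periodic {g : ℝ → ℝ} (huc : UniformContinuous g)
    (hper : Function.Periodic g (2 * Real.pi)) {ε : ℝ} (hε : 0 < ε) :
    ∀ᶠ N : ℕ in atTop, ∀ α : ℝ,
      |(N : ℝ)⁻¹ * ∑ j ∈ Finset.range N, g (α + 2 * Real.pi * j / N) -
        (2 * Real.pi)⁻¹ * ∫ θ in 0..2 * Real.pi, g θ| ≤ ε := by
  have hg := huc.continuous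
  obtain ⟨δ, hδ, hd⟩ := Metric.uniformContinuous_iff.1 huc ε hε
  have hev : ∀ᶠ N : ℕ in atTop, 2 * Real.pi / N < δ :=
    (tendsto_const_div_atTop_nhds_zero_nat (2 * Real.pi)).eventually_lt_const hδ
  filter_upwards [hev, eventually_gt_atTop 0] with N hN hN0 α
  have hNr : (0 : ℝ) < N := by exact_mod_cast hN0
  set a : ℕ → ℝ := fun j => α + 2 * Real.pi * j / N with ha
  have hstep : ∀ j, a (j + 1) - a j = 2 * Real.pi / N := by
    intro j; simp only [ha]; push_cast; field_simp; ring
  have hint : ∫ θ in 0..2 * Real.pi, g θ = ∑ j ∈ Finset.range N, ∫ θ in a j..a (j + 1), g θ := by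
    rw [intervalIntegral.sum_integral_adjacent_intervals
      (fun k _ => hg.intervalIntegrable _ _)]
    have h0 : a 0 = α := by simp [ha]
    have h1 : a N = α + 2 * Real.pi := by simp only [ha]; field_simp
    rw [h0, h1, hper.intervalIntegral_add_eq α 0, zero_add]
  have hterm : ∀ j, |(2 * Real.pi / N) * g (a j) - ∫ θ in a j..a (j + 1), g θ| ≤
      ε * (2 * Real.pi / N) := by
    intro j
    have hle : a j ≤ a (j + 1) := by
      have := hstep j
      have : 0 < 2 * Real.pi / N := by positivity
      linarith
    have e1 : (2 * Real.pi / N) * g (a j) - ∫ θ in a j..a (j + 1), g θ =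
        ∫ θ in a j..a (j + 1), (g (a j) - g θ) := by
      rw [intervalIntegral.integral_sub (by simp) (hg.intervalIntegrable _ _),
        intervalIntegral.integral_const, hstep, smul_eq_mul]
    rw [e1]
    have := intervalIntegral.norm_integral_le_of_norm_le_const (a := a j) (b := a (j + 1))
      (f := fun θ => g (a j) - g θ) (C := ε) ?_
    · rw [hstep, abs_of_pos (by positivity : 0 < 2 * Real.pi / N)] at this
      exact this
    · intro θ hθ
      rw [Set.uIoc_of_le hle] at hθ
      have hdist : dist (a j) θ < δ := by
        rw [dist_comm, Real.dist_eq, abs_of_nonneg (by linarith [hθ.1])]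
        linarith [hθ.2, hstep j]
      exact (hd hdist).le
  have e2 : (N : ℝ)⁻¹ * ∑ j ∈ Finset.range N, g (α + 2 * Real.pi * j / N) -
        (2 * Real.pi)⁻¹ * ∫ θ in 0..2 * Real.pi, g θ =
      (2 * Real.pi)⁻¹ * ∑ j ∈ Finset.range N,
        ((2 * Real.pi / N) * g (a j) - ∫ θ in a j..a (j + 1), g θ) := by
    rw [hint, Finset.sum_sub_distrib, ← Finset.mul_sum, mul_sub, ← mul_assoc]
    congr 2
    field_simp
  rw [e2, abs_mul, abs_of_pos (by positivity : 0 < (2 * Real.pi)⁻¹)]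
  calc _ ≤ (2 * Real.pi)⁻¹ * ∑ j ∈ Finset.range N, ε * (2 * Real.pi / N) := by
        gcongr
        exact (Finset.abs_sum_le_sum_abs _ _).trans (Finset.sum_le_sum fun j _ => hterm j)
    _ = ε := by
        rw [Finset.sum_const, Finset.card_range, nsmul_eq_mul]
        have := Real.pi_pos.ne'
        field_simp

-- The integral mean is replaced by the average u of |f|^p over N equally spaced rotations. As a
-- finite sum, u is continuous and locally sub-mean, so the maximum principle compares its value at
-- r with its value at some point w of modulus ρ. For large N both values are within ε/2 of the
-- circular means.
open Metric in
theorem circleAverage_norm_rpow_mono_zero {f : ℂ → ℂ} {R p : ℝ} (hp : 0 < p)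
    (hf : DifferentiableOn ℂ f (ball 0 R)) {r ρ : ℝ} (hr : 0 ≤ r) (hrρ : r ≤ ρ) (hρR : ρ < R) :
    Real.circleAverage (fun z => ‖f z‖ ^ p) 0 r ≤ Real.circleAverage (fun z => ‖f z‖ ^ p) 0 ρ := by
  rcases hrρ.eq_or_lt with rfl | hlt
  · rfl
  have hρ : 0 < ρ := hr.trans_lt hlt
  have hcb : closedBall (0 : ℂ) ρ ⊆ ball 0 R := closedBall_subset_ball hρR
  have hcm : ∀ s : ℝ, 0 ≤ s → s ≤ ρ → ∀ θ, circleMap 0 s θ ∈ closedBall (0 : ℂ) ρ := by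
    intro s hs hsρ θ
    rw [mem_closedBall_zero_iff, norm_circleMap_zero, abs_of_nonneg hs]
    exact hsρ
  have hgc : ContinuousOn (fun z => ‖f z‖ ^ p) (ball 0 R) :=
    hf.continuousOn.norm.rpow_const fun _ _ => Or.inr hp.le
  have hcont : ∀ s : ℝ, 0 ≤ s → s ≤ ρ →
      UniformContinuous fun θ => ‖f (circleMap 0 s θ)‖ ^ p := by
    intro s hs hsρ
    have h1 := (isCompact_closedBall (0 : ℂ) ρ).uniformContinuousOn_of_continuous (hgc.mono hcb)
    rw [Metric.uniformContinuousOn_iff] at h1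
    have h2 := Metric.uniformContinuous_iff.1 (lipschitzWith_circleMap 0 s).uniformContinuous
    refine Metric.uniformContinuous_iff.2 fun ε hε => ?_
    obtain ⟨δ, hδ, hd⟩ := h1 ε hε
    obtain ⟨η, hη, hh⟩ := h2 δ hδ
    exact ⟨η, hη, fun a b hab => hd _ (hcm s hs hsρ a) _ (hcm s hs hsρ b) (hh hab)⟩
  have hperi : ∀ s : ℝ, Function.Periodic (fun θ => ‖f (circleMap 0 s θ)‖ ^ p) (2 * Real.pi) :=
    fun s => (periodic_circleMap 0 s).comp fun z => ‖f z‖ ^ p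
  refine le_of_forall_pos_le_add fun ε hε => ?_
  obtain ⟨N, ⟨h1, h2⟩, hN0⟩ := (((riemann_sum_periodic (hcont r hr hrρ) (hperi r)
    (half_pos hε)).and (riemann_sum_periodic (hcont ρ hρ.le le_rfl) (hperi ρ)
    (half_pos hε))).and (eventually_gt_atTop 0)).exists
  set e : ℕ → ℂ := fun j => Complex.exp (((2 * Real.pi * j / N : ℝ) : ℂ) * Complex.I) with he
  have hen : ∀ j, ‖e j‖ = 1 := fun j => Complex.norm_exp_ofReal_mul_I _
  set u : ℂ → ℝ := fun z => (N : ℝ)⁻¹ * ∑ j ∈ Finset.range N, ‖f (z * e j)‖ ^ p with hu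
  have hue : ∀ s α : ℝ, u (circleMap 0 s α) = (N : ℝ)⁻¹ * ∑ j ∈ Finset.range N,
      ‖f (circleMap 0 s (α + 2 * Real.pi * j / N))‖ ^ p := by
    intro s α
    simp only [hu, he]
    congr 1
    refine Finset.sum_congr rfl fun j _ => ?_
    rw [circleMap_zero, circleMap_zero, mul_assoc, ← Complex.exp_add]
    congr 4
    push_cast; ring_nf
  have hmaps : ∀ j, Set.MapsTo (fun z => z * e j) (ball (0 : ℂ) R) (ball 0 R) := by
    intro j z hz
    rw [mem_ball_zero_iff] at hz ⊢
    rwa [norm_mul, hen, mul_one]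
  have hfd : ∀ j, DifferentiableOn ℂ (fun z => f (z * e j)) (ball 0 R) := fun j =>
    hf.comp (differentiableOn_id.mul_const _) (hmaps j)
  have hfc : ∀ j, ContinuousOn (fun z => ‖f (z * e j)‖ ^ p) (ball 0 R) := fun j =>
    (hfd j).continuousOn.norm.rpow_const fun _ _ => Or.inr hp.le
  have hucont : ContinuousOn u (closedBall 0 ρ) :=
    continuousOn_const.mul ((continuousOn_finsetSum _ fun j _ => hfc j).mono hcb)
  have husub : ∀ z ∈ ball (0 : ℂ) ρ, ∀ᶠ r : ℝ in 𝓝[>] 0, u z ≤ Real.circleAverage u z r := by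
    intro z hz
    have hzR : z ∈ ball (0 : ℂ) R := ball_subset_ball hρR.le hz
    have hev : ∀ᶠ r : ℝ in 𝓝[>] 0, ∀ j ∈ Finset.range N,
        ‖f (z * e j)‖ ^ p ≤ Real.circleAverage (fun w => ‖f (w * e j)‖ ^ p) z r :=
      (Filter.eventually_all_finset _).2 fun j _ =>
        eventually_norm_rpow_le_circleAverage isOpen_ball (hfd j) hp hzR
    have hmem : Set.Ioo (0 : ℝ) (R - ‖z‖) ∈ 𝓝[>] (0 : ℝ) :=
      Ioo_mem_nhdsGT (by linarith [mem_ball_zero_iff.1 hzR])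
    filter_upwards [hev, hmem] with s hs hsm
    have hsph : sphere z |s| ⊆ ball 0 R := by
      intro w hw
      rw [abs_of_pos hsm.1, mem_sphere_iff_norm] at hw
      rw [mem_ball_zero_iff]
      calc ‖w‖ = ‖(w - z) + z‖ := by rw [sub_add_cancel]
        _ ≤ s + ‖z‖ := hw ▸ norm_add_le _ _
        _ < R := by linarith [hsm.2]
    have hci : ∀ j ∈ Finset.range N, CircleIntegrable (fun w => ‖f (w * e j)‖ ^ p) z s :=
      fun j _ => ((hfc j).mono hsph).circleIntegrable'
    have havg : Real.circleAverage u z s = (N : ℝ)⁻¹ * ∑ j ∈ Finset.range N,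
        Real.circleAverage (fun w => ‖f (w * e j)‖ ^ p) z s := by
      rw [← Real.circleAverage_fun_sum hci, ← smul_eq_mul, ← Real.circleAverage_fun_smul]
      rfl
    rw [havg]
    simp only [hu]
    gcongr with j hj
    exact hs j (by simpa using hj)
  -- The argument of w is unknown, but the Riemann sums at radius ρ are close to the mean for every
  -- starting angle.
  obtain ⟨w, hw, hle⟩ := exists_mem_sphere_le_of_subMean hucont husub (hcm r hr hrρ 0)
  have hw' : w = circleMap 0 ρ w.arg := by
    rw [circleMap_zero, ← mem_sphere_zero_iff_norm.1 hw, Complex.norm_mul_exp_arg_mul_I]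
  rw [hw', hue, hue] at hle
  have h1' := abs_le.1 (h1 0)
  have h2' := abs_le.1 (h2 w.arg)
  rw [Real.circleAverage_def, Real.circleAverage_def, smul_eq_mul, smul_eq_mul]
  linarith [h1'.1, h2'.2]

theorem circleAverage_norm_rpow_mono {f : ℂ → ℂ} {c : ℂ} {R p : ℝ} (hp : 0 < p)
    (hf : DifferentiableOn ℂ f (Metric.ball c R)) {r ρ : ℝ} (hr : 0 ≤ r) (hrρ : r ≤ ρ)
    (hρR : ρ < R) :
    Real.circleAverage (fun z => ‖f z‖ ^ p) c r ≤ Real.circleAverage (fun z => ‖f z‖ ^ p) c ρ := by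
  have h : DifferentiableOn ℂ (fun z => f (z + c)) (Metric.ball 0 R) := by
    refine hf.comp (differentiableOn_id.add_const c) fun z hz => ?_
    simpa [mem_ball_iff_norm] using hz
  have := circleAverage_norm_rpow_mono_zero hp h hr hrρ hρR
  rwa [← Real.circleAverage_map_add_const (f := fun z => ‖f z‖ ^ p) (c := c) (R := r),
    ← Real.circleAverage_map_add_const (f := fun z => ‖f z‖ ^ p) (c := c) (R := ρ)]

/-! ### Integration in polar coordinates -/

/-- The integral of `G` over the circle of radius `s` with respect to the angle. -/
def circleLIntegral (G : ℂ → ℝ≥0∞) (s : ℝ) : ℝ≥0∞ :=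
  ∫⁻ θ in Set.Ioo (-Real.pi) Real.pi, G (circleMap 0 s θ)

theorem polarCoord_symm_eq_circleMap (x : ℝ × ℝ) :
    Complex.polarCoord.symm x = circleMap 0 x.1 x.2 := by
  rw [Complex.polarCoord_symm_apply, circleMap_zero, Complex.exp_mul_I]
  simp

theorem measurable_circleMap_uncurry :
    Measurable fun x : ℝ × ℝ => circleMap 0 x.1 x.2 := by
  unfold circleMap
  fun_prop

theorem lintegral_polar_target (H : ℝ × ℝ → ℝ≥0∞) (hH : Measurable H) :
    ∫⁻ x in polarCoord.target, H x =
      ∫⁻ s in Set.Ioi (0 : ℝ), ∫⁻ θ in Set.Ioo (-Real.pi) Real.pi, H (s, θ) := by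
  rw [polarCoord_target, Measure.volume_eq_prod, ← Measure.prod_restrict,
    lintegral_prod _ hH.aemeasurable]

theorem measurable_circleLIntegral {G : ℂ → ℝ≥0∞} (hG : Measurable G) :
    Measurable (circleLIntegral G) :=
  Measurable.lintegral_prod_right' (f := fun x : ℝ × ℝ => G (circleMap 0 x.1 x.2))
    (hG.comp measurable_circleMap_uncurry)

theorem circleLIntegral_const_mul {G : ℂ → ℝ≥0∞} (hG : Measurable G) (c : ℝ≥0∞) (s : ℝ) :
    circleLIntegral (fun z => c * G z) s = c * circleLIntegral G s :=
  lintegral_const_mul (f := fun θ => G (circleMap 0 s θ)) c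
    (hG.comp (continuous_circleMap 0 s).measurable)

theorem lintegral_eq_polar {G : ℂ → ℝ≥0∞} (hG : Measurable G) :
    ∫⁻ z, G z = ∫⁻ s in Set.Ioi (0 : ℝ), ENNReal.ofReal s * circleLIntegral G s := by
  have hm := hG.comp measurable_circleMap_uncurry
  rw [← Complex.lintegral_comp_polarCoord_symm]
  simp only [polarCoord_symm_eq_circleMap, smul_eq_mul]
  rw [lintegral_polar_target]
  · refine lintegral_congr fun s => ?_
    exact circleLIntegral_const_mul hG (ENNReal.ofReal s) s
  · exact (measurable_fst.ennreal_ofReal).mul hm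

theorem setLIntegral_ball_eq_polar {G : ℂ → ℝ≥0∞} (hG : Measurable G) (R : ℝ) :
    ∫⁻ z in Metric.ball 0 R, G z =
      ∫⁻ s in Set.Ioo 0 R, ENNReal.ofReal s * circleLIntegral G s := by
  rw [← lintegral_indicator Metric.isOpen_ball.measurableSet,
    lintegral_eq_polar (hG.indicator Metric.isOpen_ball.measurableSet), ← Set.Ioi_inter_Iio,
    Set.inter_comm, ← setLIntegral_indicator measurableSet_Iio]
  refine setLIntegral_congr_fun measurableSet_Ioi fun s hs => ?_
  have hmem : ∀ θ, circleMap 0 s θ ∈ Metric.ball (0 : ℂ) R ↔ s < R := by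
    intro θ
    rw [mem_ball_zero_iff, norm_circleMap_zero, abs_of_pos hs]
  by_cases h : s < R
  · rw [Set.indicator_of_mem (by exact h)]
    congr 1
    refine lintegral_congr fun θ => ?_
    rw [Set.indicator_of_mem ((hmem θ).2 h)]
  · rw [Set.indicator_of_notMem (by exact h), circleLIntegral]
    simp [Set.indicator, hmem, h]

/-! ### Radial doubling measures -/

/-- `ν` is the radial measure on the disc with radial density `g / π`, where the tail integrals
`τ t` of `g` over `(1 - t, 1)` satisfy both doubling conditions. -/
structure IsDoublingMeasure (ν : Measure ℂ) (g : ℝ → ℝ≥0∞) (τ : ℝ → ℝ) : Prop where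
  measurable : Measurable g
  measurable_tail : Measurable τ
  lintegral_eq : ∀ G : ℂ → ℝ≥0∞, Measurable G → ∫⁻ z, G z ∂ν =
    ∫⁻ s in Set.Ioo (0 : ℝ) 1, ENNReal.ofReal (s / Real.pi) * g s * circleLIntegral G s
  tail_eq : ∀ t : ℝ, 0 < t → t ≤ 1 → ENNReal.ofReal (τ t) = ∫⁻ s in Set.Ioo (1 - t) 1, g s
  pos : ∀ t : ℝ, 0 < t → t ≤ 1 → 0 < τ t
  mono : ∀ t s : ℝ, 0 < t → t ≤ s → s ≤ 1 → τ t ≤ τ s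
  upper : ∃ C B : ℝ, 0 < C ∧ 0 < B ∧ ∀ t s : ℝ, 0 < t → t ≤ s → s ≤ 1 →
    τ s ≤ C * (s / t) ^ B * τ t
  decay : ∃ C β : ℝ, 0 < C ∧ 0 < β ∧ ∀ t : ℝ, 0 < t → t ≤ 1 → τ t ≤ C * t ^ β
  lower : ∃ C K : ℝ, 0 < C ∧ 1 < K ∧ ∀ t : ℝ, 0 < t → t ≤ 1 →
    ENNReal.ofReal (τ t) ≤ ENNReal.ofReal C * ∫⁻ s in Set.Ioc (1 - t) (1 - t / K), g s

/-- The real segment is a null set of the plane, so measurability of ω in the disc says nothing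
directly about s ↦ ω(s). By Fubini a measurable version of ω agrees with it at almost every point of
some ray, and radiality carries the agreement to the real segment. -/
theorem IsRadialWeight.exists_density {ω : ℂ → ℝ} (hω : IsRadialWeight ω) :
    ∃ g : ℝ → ℝ≥0∞, Measurable g ∧
      (∀ᵐ s : ℝ, s ∈ Set.Ioo (0 : ℝ) 1 → ENNReal.ofReal (ω (s : ℂ)) = g s) := by
  have hae : AEMeasurable (fun z => ENNReal.ofReal (ω z)) (volume.restrict disc) :=
    hω.integrable.aestronglyMeasurable.aemeasurable.ennreal_ofReal
  have hdisc : MeasurableSet disc := Metric.isOpen_ball.measurableSet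
  obtain ⟨h, hh, heq⟩ := hae
  obtain ⟨N, hN, hNm, hN0⟩ := exists_measurable_superset_of_null
    (ae_iff.1 ((ae_restrict_iff' hdisc).1 heq))
  have h1 : ∫⁻ x in polarCoord.target,
      ENNReal.ofReal x.1 * N.indicator 1 (circleMap 0 x.1 x.2) = 0 := by
    have h2 := Complex.lintegral_comp_polarCoord_symm (N.indicator 1)
    rw [lintegral_indicator_one hNm, hN0] at h2
    simpa only [polarCoord_symm_eq_circleMap, smul_eq_mul] using h2
  have hm : Measurable fun x : ℝ × ℝ =>
      ENNReal.ofReal x.1 * N.indicator (1 : ℂ → ℝ≥0∞) (circleMap 0 x.1 x.2) :=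
    measurable_fst.ennreal_ofReal.mul
      ((measurable_one.indicator hNm).comp measurable_circleMap_uncurry)
  rw [lintegral_eq_zero_iff hm, polarCoord_target, Measure.volume_eq_prod,
    ← Measure.prod_restrict, ← Measure.prod_swap] at h1
  have h3 := Measure.ae_ae_of_ae_prod
    (ae_of_ae_map measurable_swap.aemeasurable h1)
  have hne : (ae (volume.restrict (Set.Ioo (-Real.pi) Real.pi))).NeBot := by
    rw [ae_neBot]
    intro h0
    have := congrArg (fun m : Measure ℝ => m Set.univ) h0
    simp at this
    linarith [Real.pi_pos]
  obtain ⟨θ, hθ⟩ := h3.exists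
  refine ⟨fun s => h (circleMap 0 s θ),
    hh.comp (measurable_circleMap_uncurry.comp (measurable_id.prodMk measurable_const)), ?_⟩
  filter_upwards [(ae_restrict_iff' measurableSet_Ioi).1 hθ] with s hs hs01
  have h4 := hs hs01.1
  have hnorm : ‖circleMap 0 s θ‖ = s := by rw [norm_circleMap_zero, abs_of_pos hs01.1]
  have hmem : circleMap 0 s θ ∈ disc := by
    rw [disc, mem_ball_zero_iff, hnorm]; exact hs01.2
  have hnot : circleMap 0 s θ ∉ N := by
    intro hin
    simp [hin] at h4
    linarith [hs01.1]
  have h5 : ENNReal.ofReal (ω (circleMap 0 s θ)) = h (circleMap 0 s θ) := by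
    by_contra hc
    exact hnot (hN (by simpa using ⟨hmem, hc⟩))
  rw [← h5, hω.radial _ hmem, hnorm]

theorem weightMeasure_lintegral_eq {ω : ℂ → ℝ} (hω : IsRadialWeight ω) {g : ℝ → ℝ≥0∞}
    (hg : Measurable g)
    (hae : ∀ᵐ s : ℝ, s ∈ Set.Ioo (0 : ℝ) 1 → ENNReal.ofReal (ω (s : ℂ)) = g s)
    {G : ℂ → ℝ≥0∞} (hG : Measurable G) : ∫⁻ z, G z ∂(weightMeasure ω) =
      ∫⁻ s in Set.Ioo (0 : ℝ) 1, ENNReal.ofReal (s / Real.pi) * g s * circleLIntegral G s := by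
  have hdisc : MeasurableSet disc := Metric.isOpen_ball.measurableSet
  have hm := hG.comp measurable_circleMap_uncurry
  have haem : AEMeasurable (fun z => ENNReal.ofReal (ω z / Real.pi)) (volume.restrict disc) :=
    (hω.integrable.aestronglyMeasurable.aemeasurable.div_const _).ennreal_ofReal
  rw [weightMeasure, lintegral_withDensity_eq_lintegral_mul₀ haem hG.aemeasurable,
    ← lintegral_indicator hdisc, ← Complex.lintegral_comp_polarCoord_symm]
  simp only [polarCoord_symm_eq_circleMap, smul_eq_mul]
  set H : ℝ × ℝ → ℝ≥0∞ := fun x => (Set.Ioo (0 : ℝ) 1).indicator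
    (fun s => ENNReal.ofReal (s / Real.pi) * g s) x.1 * G (circleMap 0 x.1 x.2) with hH
  have hHm : Measurable H :=
    (((by fun_prop : Measurable fun s : ℝ => ENNReal.ofReal (s / Real.pi) * g s).indicator
      measurableSet_Ioo).comp measurable_fst).mul hm
  have hae' : ∀ᵐ x : ℝ × ℝ, x.1 ∈ Set.Ioo (0 : ℝ) 1 → ENNReal.ofReal (ω (x.1 : ℂ)) = g x.1 := by
    rw [Measure.volume_eq_prod]
    exact Measure.quasiMeasurePreserving_fst.ae hae
  have hstep : ∫⁻ x in polarCoord.target, ENNReal.ofReal x.1 * disc.indicator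
      ((fun z => ENNReal.ofReal (ω z / Real.pi)) * fun z => G z) (circleMap 0 x.1 x.2) =
      ∫⁻ x in polarCoord.target, H x := by
    refine lintegral_congr_ae ((ae_restrict_iff' polarCoord.open_target.measurableSet).2 ?_)
    filter_upwards [hae'] with x hx hxt
    have hx0 : 0 < x.1 := hxt.1
    have hnorm : ‖circleMap 0 x.1 x.2‖ = x.1 := by rw [norm_circleMap_zero, abs_of_pos hx0]
    by_cases h1 : x.1 < 1
    · have hmem : circleMap 0 x.1 x.2 ∈ disc := by
        rw [disc, mem_ball_zero_iff, hnorm]; exact h1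
      have hI : x.1 ∈ Set.Ioo (0 : ℝ) 1 := ⟨hx0, h1⟩
      simp only [hH]
      rw [Set.indicator_of_mem hmem, Set.indicator_of_mem hI, Pi.mul_apply, hω.radial _ hmem,
        hnorm, ← hx hI, ENNReal.ofReal_div_of_pos Real.pi_pos,
        ENNReal.ofReal_div_of_pos Real.pi_pos, div_eq_mul_inv, div_eq_mul_inv]
      ring
    · have hmem : circleMap 0 x.1 x.2 ∉ disc := by
        rw [disc, mem_ball_zero_iff, hnorm]; exact h1
      have hI : x.1 ∉ Set.Ioo (0 : ℝ) 1 := fun h => h1 h.2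
      simp only [hH]
      rw [Set.indicator_of_notMem hmem, Set.indicator_of_notMem hI, mul_zero, zero_mul]
  rw [hstep, lintegral_polar_target _ hHm]
  have : Set.Ioo (0 : ℝ) 1 = Set.Ioo 0 1 ∩ Set.Ioi 0 := by
    ext s; simp +contextual
  rw [this, ← setLIntegral_indicator measurableSet_Ioo]
  refine lintegral_congr fun s => ?_
  refine (circleLIntegral_const_mul hG ((Set.Ioo (0 : ℝ) 1).indicator
    (fun s => ENNReal.ofReal (s / Real.pi) * g s) s) s).trans ?_
  by_cases hs : s ∈ Set.Ioo (0 : ℝ) 1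
  · rw [Set.indicator_of_mem hs, Set.indicator_of_mem hs]
  · rw [Set.indicator_of_notMem hs, Set.indicator_of_notMem hs, zero_mul]

theorem circleLIntegral_one (s : ℝ) :
    circleLIntegral (fun _ => 1) s = ENNReal.ofReal (2 * Real.pi) := by
  rw [circleLIntegral, setLIntegral_one, Real.volume_Ioo]
  ring_nf

theorem weightMeasure_univ_lt_top {ω : ℂ → ℝ} (hω : IsRadialWeight ω) :
    weightMeasure ω Set.univ < ∞ := by
  have h := (Integrable.div_const hω.integrable Real.pi).lintegral_lt_top
  rwa [weightMeasure, withDensity_apply _ MeasurableSet.univ, Measure.restrict_univ]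

theorem ClassD.exists_isDoublingMeasure {ω : ℂ → ℝ} (hω : ClassD ω) :
    ∃ (g : ℝ → ℝ≥0∞) (τ : ℝ → ℝ), IsDoublingMeasure (weightMeasure ω) g τ := by
  obtain ⟨g, hg, hae⟩ := hω.weight.exists_density
  have hpolar := fun (G : ℂ → ℝ≥0∞) (hG : Measurable G) =>
    weightMeasure_lintegral_eq hω.weight hg hae hG
  have htail : ∀ r : ℝ, 0 ≤ r → tail ω r = ∫⁻ s in Set.Ioo r 1, g s := by
    intro r hr
    refine lintegral_congr_ae ((ae_restrict_iff' measurableSet_Ioo).2 ?_)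
    filter_upwards [hae] with s hs hsr
    exact hs ⟨hr.trans_lt hsr.1, hsr.2⟩
  obtain ⟨C₁, hC₁, hup⟩ := hω.upper
  obtain ⟨K, C₂, hK, hC₂, hlow⟩ := hω.lower
  have hanti : ∀ r s : ℝ, r ≤ s → tail ω s ≤ tail ω r := fun r s hrs =>
    lintegral_mono_set (Set.Ioo_subset_Ioo_left hrs)
  -- Integrability in the plane controls the integral of s ω(s) only. On (1/2, 1) the polar factor
  -- (s/π)·2π is at least 1, and upper doubling at r = 0 then bounds the full tail.
  have hhalf : tail ω (1 / 2) < ∞ := by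
    have h1 := weightMeasure_univ_lt_top hω.weight
    rw [← lintegral_one, hpolar _ measurable_const] at h1
    refine lt_of_le_of_lt ?_ h1
    rw [htail _ (by norm_num)]
    calc ∫⁻ s in Set.Ioo (1 / 2 : ℝ) 1, g s
        ≤ ∫⁻ s in Set.Ioo (1 / 2 : ℝ) 1,
          ENNReal.ofReal (s / Real.pi) * g s * circleLIntegral (fun _ => 1) s := by
          refine setLIntegral_mono' measurableSet_Ioo fun s hs => ?_
          rw [circleLIntegral_one, mul_right_comm, ← ENNReal.ofReal_mul (by
            have := Real.pi_pos; have := hs.1; positivity)]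
          refine le_mul_of_one_le_left' ?_
          rw [ENNReal.one_le_ofReal]
          have := Real.pi_pos.ne'
          field_simp
          linarith [hs.1]
      _ ≤ _ := lintegral_mono_set (Set.Ioo_subset_Ioo_left (by norm_num))
  have hfin : ∀ r : ℝ, 0 ≤ r → tail ω r < ∞ := by
    intro r hr
    refine (hanti 0 r hr).trans_lt ((hup 0 le_rfl one_pos).trans_lt ?_)
    rw [add_zero]
    exact ENNReal.mul_lt_top ENNReal.ofReal_lt_top hhalf
  set τ : ℝ → ℝ := fun t => (tail ω (1 - t)).toReal with hτ
  have hof : ∀ t : ℝ, t ≤ 1 → ENNReal.ofReal (τ t) = tail ω (1 - t) := fun t ht =>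
    ENNReal.ofReal_toReal (hfin _ (by linarith)).ne
  have hpos : ∀ t : ℝ, 0 < t → t ≤ 1 → 0 < τ t := fun t ht ht1 =>
    ENNReal.toReal_pos (hω.tail_pos _ (by linarith) (by linarith)).ne' (hfin _ (by linarith)).ne
  have hmono : ∀ t s : ℝ, 0 < t → t ≤ s → s ≤ 1 → τ t ≤ τ s := fun t s ht hts hs =>
    ENNReal.toReal_mono (hfin _ (by linarith)).ne (hanti _ _ (by linarith))
  have hup' : ∀ t : ℝ, 0 < t → t ≤ 1 → τ t ≤ C₁ * τ (t / 2) := by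
    intro t ht ht1
    have h1 := hup (1 - t) (by linarith) (by linarith)
    rw [show (1 + (1 - t)) / 2 = 1 - t / 2 by ring, ← hof t ht1, ← hof (t / 2) (by linarith),
      ← ENNReal.ofReal_mul (by linarith)] at h1
    refine (ENNReal.ofReal_le_ofReal_iff ?_).1 h1
    have := hpos (t / 2) (by positivity) (by linarith)
    positivity
  have hlow' : ∀ t : ℝ, 0 < t → t ≤ 1 → C₂ * τ (t / K) ≤ τ t := by
    intro t ht ht1
    have htK : t / K ≤ 1 := (div_le_one (by linarith)).2 (by linarith)
    have h1 := hlow (1 - t) (by linarith) (by linarith)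
    rw [show 1 - (1 - t) = t by ring, ← hof t ht1, ← hof (t / K) htK,
      ← ENNReal.ofReal_mul (by linarith)] at h1
    exact (ENNReal.ofReal_le_ofReal_iff (hpos t ht ht1).le).1 h1
  have hτm : Measurable τ :=
    ((show Antitone (tail ω) from fun r s hrs => hanti r s hrs).measurable.comp
      (measurable_const.sub measurable_id)).ennreal_toReal
  refine ⟨g, τ, hg, hτm, hpolar, ?_, hpos, hmono, ?_, ?_, ?_⟩
  · intro t ht ht1
    rw [hof t ht1, htail _ (by linarith)]
  · have iter : ∀ (n : ℕ) (s : ℝ), 0 < s → s ≤ 1 → τ s ≤ C₁ ^ n * τ (s / 2 ^ n) := by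
      intro n
      induction n with
      | zero => intro s _ _; simp
      | succ n ih =>
        intro s hs hs1
        have h2 := hup' (s / 2 ^ n) (by positivity) ((div_le_self hs.le
          (one_le_pow₀ (by norm_num))).trans hs1)
        calc τ s ≤ C₁ ^ n * τ (s / 2 ^ n) := ih s hs hs1
          _ ≤ C₁ ^ n * (C₁ * τ (s / 2 ^ n / 2)) := by gcongr
          _ = _ := by rw [div_div, ← pow_succ, pow_succ C₁, mul_assoc]
    -- With C₁ < 2^m, n halvings cost C₁^n ≤ (2^n)^m ≤ (s/t)^m.
    obtain ⟨m, hm⟩ := pow_unbounded_of_one_lt C₁ (one_lt_two : (1 : ℝ) < 2)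
    refine ⟨C₁, m + 1, by linarith, by positivity, fun t s ht hts hs => ?_⟩
    obtain ⟨n, hn1, hn2⟩ := exists_nat_pow_near ((one_le_div ht).2 hts) (one_lt_two : (1 : ℝ) < 2)
    have h2 : s / 2 ^ (n + 1) ≤ t := by
      rw [div_le_iff₀ (by positivity)]
      rw [div_lt_iff₀ ht] at hn2
      linarith
    have hst : 1 ≤ s / t := (one_le_div ht).2 hts
    calc τ s ≤ C₁ ^ (n + 1) * τ (s / 2 ^ (n + 1)) := iter (n + 1) s (by linarith) hs
      _ ≤ C₁ ^ (n + 1) * τ t := by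
        gcongr
        exact hmono _ _ (by have := ht.trans_le hts; positivity) h2 (hts.trans hs)
      _ = C₁ * C₁ ^ n * τ t := by rw [pow_succ']
      _ ≤ C₁ * (s / t) ^ ((m : ℝ) + 1) * τ t := by
        have h3 : C₁ ^ n ≤ (s / t) ^ ((m : ℝ) + 1) := by
          calc C₁ ^ n ≤ (2 ^ m) ^ n := by gcongr
            _ = (2 ^ n) ^ m := by rw [← pow_mul, ← pow_mul, mul_comm]
            _ ≤ (s / t) ^ m := by gcongr
            _ = (s / t) ^ (m : ℝ) := (Real.rpow_natCast _ _).symm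
            _ ≤ _ := Real.rpow_le_rpow_of_exponent_le hst (by linarith)
        have := hpos t ht (hts.trans hs)
        gcongr
  · have iter : ∀ n : ℕ, C₂ ^ n * τ (1 / K ^ n) ≤ τ 1 := by
      intro n
      induction n with
      | zero => simp
      | succ n ih =>
        have h2 := hlow' (1 / K ^ n) (by positivity)
          ((div_le_one (by positivity)).2 (one_le_pow₀ hK.le))
        calc C₂ ^ (n + 1) * τ (1 / K ^ (n + 1)) = C₂ ^ n * (C₂ * τ (1 / K ^ n / K)) := by
              rw [div_div, ← pow_succ, pow_succ C₂, mul_assoc]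
          _ ≤ C₂ ^ n * τ (1 / K ^ n) := by gcongr
          _ ≤ _ := ih
    -- Each division of t by K divides the tail by at least C₂ = K^β.
    set β := Real.logb K C₂ with hβ
    have hβpos : 0 < β := Real.logb_pos hK hC₂
    have hKβ : K ^ β = C₂ := Real.rpow_logb (by linarith) hK.ne' (by linarith)
    have h1 := hpos 1 one_pos le_rfl
    refine ⟨C₂ * τ 1, β, by positivity, hβpos, fun t ht ht1 => ?_⟩
    obtain ⟨n, hn1, hn2⟩ := exists_nat_pow_near ((one_le_div ht).2 ht1) hK
    have hKn : (0 : ℝ) < K ^ n := by positivity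
    have h2 : t ≤ 1 / K ^ n := by
      rw [le_div_iff₀ hKn]; rw [le_div_iff₀ ht] at hn1; linarith
    have h3 : 1 ≤ K ^ (n + 1) * t := by
      rw [div_lt_iff₀ ht] at hn2; exact hn2.le
    have h4 : 1 ≤ C₂ ^ (n + 1) * t ^ β := by
      rw [← hKβ, ← Real.rpow_mul_natCast (by linarith), mul_comm β, Real.rpow_natCast_mul (by linarith),
        ← Real.mul_rpow (by positivity) ht.le]
      exact Real.one_le_rpow h3 hβpos.le
    have h5 := hmono t _ ht h2 ((div_le_one (by positivity)).2 (one_le_pow₀ hK.le))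
    have h6 := hpos t ht ht1
    calc τ t ≤ τ t * (C₂ ^ (n + 1) * t ^ β) := le_mul_of_one_le_right h6.le h4
      _ = C₂ * (C₂ ^ n * τ t) * t ^ β := by ring
      _ ≤ C₂ * (C₂ ^ n * τ (1 / K ^ n)) * t ^ β := by gcongr
      _ ≤ C₂ * τ 1 * t ^ β := by gcongr; exact iter n
  -- If I is the mass of (1 - t, 1 - t/K], then τ(t) = I + τ(t/K) ≤ I + τ(t)/C₂; solve for τ(t).
  · refine ⟨C₂ / (C₂ - 1), K, div_pos (by linarith) (by linarith), hK, fun t ht ht1 => ?_⟩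
    have htK : t / K ≤ t := div_le_self ht.le hK.le
    have htK0 : 0 < t / K := by positivity
    have hsplit : tail ω (1 - t) = (∫⁻ s in Set.Ioc (1 - t) (1 - t / K), g s) +
        tail ω (1 - t / K) := by
      rw [htail _ (by linarith), htail _ (by linarith), ← Set.Ioc_union_Ioo_eq_Ioo
        (by linarith : 1 - t ≤ 1 - t / K) (by linarith : 1 - t / K < 1),
        lintegral_union measurableSet_Ioo]
      rw [Set.disjoint_left]
      intro x hx hx2
      exact absurd hx.2 (not_le.2 hx2.1)
    set I := ∫⁻ s in Set.Ioc (1 - t) (1 - t / K), g s with hI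
    have hIfin : I ≠ ∞ := by
      have := hfin (1 - t) (by linarith)
      rw [hsplit] at this
      exact (lt_of_le_of_lt le_self_add this).ne
    have hreal : τ t = I.toReal + τ (t / K) := by
      simp only [hτ]
      rw [hsplit, ENNReal.toReal_add hIfin (hfin _ (by linarith)).ne]
    rw [← ENNReal.ofReal_toReal hIfin, ← ENNReal.ofReal_mul (div_pos (by linarith) (by linarith)).le]
    refine ENNReal.ofReal_le_ofReal ?_
    rw [div_mul_eq_mul_div, le_div_iff₀ (by linarith)]
    have := hlow' t ht ht1
    nlinarith

/-! ### Area integrals of |f|^p and the tail density -/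

theorem measurableSet_disc : MeasurableSet disc := Metric.isOpen_ball.measurableSet

open Metric in
theorem lintegral_circle_norm_rpow {f : ℂ → ℂ} {c : ℂ} {R p : ℝ} (hp : 0 < p)
    (hf : DifferentiableOn ℂ f (ball c R)) {r : ℝ} (hr : 0 ≤ r) (hrR : r < R) :
    ∫⁻ θ in Set.Ioo (-Real.pi) Real.pi, ENNReal.ofReal (‖f (circleMap c r θ)‖ ^ p) =
      ENNReal.ofReal (2 * Real.pi * Real.circleAverage (fun z => ‖f z‖ ^ p) c r) := by
  have hmem : ∀ θ, circleMap c r θ ∈ ball c R := fun θ => by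
    rw [mem_ball, dist_eq_norm, circleMap_sub_center, norm_circleMap_zero, abs_of_nonneg hr]
    exact hrR
  have hcont : Continuous fun θ => ‖f (circleMap c r θ)‖ ^ p :=
    (hf.continuousOn.norm.rpow_const fun _ _ => Or.inr hp.le).comp_continuous
      (continuous_circleMap c r) hmem
  have hper : Function.Periodic (fun θ => ‖f (circleMap c r θ)‖ ^ p) (2 * Real.pi) :=
    (periodic_circleMap c r).comp fun z => ‖f z‖ ^ p
  have hπ : -Real.pi ≤ Real.pi := by linarith [Real.pi_pos]
  have h1 : ∫ θ in 0..2 * Real.pi, ‖f (circleMap c r θ)‖ ^ p =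
      ∫ θ in Set.Ioc (-Real.pi) Real.pi, ‖f (circleMap c r θ)‖ ^ p := by
    rw [← intervalIntegral.integral_of_le hπ]
    have := hper.intervalIntegral_add_eq 0 (-Real.pi)
    rw [zero_add] at this
    rw [this]; congr 1; ring
  rw [Real.circleAverage_def, smul_eq_mul, mul_inv_cancel_left₀ Real.two_pi_pos.ne', h1,
    ofReal_integral_eq_lintegral_ofReal _ (ae_of_all _ fun θ => by positivity)]
  · exact setLIntegral_congr Ioo_ae_eq_Ioc
  · exact (hcont.integrableOn_Icc (a := -Real.pi) (b := Real.pi)).mono_set Set.Ioc_subset_Icc_self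

theorem circleLIntegral_norm_rpow_mono {f : ℂ → ℂ} {p : ℝ} (hp : 0 < p)
    (hf : DifferentiableOn ℂ f disc) {r ρ : ℝ} (hr : 0 ≤ r) (hrρ : r ≤ ρ) (hρ : ρ < 1) :
    circleLIntegral (fun z => ENNReal.ofReal (‖f z‖ ^ p)) r ≤
      circleLIntegral (fun z => ENNReal.ofReal (‖f z‖ ^ p)) ρ := by
  rw [circleLIntegral, circleLIntegral, lintegral_circle_norm_rpow hp hf hr (hrρ.trans_lt hρ),
    lintegral_circle_norm_rpow hp hf (hr.trans hrρ) hρ]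
  have := circleAverage_norm_rpow_mono hp hf hr hrρ hρ
  refine ENNReal.ofReal_le_ofReal ?_
  gcongr

open Metric in
theorem norm_rpow_le_setLIntegral_ball {f : ℂ → ℂ} (hfm : Measurable f) {p R : ℝ} (hp : 0 < p)
    {z : ℂ} (hR : 0 < R) (hf : DifferentiableOn ℂ f (ball z R)) :
    ENNReal.ofReal (Real.pi * R ^ 2) * ENNReal.ofReal (‖f z‖ ^ p) ≤
      ∫⁻ w in ball z R, ENNReal.ofReal (‖f w‖ ^ p) := by
  set G : ℂ → ℝ≥0∞ := fun w => ENNReal.ofReal (‖f (z + w)‖ ^ p) with hG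
  have hGm : Measurable G :=
    ((hfm.comp (measurable_const_add z)).norm.pow_const p).ennreal_ofReal
  have hshift : ∫⁻ w in ball z R, ENNReal.ofReal (‖f w‖ ^ p) = ∫⁻ w in ball 0 R, G w := by
    have := (measurePreserving_add_left (volume : Measure ℂ) z).setLIntegral_comp_preimage
      (isOpen_ball.measurableSet (s := ball z R))
      ((hfm.norm.pow_const p).ennreal_ofReal)
    rw [← this]
    congr 2
    ext w
    simp
  rw [hshift, setLIntegral_ball_eq_polar hGm]
  have hcirc : ∀ s ∈ Set.Ioo 0 R, ENNReal.ofReal (2 * Real.pi * ‖f z‖ ^ p) ≤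
      circleLIntegral G s := by
    intro s hs
    have h1 := lintegral_circle_norm_rpow hp hf hs.1.le hs.2
    have h2 := circleAverage_norm_rpow_mono hp hf le_rfl hs.1.le hs.2
    rw [Real.circleAverage_zero] at h2
    calc ENNReal.ofReal (2 * Real.pi * ‖f z‖ ^ p) ≤ _ := ENNReal.ofReal_le_ofReal (by gcongr)
      _ = _ := h1.symm
      _ = _ := by
        simp only [circleLIntegral, hG, circleMap, zero_add]
  have hint : ∫⁻ s in Set.Ioo 0 R, ENNReal.ofReal s = ENNReal.ofReal (R ^ 2 / 2) := by
    have hi : IntegrableOn (fun s : ℝ => s) (Set.Ioo 0 R) :=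
      (continuous_id.integrableOn_Icc (a := 0) (b := R)).mono_set Set.Ioo_subset_Icc_self
    rw [← ofReal_integral_eq_lintegral_ofReal hi
      ((ae_restrict_iff' measurableSet_Ioo).2 (ae_of_all _ fun s hs => hs.1.le)),
      ← integral_Ioc_eq_integral_Ioo, ← intervalIntegral.integral_of_le hR.le, integral_id]
    simp
  calc ENNReal.ofReal (Real.pi * R ^ 2) * ENNReal.ofReal (‖f z‖ ^ p)
      = ENNReal.ofReal (R ^ 2 / 2) * ENNReal.ofReal (2 * Real.pi * ‖f z‖ ^ p) := by
        rw [← ENNReal.ofReal_mul (by positivity), ← ENNReal.ofReal_mul (by positivity)]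
        congr 1; ring
    _ = ∫⁻ s in Set.Ioo 0 R, ENNReal.ofReal s * ENNReal.ofReal (2 * Real.pi * ‖f z‖ ^ p) := by
        rw [lintegral_mul_const _ ENNReal.measurable_ofReal, hint]
    _ ≤ _ := setLIntegral_mono' measurableSet_Ioo fun s hs => by
        gcongr
        exact hcirc s hs

/-- By reverse doubling τ(1 - s) is at most a constant times the mass of g on (s, 1 - (1 - s)/K].
There the circular means of |f|^p are at least the mean at s, and 1 - u is comparable to 1 - s.
After Tonelli the variable s runs over an interval of length (K - 1)(1 - u), which cancels the
denominator. -/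
theorem IsDoublingMeasure.setLIntegral_tail_le {ν : Measure ℂ} {g : ℝ → ℝ≥0∞} {τ : ℝ → ℝ}
    (h : IsDoublingMeasure ν g τ) {ψ : ℝ → ℝ} (hψm : Measurable ψ)
    (hψpos : ∀ t, 0 < t → t ≤ 1 → 0 < ψ t)
    (hψ : ∀ L : ℝ, ∃ C : ℝ, 0 < C ∧ ∀ t s : ℝ, 0 < t → t ≤ s → s ≤ 1 → s ≤ L * t →
      ψ s ≤ C * ψ t) {p : ℝ} (hp : 0 < p) :
    ∃ C : ℝ, 0 < C ∧ ∀ f : ℂ → ℂ, Measurable f → DifferentiableOn ℂ f disc →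
      ∫⁻ w in disc, ENNReal.ofReal (ψ (1 - ‖w‖) * τ (1 - ‖w‖) / (1 - ‖w‖)) *
        ENNReal.ofReal (‖f w‖ ^ p) ≤
      ENNReal.ofReal C * ∫⁻ w, ENNReal.ofReal (ψ (1 - ‖w‖)) * ENNReal.ofReal (‖f w‖ ^ p) ∂ν := by
  obtain ⟨C₀, K, hC₀, hK, hlow⟩ := h.lower
  obtain ⟨C₁, hC₁, hcmp⟩ := hψ K
  refine ⟨C₀ * C₁ * K * Real.pi, by have := Real.pi_pos; positivity, fun f hfm hf => ?_⟩
  have hK0 : 0 < K := by linarith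
  have hgm := h.measurable
  set F : ℂ → ℝ≥0∞ := fun w => ENNReal.ofReal (‖f w‖ ^ p) with hF
  have hFm : Measurable F := (hfm.norm.pow_const p).ennreal_ofReal
  set m := circleLIntegral F with hm
  have hmm : Measurable m := measurable_circleLIntegral hFm
  have hτm := h.measurable_tail
  have hradial : ∀ H : ℝ → ℝ≥0∞, ∀ s, 0 < s →
      circleLIntegral (fun w => H ‖w‖ * F w) s = H s * m s := by
    intro H s hs
    rw [hm, ← circleLIntegral_const_mul hFm]
    refine lintegral_congr fun θ => ?_
    simp only [norm_circleMap_zero, abs_of_pos hs]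
  set E : Set (ℝ × ℝ) := {x | x.1 < x.2 ∧ x.2 ≤ 1 - (1 - x.1) / K} with hE
  have hEm : MeasurableSet E := by
    refine (measurableSet_lt measurable_fst measurable_snd).inter
      (measurableSet_le measurable_snd ?_)
    fun_prop
  set J : ℝ → ℝ≥0∞ := fun u => ENNReal.ofReal (u * ψ (1 - u) / (1 - u)) * m u * g u with hJ
  have hψm' : Measurable fun u : ℝ => ψ (1 - u) := hψm.comp (measurable_const.sub measurable_id)
  have hJm : Measurable J := by
    simp only [hJ]
    have : Measurable fun u : ℝ => u * ψ (1 - u) / (1 - u) := by fun_prop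
    exact (this.ennreal_ofReal.mul hmm).mul hgm
  have hpt : ∀ s ∈ Set.Ioo (0 : ℝ) 1,
      ENNReal.ofReal s * (ENNReal.ofReal (ψ (1 - s) * τ (1 - s) / (1 - s)) * m s) ≤
      ENNReal.ofReal (C₀ * C₁) *
        ∫⁻ u in Set.Ioo (0 : ℝ) 1, E.indicator (fun x => J x.2) (s, u) := by
    intro s hs
    have hs1 : 0 < 1 - s := by linarith [hs.2]
    have hτ := hlow (1 - s) hs1 (by linarith [hs.1])
    rw [sub_sub_cancel] at hτ
    have hψs := hψpos (1 - s) hs1 (by linarith [hs.1])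
    have hsub : Set.Ioc s (1 - (1 - s) / K) ⊆ Set.Ioo 0 1 := by
      intro u hu
      have : 0 < (1 - s) / K := by positivity
      exact ⟨hs.1.trans hu.1, by linarith [hu.2]⟩
    have hkey : ∀ u ∈ Set.Ioc s (1 - (1 - s) / K),
        ENNReal.ofReal (s * ψ (1 - s) / (1 - s)) * m s * g u ≤ ENNReal.ofReal C₁ * J u := by
      intro u hu
      have hu01 := hsub hu
      have hu1 : 0 < 1 - u := by linarith [hu01.2]
      have h1 : 1 - s ≤ K * (1 - u) := by
        have := hu.2
        have h2 : (1 - s) / K ≤ 1 - u := by linarith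
        rw [div_le_iff₀ hK0] at h2; linarith
      have h3 := hcmp (1 - u) (1 - s) hu1 (by linarith [hu.1]) (by linarith [hs.1]) h1
      have h4 : m s ≤ m u := circleLIntegral_norm_rpow_mono hp hf hs.1.le hu.1.le hu01.2
      have hψu := hψpos (1 - u) hu1 (by linarith [hu01.1])
      have h5 : s * ψ (1 - s) / (1 - s) ≤ C₁ * (u * ψ (1 - u) / (1 - u)) := by
        have h6 : s * ψ (1 - s) ≤ u * (C₁ * ψ (1 - u)) :=
          mul_le_mul hu.1.le h3 hψs.le hu01.1.le
        have h7 : 0 ≤ u * (C₁ * ψ (1 - u)) := by have := hu01.1; positivity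
        calc s * ψ (1 - s) / (1 - s) ≤ u * (C₁ * ψ (1 - u)) / (1 - u) := by
              gcongr
              exact hu.1.le
          _ = _ := by ring
      simp only [hJ]
      rw [← mul_assoc, ← mul_assoc, ← ENNReal.ofReal_mul hC₁.le]
      gcongr
    calc ENNReal.ofReal s * (ENNReal.ofReal (ψ (1 - s) * τ (1 - s) / (1 - s)) * m s)
        = ENNReal.ofReal (s * ψ (1 - s) / (1 - s)) * m s * ENNReal.ofReal (τ (1 - s)) := by
          rw [← mul_assoc, ← ENNReal.ofReal_mul hs.1.le, mul_right_comm,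
            ← ENNReal.ofReal_mul (by have := hs.1; positivity)]
          congr 2; ring
      _ ≤ ENNReal.ofReal (s * ψ (1 - s) / (1 - s)) * m s *
          (ENNReal.ofReal C₀ * ∫⁻ u in Set.Ioc s (1 - (1 - s) / K), g u) := by gcongr
      _ = ENNReal.ofReal C₀ * ∫⁻ u in Set.Ioc s (1 - (1 - s) / K),
          ENNReal.ofReal (s * ψ (1 - s) / (1 - s)) * m s * g u := by
          rw [lintegral_const_mul _ hgm]; ring
      _ ≤ ENNReal.ofReal C₀ * ∫⁻ u in Set.Ioc s (1 - (1 - s) / K), ENNReal.ofReal C₁ * J u := by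
          gcongr ENNReal.ofReal C₀ * ?_
          exact setLIntegral_mono' measurableSet_Ioc hkey
      _ = ENNReal.ofReal (C₀ * C₁) * ∫⁻ u in Set.Ioc s (1 - (1 - s) / K), J u := by
          rw [lintegral_const_mul _ hJm, ← mul_assoc, ← ENNReal.ofReal_mul hC₀.le]
      _ = _ := by
          congr 1
          rw [← Set.inter_eq_self_of_subset_left hsub, ← setLIntegral_indicator measurableSet_Ioc]
          refine lintegral_congr fun u => ?_
          simp only [Set.indicator, hE, Set.mem_Ioc, Set.mem_ofPred_eq]
  -- For fixed u, membership in E confines s to [1 - K(1 - u), u].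
  have hlen : ∀ u ∈ Set.Ioo (0 : ℝ) 1,
      ∫⁻ s in Set.Ioo (0 : ℝ) 1, E.indicator (fun x => J x.2) (s, u) ≤
      ENNReal.ofReal (K * Real.pi) * (ENNReal.ofReal (u / Real.pi) * g u *
        (ENNReal.ofReal (ψ (1 - u)) * m u)) := by
    intro u hu
    have hu1 : 0 < 1 - u := by linarith [hu.2]
    have hψu := hψpos (1 - u) hu1 (by linarith [hu.1])
    calc ∫⁻ s in Set.Ioo (0 : ℝ) 1, E.indicator (fun x => J x.2) (s, u)
        ≤ ∫⁻ s, (Set.Icc (1 - K * (1 - u)) u).indicator (fun _ => J u) s := by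
          refine (setLIntegral_le_lintegral _ _).trans (lintegral_mono fun s => ?_)
          by_cases hx : (s, u) ∈ E
          · rw [Set.indicator_of_mem hx, Set.indicator_of_mem]
            have h1 := hx.1
            have h2 : (1 - s) / K ≤ 1 - u := by have := hx.2; simp only at this; linarith
            rw [div_le_iff₀ hK0] at h2
            exact ⟨by linarith, h1.le⟩
          · rw [Set.indicator_of_notMem hx]; exact zero_le
      _ = J u * ENNReal.ofReal ((K - 1) * (1 - u)) := by
          rw [lintegral_indicator_const measurableSet_Icc, Real.volume_Icc]
          congr 2; ring
      _ ≤ J u * ENNReal.ofReal (K * (1 - u)) := by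
          gcongr; linarith
      _ = _ := by
          simp only [hJ]
          have hu0 := hu.1
          have hπ := Real.pi_pos
          calc ENNReal.ofReal (u * ψ (1 - u) / (1 - u)) * m u * g u * ENNReal.ofReal (K * (1 - u))
              = (ENNReal.ofReal (u * ψ (1 - u) / (1 - u)) * ENNReal.ofReal (K * (1 - u))) *
                (m u * g u) := by ring
            _ = (ENNReal.ofReal (K * Real.pi) * ENNReal.ofReal (u / Real.pi) *
                ENNReal.ofReal (ψ (1 - u))) * (m u * g u) := by
              rw [← ENNReal.ofReal_mul (by positivity), ← ENNReal.ofReal_mul (by positivity),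
                ← ENNReal.ofReal_mul (by positivity)]
              congr 2
              field_simp
            _ = _ := by ring
  have hψn : Measurable fun w : ℂ => ENNReal.ofReal (ψ (1 - ‖w‖)) :=
    (hψm'.comp measurable_norm).ennreal_ofReal
  have hLm : Measurable fun w : ℂ =>
      ENNReal.ofReal (ψ (1 - ‖w‖) * τ (1 - ‖w‖) / (1 - ‖w‖)) := by
    have h1 : Measurable fun u : ℝ => ψ (1 - u) * τ (1 - u) / (1 - u) := by fun_prop
    exact (h1.comp measurable_norm).ennreal_ofReal
  calc ∫⁻ w in disc, ENNReal.ofReal (ψ (1 - ‖w‖) * τ (1 - ‖w‖) / (1 - ‖w‖)) * F w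
      = ∫⁻ s in Set.Ioo (0 : ℝ) 1, ENNReal.ofReal s *
        (ENNReal.ofReal (ψ (1 - s) * τ (1 - s) / (1 - s)) * m s) := by
        refine (setLIntegral_ball_eq_polar (hLm.mul hFm) 1).trans ?_
        refine setLIntegral_congr_fun measurableSet_Ioo fun s hs => ?_
        congr 1
        exact hradial (fun u => ENNReal.ofReal (ψ (1 - u) * τ (1 - u) / (1 - u))) s hs.1
    _ ≤ ∫⁻ s in Set.Ioo (0 : ℝ) 1, ENNReal.ofReal (C₀ * C₁) *
        ∫⁻ u in Set.Ioo (0 : ℝ) 1, E.indicator (fun x => J x.2) (s, u) :=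
        setLIntegral_mono' measurableSet_Ioo hpt
    _ = ENNReal.ofReal (C₀ * C₁) * ∫⁻ u in Set.Ioo (0 : ℝ) 1, ∫⁻ s in Set.Ioo (0 : ℝ) 1,
        E.indicator (fun x => J x.2) (s, u) := by
        have hEJ : Measurable (E.indicator fun x : ℝ × ℝ => J x.2) :=
          (hJm.comp measurable_snd).indicator hEm
        rw [lintegral_const_mul' _ _ ENNReal.ofReal_ne_top]
        congr 1
        exact lintegral_lintegral_swap (f := fun s u => E.indicator (fun x => J x.2) (s, u))
          hEJ.aemeasurable
    _ ≤ ENNReal.ofReal (C₀ * C₁) * ∫⁻ u in Set.Ioo (0 : ℝ) 1, ENNReal.ofReal (K * Real.pi) *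
        (ENNReal.ofReal (u / Real.pi) * g u * (ENNReal.ofReal (ψ (1 - u)) * m u)) := by
        gcongr ENNReal.ofReal (C₀ * C₁) * ?_
        exact setLIntegral_mono' measurableSet_Ioo hlen
    _ = _ := by
        rw [lintegral_const_mul' _ _ ENNReal.ofReal_ne_top, ← mul_assoc,
          ← ENNReal.ofReal_mul (by positivity), mul_assoc (C₀ * C₁)]
        congr 1
        refine Eq.trans ?_ (h.lintegral_eq _ (hψn.mul hFm)).symm
        refine setLIntegral_congr_fun measurableSet_Ioo fun s hs => ?_
        congr 1
        exact (hradial (fun u => ENNReal.ofReal (ψ (1 - u))) s hs.1).symm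

/-! ### Geometry and measure of Carleson squares -/

theorem carlesonSquare_zero : carlesonSquare 0 = disc := if_pos rfl

theorem mem_carlesonSquare {a z : ℂ} (ha : a ≠ 0) : z ∈ carlesonSquare a ↔
    z ∈ disc ∧ ‖a‖ ≤ ‖z‖ ∧ |Complex.arg (z / a)| < (1 - ‖a‖) / 2 := by
  rw [carlesonSquare, if_neg ha]; rfl

theorem carlesonSquare_subset_disc (a : ℂ) : carlesonSquare a ⊆ disc := by
  by_cases ha : a = 0
  · rw [ha, carlesonSquare_zero]
  · exact fun z hz => ((mem_carlesonSquare ha).1 hz).1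

theorem measurableSet_carlesonSquare (a : ℂ) : MeasurableSet (carlesonSquare a) := by
  by_cases ha : a = 0
  · rw [ha, carlesonSquare_zero]; exact measurableSet_disc
  · rw [carlesonSquare, if_neg ha]
    refine measurableSet_disc.inter ((measurableSet_le measurable_const measurable_norm).inter ?_)
    exact measurableSet_lt
      (Complex.measurable_arg.comp (measurable_id.div_const a)).norm measurable_const

theorem mem_disc {z : ℂ} : z ∈ disc ↔ ‖z‖ < 1 := mem_ball_zero_iff

/-- Jordan's inequality applied to sin |arg ζ| = |im ζ| / |ζ|, where |ζ| ≥ 1/2. -/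
theorem abs_arg_le_of_norm_sub_one_le {ζ : ℂ} {σ : ℝ} (h : ‖ζ - 1‖ ≤ σ) (hσ : σ ≤ 1 / 2) :
    |Complex.arg ζ| ≤ Real.pi * σ := by
  have hre : 1 / 2 ≤ ζ.re := by
    have h1 := (Complex.abs_re_le_norm (ζ - 1)).trans h
    rw [Complex.sub_re, Complex.one_re, abs_le] at h1
    linarith [h1.1]
  have him : |ζ.im| ≤ σ := by
    have h1 := (Complex.abs_im_le_norm (ζ - 1)).trans h
    rwa [Complex.sub_im, Complex.one_im, sub_zero] at h1
  have hn : 1 / 2 ≤ ‖ζ‖ := hre.trans ((le_abs_self _).trans (Complex.abs_re_le_norm ζ))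
  have hle : |Complex.arg ζ| ≤ Real.pi / 2 := Complex.abs_arg_le_pi_div_two_iff.2 (by linarith)
  have h2 := Real.mul_le_sin (abs_nonneg (Complex.arg ζ)) hle
  have h3 : Real.sin |Complex.arg ζ| ≤ 2 * σ := by
    rw [← Real.abs_sin_eq_sin_abs_of_abs_le_pi (hle.trans (by linarith [Real.pi_pos])),
      Complex.sin_arg, abs_div, abs_of_nonneg (norm_nonneg ζ), div_le_iff₀ (by linarith)]
    nlinarith [abs_nonneg ζ.im]
  have h4 : 2 / Real.pi * |Complex.arg ζ| ≤ 2 * σ := h2.trans h3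
  rw [div_mul_eq_mul_div, div_le_iff₀ Real.pi_pos] at h4
  linarith

theorem arg_conj_mul {a z : ℂ} (ha : a ≠ 0) :
    Complex.arg ((starRingEnd ℂ) a * z) = Complex.arg (z / a) := by
  have h1 : (starRingEnd ℂ) a * z = ((‖a‖ ^ 2 : ℝ) : ℂ) * (z / a) := by
    have := Complex.conj_mul' a
    field_simp
    rw [mul_right_comm, this]
    push_cast; ring
  rw [h1, Complex.arg_real_mul _ (by positivity)]

/-- A horocyclic neighbourhood is contained in a comparable Carleson square. -/
theorem exists_carlesonSquare_superset {a : ℂ} (ha : a ∈ disc) {σ : ℝ} (hσ : 1 - ‖a‖ ≤ σ) :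
    ∃ b ∈ disc, 1 - ‖b‖ = min 1 (8 * σ) ∧
      ∀ z ∈ disc, ‖1 - (starRingEnd ℂ) a * z‖ < σ → z ∈ carlesonSquare b := by
  have ha1 := mem_disc.1 ha
  -- The centre b is the multiple of a with 1 - |b| = 8σ. The angular half-width of S(b) is then 4σ,
  -- more than the bound πσ on the argument. When 8σ ≥ 1 the whole disc serves.
  rcases le_or_gt 1 (8 * σ) with h | h
  · refine ⟨0, by simp [mem_disc], by simp [h], fun z hz _ => ?_⟩
    rwa [carlesonSquare_zero]
  have hna : 0 < ‖a‖ := by linarith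
  have ha0 : a ≠ 0 := norm_pos_iff.1 hna
  have hcoef : 0 < (1 - 8 * σ) / ‖a‖ := div_pos (by linarith) hna
  have hnb : ‖(((1 - 8 * σ) / ‖a‖ : ℝ) : ℂ) * a‖ = 1 - 8 * σ := by
    rw [norm_mul, Complex.norm_real, Real.norm_of_nonneg hcoef.le, div_mul_cancel₀ _ hna.ne']
  have hb0 : (((1 - 8 * σ) / ‖a‖ : ℝ) : ℂ) * a ≠ 0 :=
    mul_ne_zero (by exact_mod_cast hcoef.ne') ha0
  refine ⟨(((1 - 8 * σ) / ‖a‖ : ℝ) : ℂ) * a, ?_, ?_, fun z hz hzσ => ?_⟩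
  · rw [mem_disc, hnb]; linarith
  · rw [hnb, min_eq_right h.le]; ring
  · rw [mem_carlesonSquare hb0, hnb]
    refine ⟨hz, ?_, ?_⟩
    · have h1 : 1 - ‖z‖ ≤ ‖1 - (starRingEnd ℂ) a * z‖ := by
        have h2 := norm_sub_norm_le (1 : ℂ) ((starRingEnd ℂ) a * z)
        rw [norm_one, norm_mul, RCLike.norm_conj] at h2
        have : ‖a‖ * ‖z‖ ≤ ‖z‖ := mul_le_of_le_one_left (norm_nonneg z) ha1.le
        linarith
      linarith
    · have h3 : Complex.arg (z / ((((1 - 8 * σ) / ‖a‖ : ℝ) : ℂ) * a)) = Complex.arg (z / a) := by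
        rw [show z / ((((1 - 8 * σ) / ‖a‖ : ℝ) : ℂ) * a) =
          ((((1 - 8 * σ) / ‖a‖)⁻¹ : ℝ) : ℂ) * (z / a) by
            rw [Complex.ofReal_inv, div_mul_eq_div_div_swap, div_eq_inv_mul (z / a)]]
        exact Complex.arg_real_mul _ (by positivity)
      rw [h3, ← arg_conj_mul ha0]
      rw [← norm_sub_rev] at hzσ
      refine (abs_arg_le_of_norm_sub_one_le hzσ.le (by linarith)).trans_lt ?_
      have := Real.pi_lt_four
      nlinarith [norm_nonneg ((starRingEnd ℂ) a * z - 1)]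

/-- For ζ = āz, write 1 - ζ = (1 - |ζ|) - |ζ|(e^(i arg ζ) - 1): the first term measures the height
in the square and the second the angle. -/
theorem norm_one_sub_conj_mul_le {a z : ℂ} (ha : a ∈ disc) (hz : z ∈ carlesonSquare a) :
    ‖1 - (starRingEnd ℂ) a * z‖ ≤ 3 * (1 - ‖a‖) := by
  by_cases ha0 : a = 0
  · simp [ha0]
  have ha1 := mem_disc.1 ha
  obtain ⟨hzd, haz, harg⟩ := (mem_carlesonSquare ha0).1 hz
  have hz1 := mem_disc.1 hzd
  rw [← arg_conj_mul ha0] at harg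
  have hn : ‖(starRingEnd ℂ) a * z‖ = ‖a‖ * ‖z‖ := by rw [norm_mul, RCLike.norm_conj]
  generalize (starRingEnd ℂ) a * z = ζ at harg hn ⊢
  have h1 : 1 - ζ = ((1 - ‖ζ‖ : ℝ) : ℂ) - ‖ζ‖ * (Complex.exp (Complex.I * (Complex.arg ζ : ℝ)) - 1) := by
    have := Complex.norm_mul_exp_arg_mul_I ζ
    rw [mul_sub, mul_comm Complex.I, this]
    push_cast; ring
  have hζ1 : ‖ζ‖ ≤ 1 := by rw [hn]; nlinarith [norm_nonneg a, norm_nonneg z]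
  calc ‖1 - ζ‖ ≤ (1 - ‖ζ‖) + ‖ζ‖ * |Complex.arg ζ| := by
        rw [h1]
        refine (norm_sub_le _ _).trans ?_
        rw [Complex.norm_real, Real.norm_of_nonneg (by linarith), norm_mul, Complex.norm_real,
          norm_norm]
        gcongr
        exact Real.norm_exp_I_mul_ofReal_sub_one_le
    _ ≤ (1 - ‖a‖ * ‖a‖) + 1 * ((1 - ‖a‖) / 2) := by
        gcongr
        rw [hn]; gcongr
    _ ≤ _ := by nlinarith [norm_nonneg a]

/-- A single square attached to w catches all z whose small discs contain w, because then |1 - w̄z|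
< 3(1 - |w|); the factor 24 is 8·3. This is what bounds the inner integral after Tonelli in the
embedding. -/
theorem mem_carlesonSquare_of_near {w : ℂ} (hw : w ∈ disc) :
    ∃ b ∈ disc, 1 - ‖b‖ = min 1 (24 * (1 - ‖w‖)) ∧
      ∀ z ∈ disc, ‖w - z‖ < (1 - ‖z‖) / 8 → z ∈ carlesonSquare b := by
  have hw1 := mem_disc.1 hw
  obtain ⟨b, hb, hb1, hsub⟩ := exists_carlesonSquare_superset hw
    (σ := 3 * (1 - ‖w‖)) (by linarith)
  refine ⟨b, hb, by rw [hb1]; ring_nf, fun z hz hzw => hsub z hz ?_⟩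
  have h1 : ‖w‖ - ‖z‖ ≤ ‖w - z‖ := norm_sub_norm_le w z
  have h2 : 1 - (starRingEnd ℂ) w * z = ((1 - ‖w‖ ^ 2 : ℝ) : ℂ) + (starRingEnd ℂ) w * (w - z) := by
    have := Complex.conj_mul' w
    rw [mul_sub, this]; push_cast; ring
  have h3 : 0 ≤ 1 - ‖w‖ ^ 2 := by nlinarith [norm_nonneg w]
  calc ‖1 - (starRingEnd ℂ) w * z‖ ≤ (1 - ‖w‖ ^ 2) + ‖w‖ * ‖w - z‖ := by
        rw [h2]
        refine (norm_add_le _ _).trans ?_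
        rw [Complex.norm_real, Real.norm_of_nonneg h3, norm_mul, RCLike.norm_conj]
    _ < 3 * (1 - ‖w‖) := by
        have h4 : ‖z‖ - ‖w‖ ≤ ‖w - z‖ := by rw [norm_sub_rev]; exact norm_sub_norm_le z w
        nlinarith [norm_nonneg w, norm_nonneg (w - z)]

theorem circleLIntegral_rotate {G : ℂ → ℝ≥0∞} (hG : Measurable G) (α s : ℝ) :
    circleLIntegral (fun z => G (Complex.exp (α * Complex.I) * z)) s = circleLIntegral G s := by
  have hshift : ∀ θ : ℝ, Complex.exp (α * Complex.I) * circleMap 0 s θ = circleMap 0 s (θ + α) := by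
    intro θ
    rw [circleMap_zero, circleMap_zero, mul_left_comm, ← Complex.exp_add]
    push_cast; ring_nf
  simp only [circleLIntegral, hshift]
  set h : ℝ → ℝ≥0∞ := fun θ => G (circleMap 0 s θ) with hh
  have hm : Measurable h := hG.comp (continuous_circleMap 0 s).measurable
  rw [setLIntegral_congr Ioo_ae_eq_Ioc, setLIntegral_congr Ioo_ae_eq_Ioc]
  have h1 := (measurePreserving_add_right (volume : Measure ℝ) α).setLIntegral_comp_preimage
    (measurableSet_Ioc (a := -Real.pi + α) (b := Real.pi + α)) hm
  have h2 : (fun x : ℝ => x + α) ⁻¹' Set.Ioc (-Real.pi + α) (Real.pi + α) =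
      Set.Ioc (-Real.pi) Real.pi := by
    ext x; simp
  rw [h2] at h1
  refine h1.trans ?_
  have hT : (0 : ℝ) < 2 * Real.pi := Real.two_pi_pos
  have d1 := isAddFundamentalDomain_Ioc hT (-Real.pi + α) volume
  have d2 := isAddFundamentalDomain_Ioc hT (-Real.pi) volume
  have e1 : -Real.pi + α + 2 * Real.pi = Real.pi + α := by ring
  have e2 : -Real.pi + 2 * Real.pi = Real.pi := by ring
  rw [e1] at d1; rw [e2] at d2
  refine d1.setLIntegral_eq d2 h fun g x => ?_
  obtain ⟨_, n, rfl⟩ := g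
  rw [AddSubgroup.vadd_def]
  simp only [vadd_eq_add, hh]
  rw [add_comm]
  exact congrArg G (by simpa using ((periodic_circleMap 0 s).zsmul n) x)

/-- Rotating by arg a centres the arc at angle 0, away from the branch cut; its length is 1 - |a|,
less than 2π. -/
theorem circleLIntegral_carlesonSquare {a : ℂ} (ha : a ∈ disc) (ha0 : a ≠ 0) {s : ℝ}
    (hs : s ∈ Set.Ioo (0 : ℝ) 1) :
    circleLIntegral ((carlesonSquare a).indicator 1) s =
      if ‖a‖ ≤ s then ENNReal.ofReal (1 - ‖a‖) else 0 := by
  have hna : 0 < ‖a‖ := norm_pos_iff.2 ha0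
  have ha1 := mem_disc.1 ha
  rw [← circleLIntegral_rotate (measurable_one.indicator (measurableSet_carlesonSquare a)) a.arg,
    circleLIntegral]
  have hmem : ∀ θ ∈ Set.Ioo (-Real.pi) Real.pi,
      (Complex.exp (a.arg * Complex.I) * circleMap 0 s θ ∈ carlesonSquare a ↔
        ‖a‖ ≤ s ∧ |θ| < (1 - ‖a‖) / 2) := by
    intro θ hθ
    have hn : ‖Complex.exp (a.arg * Complex.I) * circleMap 0 s θ‖ = s := by
      rw [norm_mul, Complex.norm_exp_ofReal_mul_I, norm_circleMap_zero, abs_of_pos hs.1, one_mul]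
    have harg : Complex.arg (Complex.exp (a.arg * Complex.I) * circleMap 0 s θ / a) = θ := by
      have h1 : Complex.exp (a.arg * Complex.I) * circleMap 0 s θ / a =
          ((s / ‖a‖ : ℝ) : ℂ) * (Real.cos θ + Real.sin θ * Complex.I) := by
        have h2 := Complex.norm_mul_exp_arg_mul_I a
        have h3 := Complex.exp_ne_zero (a.arg * Complex.I)
        have h4 : (‖a‖ : ℂ) ≠ 0 := by exact_mod_cast hna.ne'
        rw [circleMap_zero, Complex.exp_mul_I (θ : ℂ)]
        nth_rw 2 [← h2]
        push_cast
        field_simp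
      rw [h1]
      have := Complex.arg_mul_cos_add_sin_mul_I (div_pos hs.1 hna) ⟨hθ.1, hθ.2.le⟩
      push_cast at this ⊢
      exact this
    rw [mem_carlesonSquare ha0, mem_disc, hn, harg]
    simp [hs.2]
  split_ifs with h
  · have h1 : ∫⁻ θ in Set.Ioo (-Real.pi) Real.pi, (carlesonSquare a).indicator (1 : ℂ → ℝ≥0∞)
        (Complex.exp (a.arg * Complex.I) * circleMap 0 s θ) =
        ∫⁻ θ in Set.Ioo (-Real.pi) Real.pi,
          (Set.Ioo (-((1 - ‖a‖) / 2)) ((1 - ‖a‖) / 2)).indicator (1 : ℝ → ℝ≥0∞) θ := by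
      refine setLIntegral_congr_fun measurableSet_Ioo fun θ hθ => ?_
      simp only [Set.indicator, hmem θ hθ, h, true_and, Set.mem_Ioo, abs_lt]
      rfl
    rw [h1, setLIntegral_indicator measurableSet_Ioo, Set.inter_eq_self_of_subset_left]
    · simp only [Pi.one_apply, setLIntegral_one, Real.volume_Ioo]
      congr 1; ring
    · have := Real.pi_gt_three
      exact Set.Ioo_subset_Ioo (by linarith) (by linarith)
  · have h1 : ∫⁻ θ in Set.Ioo (-Real.pi) Real.pi, (carlesonSquare a).indicator (1 : ℂ → ℝ≥0∞)
        (Complex.exp (a.arg * Complex.I) * circleMap 0 s θ) =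
        ∫⁻ θ in Set.Ioo (-Real.pi) Real.pi, 0 := by
      refine setLIntegral_congr_fun measurableSet_Ioo fun θ hθ => ?_
      simp [Set.indicator, hmem θ hθ, h]
    rw [h1, lintegral_zero]

theorem circleLIntegral_disc {s : ℝ} (hs : s ∈ Set.Ioo (0 : ℝ) 1) :
    circleLIntegral (disc.indicator 1) s = ENNReal.ofReal (2 * Real.pi) := by
  rw [← circleLIntegral_one s]
  refine lintegral_congr fun θ => ?_
  rw [Set.indicator_of_mem]
  · rfl
  · rw [mem_disc, norm_circleMap_zero, abs_of_pos hs.1]; exact hs.2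

theorem circleLIntegral_carlesonSquare_le {a : ℂ} (ha : a ∈ disc) {s : ℝ}
    (hs : s ∈ Set.Ioo (0 : ℝ) 1) : circleLIntegral ((carlesonSquare a).indicator 1) s ≤
      (Set.Ici ‖a‖).indicator (fun _ => ENNReal.ofReal (2 * Real.pi * (1 - ‖a‖))) s := by
  have ha1 := mem_disc.1 ha
  by_cases ha0 : a = 0
  · subst ha0
    rw [carlesonSquare_zero, circleLIntegral_disc hs, Set.indicator_of_mem]
    · simp
    · simpa using hs.1.le
  · rw [circleLIntegral_carlesonSquare ha ha0 hs]
    split_ifs with h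
    · rw [Set.indicator_of_mem (by exact h)]
      refine ENNReal.ofReal_le_ofReal ?_
      nlinarith [Real.pi_gt_three]
    · exact zero_le

theorem le_circleLIntegral_carlesonSquare {a : ℂ} (ha : a ∈ disc) {s : ℝ}
    (hs : s ∈ Set.Ioo (0 : ℝ) 1) (has : ‖a‖ ≤ s) :
    ENNReal.ofReal (1 - ‖a‖) ≤ circleLIntegral ((carlesonSquare a).indicator 1) s := by
  by_cases ha0 : a = 0
  · subst ha0
    rw [carlesonSquare_zero, circleLIntegral_disc hs]
    refine ENNReal.ofReal_le_ofReal ?_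
    rw [norm_zero]
    linarith [Real.pi_gt_three]
  · rw [circleLIntegral_carlesonSquare ha ha0 hs, if_pos has]

theorem IsDoublingMeasure.measure_carlesonSquare {ν : Measure ℂ} {g : ℝ → ℝ≥0∞} {τ : ℝ → ℝ}
    (h : IsDoublingMeasure ν g τ) : ∃ C : ℝ, 0 < C ∧ ∀ a ∈ disc,
      ν (carlesonSquare a) ≤ ENNReal.ofReal (C * ((1 - ‖a‖) * τ (1 - ‖a‖))) ∧
      ENNReal.ofReal ((1 - ‖a‖) * τ (1 - ‖a‖)) ≤ ENNReal.ofReal C * ν (carlesonSquare a) := by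
  obtain ⟨C, B, hC, hB, hup⟩ := h.upper
  have hπ := Real.pi_pos
  refine ⟨2 * Real.pi + 2 * Real.pi * (C * 2 ^ B), by positivity, fun a ha => ?_⟩
  have ha1 := mem_disc.1 ha
  set t := 1 - ‖a‖ with ht
  have ht0 : 0 < t := by linarith
  have ht1 : t ≤ 1 := by linarith [norm_nonneg a]
  have hτ := h.pos t ht0 ht1
  have hint : ν (carlesonSquare a) = ∫⁻ s in Set.Ioo (0 : ℝ) 1, ENNReal.ofReal (s / Real.pi) * g s *
      circleLIntegral ((carlesonSquare a).indicator 1) s := by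
    rw [← h.lintegral_eq _ (measurable_one.indicator (measurableSet_carlesonSquare a)),
      lintegral_indicator_one (measurableSet_carlesonSquare a)]
  constructor
  · rw [hint]
    calc _ ≤ ∫⁻ s in Set.Ioo (0 : ℝ) 1, (Set.Ici ‖a‖).indicator
          (fun s => ENNReal.ofReal (2 * Real.pi * t) * g s) s := by
          refine setLIntegral_mono' measurableSet_Ioo fun s hs => ?_
          have h1 := circleLIntegral_carlesonSquare_le ha hs
          by_cases hsa : s ∈ Set.Ici ‖a‖
          · rw [Set.indicator_of_mem hsa] at h1 ⊢
            calc _ ≤ 1 * g s * ENNReal.ofReal (2 * Real.pi * t) := by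
                  gcongr
                  rw [ENNReal.ofReal_le_one, div_le_one hπ]
                  linarith [hs.2, Real.pi_gt_three]
              _ = _ := by ring
          · rw [Set.indicator_of_notMem hsa] at h1 ⊢
            rw [nonpos_iff_eq_zero.1 h1, mul_zero]
      _ ≤ ∫⁻ s in Set.Ico ‖a‖ 1, ENNReal.ofReal (2 * Real.pi * t) * g s := by
          rw [setLIntegral_indicator measurableSet_Ici]
          exact lintegral_mono_set fun s hs => ⟨hs.1, hs.2.2⟩
      _ = ENNReal.ofReal (2 * Real.pi * t * τ t) := by
          rw [setLIntegral_congr Ioo_ae_eq_Ico.symm, lintegral_const_mul _ h.measurable,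
            ENNReal.ofReal_mul (p := 2 * Real.pi * t) (by positivity), h.tail_eq t ht0 ht1, ht,
            sub_sub_cancel]
      _ ≤ _ := by
          refine ENNReal.ofReal_le_ofReal ?_
          have : 0 ≤ 2 * Real.pi * (C * 2 ^ B) * (t * τ t) := by positivity
          linarith
  -- The polar factor s degenerates near the origin. Only s > 1 - u ≥ 1/2 is kept, and upper
  -- doubling from t down to u ≥ t/2 pays for this.
  · set u := min t (1 / 2) with hu
    have hu0 : 0 < u := lt_min ht0 (by norm_num)
    have hut : u ≤ t := min_le_left _ _
    have hu2 : u ≤ 1 / 2 := min_le_right _ _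
    have htu : t ≤ 2 * u := by
      rw [hu]
      rcases min_cases t (1 / 2) with ⟨h1, _⟩ | ⟨h1, _⟩ <;> rw [h1] <;> linarith
    have hτu := h.pos u hu0 (hut.trans ht1)
    have hle : τ t ≤ C * 2 ^ B * τ u := by
      refine (hup u t hu0 hut ht1).trans ?_
      gcongr
      rwa [div_le_iff₀ hu0]
    have hlow : ENNReal.ofReal (t / (2 * Real.pi) * τ u) ≤ ν (carlesonSquare a) := by
      rw [hint, ENNReal.ofReal_mul (by positivity), h.tail_eq u hu0 (hut.trans ht1),
        ← lintegral_const_mul _ h.measurable]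
      refine (setLIntegral_mono' measurableSet_Ioo fun s hs => ?_).trans
        (lintegral_mono_set (Set.Ioo_subset_Ioo_left (by linarith)))
      have hs01 : s ∈ Set.Ioo (0 : ℝ) 1 := ⟨by linarith [hs.1], hs.2⟩
      have h1 := le_circleLIntegral_carlesonSquare ha hs01 (by linarith [hs.1])
      calc ENNReal.ofReal (t / (2 * Real.pi)) * g s
          = ENNReal.ofReal (1 / 2 / Real.pi) * g s * ENNReal.ofReal t := by
            rw [mul_right_comm, ← ENNReal.ofReal_mul (by positivity)]
            congr 2; field_simp
        _ ≤ _ := by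
            gcongr
            linarith [hs.1]
    calc ENNReal.ofReal (t * τ t)
        ≤ ENNReal.ofReal (2 * Real.pi * (C * 2 ^ B) * (t / (2 * Real.pi) * τ u)) := by
          refine ENNReal.ofReal_le_ofReal ?_
          calc t * τ t ≤ t * (C * 2 ^ B * τ u) := by gcongr
            _ = _ := by field_simp
      _ = ENNReal.ofReal (2 * Real.pi * (C * 2 ^ B)) *
          ENNReal.ofReal (t / (2 * Real.pi) * τ u) := by
          rw [← ENNReal.ofReal_mul (by positivity)]
      _ ≤ _ := by
          gcongr
          linarith

theorem exists_mem_carlesonSquare {t : ℝ} (ht1 : t < 1) {N : ℕ} (hN : 0 < N)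
    (hNt : 2 * Real.pi / N < t / 2) {z : ℂ} (hz : z ∈ disc) (hzt : 1 - ‖z‖ ≤ t) :
    ∃ j ∈ Finset.range (N + 1), z ∈ carlesonSquare
      (circleMap 0 (1 - t) (-Real.pi + 2 * Real.pi * j / N)) := by
  have hNr : (0 : ℝ) < N := by exact_mod_cast hN
  have hπ := Real.pi_pos
  set x := (z.arg + Real.pi) * N / (2 * Real.pi) with hx
  have hx0 : 0 ≤ x := by
    have := Complex.neg_pi_lt_arg z
    exact div_nonneg (mul_nonneg (by linarith) hNr.le) (by linarith)
  have hxN : x ≤ N := by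
    rw [hx, div_le_iff₀ (by positivity)]
    have := Complex.arg_le_pi z
    nlinarith
  have hj1 := Nat.floor_le hx0
  have hj2 := Nat.lt_floor_add_one x
  -- The angle of z, measured from -π in units of 2π/N, is rounded down. The value arg z = π gives
  -- the index N, hence N + 1 squares.
  refine ⟨⌊x⌋₊, ?_, ?_⟩
  · rw [Finset.mem_range, Nat.lt_succ_iff]
    exact Nat.floor_le_of_le hxN
  set j : ℝ := (⌊x⌋₊ : ℝ) with hj
  set θ := -Real.pi + 2 * Real.pi * j / N with hθ
  have hd : z.arg - θ = 2 * Real.pi / N * (x - j) := by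
    rw [hθ, hx]; field_simp; ring
  have hd0 : 0 ≤ z.arg - θ := by rw [hd]; exact mul_nonneg (by positivity) (by linarith)
  have hd1 : z.arg - θ < t / 2 := by
    refine lt_of_le_of_lt ?_ hNt
    rw [hd]
    exact mul_le_of_le_one_right (by positivity) (by linarith)
  have hna : ‖circleMap 0 (1 - t) θ‖ = 1 - t := by
    rw [norm_circleMap_zero, abs_of_pos (by linarith)]
  have ha0 : circleMap 0 (1 - t) θ ≠ 0 := by
    rw [← norm_pos_iff, hna]; linarith
  have hz0 : 0 < ‖z‖ := by linarith
  rw [mem_carlesonSquare ha0, hna]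
  refine ⟨hz, by linarith, ?_⟩
  have h1 : z / circleMap 0 (1 - t) θ = ((‖z‖ / (1 - t) : ℝ) : ℂ) *
      (Real.cos (z.arg - θ) + Real.sin (z.arg - θ) * Complex.I) := by
    have h2 : (Real.cos (z.arg - θ) + Real.sin (z.arg - θ) * Complex.I : ℂ) =
        Complex.exp (z.arg * Complex.I) / Complex.exp (θ * Complex.I) := by
      rw [← Complex.exp_sub, ← sub_mul, Complex.exp_mul_I]
      push_cast; rfl
    rw [h2, circleMap_zero]
    nth_rw 1 [← Complex.norm_mul_exp_arg_mul_I z]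
    push_cast
    rw [mul_div_mul_comm]
  have h3 := Complex.arg_mul_cos_add_sin_mul_I (div_pos hz0 (by linarith : 0 < 1 - t))
    (θ := z.arg - θ) ⟨by linarith, by linarith [Real.pi_gt_three]⟩
  rw [h1]
  have h4 : Complex.arg (((‖z‖ / (1 - t) : ℝ) : ℂ) *
      (Real.cos (z.arg - θ) + Real.sin (z.arg - θ) * Complex.I)) = z.arg - θ := by
    push_cast at h3 ⊢
    exact h3
  rw [h4, abs_of_nonneg hd0]
  linarith

/-- The annulus is covered by O(1/t) squares of height t, so a bound t^(1+β) on the squares becomes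
t^β for the annulus. -/
theorem measure_annulus_le {μ : Measure ℂ} {t : ℝ} (ht : 0 < t) (ht1 : t < 1) {M : ℝ≥0∞}
    (hM : ∀ a : ℂ, ‖a‖ = 1 - t → μ (carlesonSquare a) ≤ M) :
    μ {z ∈ disc | 1 - ‖z‖ ≤ t} ≤ ENNReal.ofReal (16 / t) * M := by
  have hπ := Real.pi_pos
  set N := ⌊4 * Real.pi / t⌋₊ + 1 with hN
  have hN1 : (N : ℝ) ≤ 4 * Real.pi / t + 1 := by
    rw [hN]; push_cast
    have := Nat.floor_le (by positivity : 0 ≤ 4 * Real.pi / t)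
    linarith
  have hN2 : 4 * Real.pi / t < N := by
    rw [hN]; push_cast; exact Nat.lt_floor_add_one _
  have hNr : (0 : ℝ) < N := lt_trans (by positivity) hN2
  have hNt : 2 * Real.pi / N < t / 2 := by
    rw [div_lt_iff₀ ht] at hN2
    rw [div_lt_div_iff₀ hNr (by norm_num)]
    linarith
  calc μ {z ∈ disc | 1 - ‖z‖ ≤ t}
      ≤ μ (⋃ j ∈ Finset.range (N + 1), carlesonSquare
        (circleMap 0 (1 - t) (-Real.pi + 2 * Real.pi * j / N))) := by
        refine measure_mono fun z hz => ?_
        obtain ⟨j, hj, hmem⟩ := exists_mem_carlesonSquare ht1 (by exact_mod_cast hNr) hNt hz.1 hz.2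
        exact Set.mem_biUnion hj hmem
    _ ≤ ∑ j ∈ Finset.range (N + 1), μ (carlesonSquare
        (circleMap 0 (1 - t) (-Real.pi + 2 * Real.pi * j / N))) := measure_biUnion_finset_le _ _
    _ ≤ ∑ _j ∈ Finset.range (N + 1), M := by
        refine Finset.sum_le_sum fun j _ => hM _ ?_
        rw [norm_circleMap_zero, abs_of_pos (by linarith)]
    _ = ENNReal.ofReal (N + 1) * M := by
        rw [Finset.sum_const, Finset.card_range, nsmul_eq_mul]
        congr 1
        rw [ENNReal.ofReal_add hNr.le zero_le_one]
        simp
    _ ≤ _ := by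
        gcongr
        have h1 : 4 * Real.pi / t + 2 ≤ 16 / t := by
          rw [div_add' _ _ _ ht.ne', div_le_div_iff_of_pos_right ht]
          have := Real.pi_lt_d2
          linarith
        linarith

/-! ### Kernel estimates and test functions -/

/-- The modular `∫_𝔻 |f|^p Ψ(|f|) dμ`. -/
def modular (p : ℝ) (Ψ : ℝ → ℝ) (μ : Measure ℂ) (f : ℂ → ℂ) : ℝ≥0∞ :=
  ∫⁻ z in disc, ENNReal.ofReal (‖f z‖ ^ p * Ψ ‖f z‖) ∂μ

namespace IsDoublingMeasure

variable {ν : Measure ℂ} {g : ℝ → ℝ≥0∞} {τ : ℝ → ℝ}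

theorem measure_compl_disc (h : IsDoublingMeasure ν g τ) : ν discᶜ = 0 := by
  rw [← lintegral_indicator_one measurableSet_disc.compl,
    h.lintegral_eq _ (measurable_one.indicator measurableSet_disc.compl)]
  rw [← lintegral_zero (μ := volume.restrict (Set.Ioo (0 : ℝ) 1))]
  refine setLIntegral_congr_fun measurableSet_Ioo fun s hs => ?_
  have h0 : circleLIntegral (discᶜ.indicator 1) s = 0 := by
    rw [circleLIntegral, ← lintegral_zero (μ := volume.restrict (Set.Ioo (-Real.pi) Real.pi))]
    refine lintegral_congr fun θ => ?_
    rw [Set.indicator_of_notMem]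
    rw [Set.notMem_compl_iff, mem_disc, norm_circleMap_zero, abs_of_pos hs.1]
    exact hs.2
  simp only [h0, mul_zero]

theorem restrict_disc (h : IsDoublingMeasure ν g τ) : ν.restrict disc = ν :=
  Measure.restrict_eq_self_of_ae_mem (by
    rw [ae_iff]; exact h.measure_compl_disc)

theorem mul_tail_le (h : IsDoublingMeasure ν g τ) : ∃ C B : ℝ, 0 < C ∧ 0 < B ∧ ∀ t s : ℝ,
    0 < t → t ≤ s → s ≤ 1 → s * τ s ≤ C * (s / t) ^ B * (t * τ t) := by
  obtain ⟨C, B, hC, hB, hup⟩ := h.upper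
  refine ⟨C, B + 1, hC, by linarith, fun t s ht hts hs => ?_⟩
  have hs0 : 0 < s := ht.trans_le hts
  have h1 := hup t s ht hts hs
  calc s * τ s ≤ s * (C * (s / t) ^ B * τ t) := by gcongr
    _ = C * ((s / t) ^ B * (s / t)) * (t * τ t) := by field_simp
    _ = _ := by
      rw [Real.rpow_add_one (by positivity)]

/-- The upper bound holds because the power decay t^β of the tail absorbs the slow factor; the lower
bound comes from upper doubling. Negative powers of this quantity are thereby polynomially related
to 1/t. -/
theorem weight_bounds (h : IsDoublingMeasure ν g τ) {Ψ : ℝ → ℝ} (hΨ : IsSlow Ψ) :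
    ∃ C B : ℝ, 0 < C ∧ 0 < B ∧ ∀ t : ℝ, 0 < t → t ≤ 1 →
      t * τ t * Ψ (1 / t) ≤ C * t ∧ t ^ B ≤ C * (t * τ t * Ψ (1 / t)) := by
  obtain ⟨C₁, β, hC₁, hβ, h1⟩ := h.decay
  obtain ⟨C₂, hC₂, h2⟩ := hΨ.inv_le hβ
  obtain ⟨C₃, B, hC₃, hB, h3⟩ := h.mul_tail_le
  obtain ⟨C₄, hC₄, h4⟩ := hΨ.le_inv (one_pos)
  have hτ1 := h.pos 1 one_pos le_rfl
  refine ⟨C₁ * C₂ + C₃ * C₄ / τ 1, B + 1, by positivity, by positivity, fun t ht ht1 => ?_⟩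
  have hψ := hΨ.pos (1 / t) (by positivity)
  have hτ := h.pos t ht ht1
  constructor
  · calc t * τ t * Ψ (1 / t) ≤ t * (C₁ * t ^ β) * (C₂ * t ^ (-β)) := by
          gcongr
          · exact h1 t ht ht1
          · exact h2 t ht ht1
      _ = C₁ * C₂ * t * (t ^ β * t ^ (-β)) := by ring
      _ = C₁ * C₂ * t := by rw [← Real.rpow_add ht, add_neg_cancel, Real.rpow_zero, mul_one]
      _ ≤ _ := by
          gcongr
          have : 0 < C₃ * C₄ / τ 1 := by positivity
          linarith
  · have h5 := h3 t 1 ht ht1 le_rfl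
    have h6 := h4 t ht ht1
    rw [Real.rpow_one] at h6
    have h7 : t ^ B * τ 1 ≤ C₃ * (t * τ t) := by
      calc t ^ B * τ 1 ≤ t ^ B * (C₃ * (1 / t) ^ B * (t * τ t)) := by
            gcongr; linarith
        _ = C₃ * (t * τ t) * (t ^ B * (1 / t) ^ B) := by ring
        _ = _ := by
          rw [← Real.mul_rpow ht.le (by positivity), mul_one_div_cancel ht.ne', Real.one_rpow,
            mul_one]
    calc t ^ (B + 1) = t ^ B * τ 1 * t / τ 1 := by
          rw [Real.rpow_add_one ht.ne']; field_simp
      _ ≤ C₃ * (t * τ t) * (C₄ * Ψ (1 / t)) / τ 1 := by gcongr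
      _ = C₃ * C₄ / τ 1 * (t * τ t * Ψ (1 / t)) := by ring
      _ ≤ _ := by
          have : 0 < C₁ * C₂ := by positivity
          gcongr
          linarith

theorem one_sub_norm_le_norm_one_sub {a z : ℂ} (hz : z ∈ disc) :
    1 - ‖a‖ ≤ ‖1 - (starRingEnd ℂ) a * z‖ := by
  have h1 := norm_sub_norm_le (1 : ℂ) ((starRingEnd ℂ) a * z)
  rw [norm_one, norm_mul, RCLike.norm_conj] at h1
  have := mul_le_of_le_one_right (norm_nonneg a) (mem_disc.1 hz).le
  linarith

/-- Split the disc according to the dyadic size 2^k t of |1 - āz|. The k-th piece lies in a Carleson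
square of height at most 16·2^k t, whose measure upper doubling bounds by (16·2^k)^B times t τ(t).
-/
theorem lintegral_kernel_le (h : IsDoublingMeasure ν g τ) : ∃ C lam : ℝ, 0 < C ∧ 0 < lam ∧
    ∀ a ∈ disc, ∫⁻ z in disc, ENNReal.ofReal
      (((1 - ‖a‖) / ‖1 - (starRingEnd ℂ) a * z‖) ^ lam) ∂ν ≤
      ENNReal.ofReal (C * ((1 - ‖a‖) * τ (1 - ‖a‖))) := by
  obtain ⟨C₁, hC₁, hS⟩ := h.measure_carlesonSquare
  obtain ⟨C₂, B, hC₂, hB, hw⟩ := h.mul_tail_le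
  -- The power B of the kernel cancels the doubling loss and the extra 1 leaves the geometric series
  -- of 2^(-k), whose sum is 2.
  refine ⟨2 * (C₁ * (C₂ * 16 ^ B)), B + 1, by positivity, by positivity, fun a ha => ?_⟩
  have ha1 := mem_disc.1 ha
  set t := 1 - ‖a‖ with ht
  have ht0 : 0 < t := by linarith
  have ht1 : t ≤ 1 := by linarith [norm_nonneg a]
  have hτ := h.pos t ht0 ht1
  set E : ℕ → Set ℂ := fun k => {z ∈ disc | ‖1 - (starRingEnd ℂ) a * z‖ < 2 ^ (k + 1) * t} with hE
  have hEm : ∀ k, MeasurableSet (E k) := fun k =>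
    measurableSet_disc.inter (measurableSet_lt (f := fun z => ‖1 - (starRingEnd ℂ) a * z‖)
      (by fun_prop) measurable_const)
  have hEν : ∀ k, ν (E k) ≤ ENNReal.ofReal (C₁ * (C₂ * (16 * 2 ^ k) ^ B * (t * τ t))) := by
    intro k
    have h2k : (1 : ℝ) ≤ 2 ^ k := one_le_pow₀ (by norm_num)
    have htk : t ≤ 2 ^ k * t := le_mul_of_one_le_left ht0.le h2k
    have hσ : 1 - ‖a‖ ≤ 2 ^ (k + 1) * t := by rw [pow_succ]; linarith
    obtain ⟨b, hb, hb1, hsub⟩ := exists_carlesonSquare_superset ha hσ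
    refine (measure_mono fun z hz => hsub z hz.1 hz.2).trans ((hS b hb).1.trans ?_)
    have hb2 : 1 - ‖b‖ ≤ 16 * 2 ^ k * t := by
      rw [hb1]; refine (min_le_right _ _).trans (le_of_eq ?_); rw [pow_succ]; ring
    have hb3 : t ≤ 1 - ‖b‖ := by rw [hb1]; exact le_min ht1 (by rw [pow_succ]; linarith)
    have hb4 : 1 - ‖b‖ ≤ 1 := by linarith [norm_nonneg b]
    refine ENNReal.ofReal_le_ofReal ?_
    gcongr C₁ * ?_
    refine (hw t _ ht0 hb3 hb4).trans ?_
    have : 0 ≤ (1 - ‖b‖) / t := div_nonneg (by linarith) ht0.le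
    gcongr
    rw [div_le_iff₀ ht0]; exact hb2
  have hpt : ∀ z ∈ disc, ENNReal.ofReal ((t / ‖1 - (starRingEnd ℂ) a * z‖) ^ (B + 1)) ≤
      ∑' k : ℕ, ENNReal.ofReal (((2 ^ k)⁻¹ : ℝ) ^ (B + 1)) * (E k).indicator 1 z := by
    intro z hz
    have h1 := one_sub_norm_le_norm_one_sub (a := a) hz
    have hpos : 0 < ‖1 - (starRingEnd ℂ) a * z‖ := ht0.trans_le h1
    obtain ⟨k, hk1, hk2⟩ := exists_nat_pow_near ((one_le_div ht0).2 h1)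
      (one_lt_two : (1 : ℝ) < 2)
    have hzE : z ∈ E k := ⟨hz, by rw [div_lt_iff₀ ht0] at hk2; exact hk2⟩
    refine le_trans ?_ (ENNReal.le_tsum k)
    rw [Set.indicator_of_mem hzE, Pi.one_apply, mul_one]
    refine ENNReal.ofReal_le_ofReal ?_
    gcongr
    rw [le_div_iff₀ ht0] at hk1
    rw [div_le_iff₀ hpos, inv_mul_eq_div, le_div_iff₀ (by positivity)]
    linarith
  calc _ ≤ ∫⁻ z in disc, ∑' k : ℕ, ENNReal.ofReal (((2 ^ k)⁻¹ : ℝ) ^ (B + 1)) *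
          (E k).indicator 1 z ∂ν := setLIntegral_mono' measurableSet_disc hpt
    _ ≤ ∫⁻ z, ∑' k : ℕ, ENNReal.ofReal (((2 ^ k)⁻¹ : ℝ) ^ (B + 1)) *
          (E k).indicator 1 z ∂ν := setLIntegral_le_lintegral _ _
    _ = ∑' k : ℕ, ENNReal.ofReal (((2 ^ k)⁻¹ : ℝ) ^ (B + 1)) * ν (E k) := by
        rw [lintegral_tsum fun k => ((measurable_one.indicator (hEm k)).const_mul _).aemeasurable]
        congr 1
        ext k
        rw [lintegral_const_mul _ (measurable_one.indicator (hEm k)),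
          lintegral_indicator_one (hEm k)]
    _ ≤ ∑' k : ℕ, ENNReal.ofReal (C₁ * (C₂ * 16 ^ B) * (t * τ t)) * (2⁻¹ : ℝ≥0∞) ^ k := by
        refine ENNReal.tsum_le_tsum fun k => ?_
        calc _ ≤ ENNReal.ofReal (((2 ^ k)⁻¹ : ℝ) ^ (B + 1)) *
              ENNReal.ofReal (C₁ * (C₂ * (16 * 2 ^ k) ^ B * (t * τ t))) := by
              gcongr; exact hEν k
          _ = ENNReal.ofReal (C₁ * (C₂ * 16 ^ B) * (t * τ t)) * ENNReal.ofReal ((2 ^ k)⁻¹) := by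
              rw [← ENNReal.ofReal_mul (by positivity), ← ENNReal.ofReal_mul (by positivity)]
              congr 1
              rw [Real.rpow_add_one (by positivity), Real.mul_rpow (by norm_num) (by positivity),
                Real.inv_rpow (by positivity)]
              have : ((2 : ℝ) ^ k) ^ B ≠ 0 := by positivity
              field_simp
          _ = _ := by
              congr 1
              rw [ENNReal.ofReal_inv_of_pos (by positivity), ENNReal.ofReal_pow (by norm_num),
                ENNReal.inv_pow]
              simp
    _ = _ := by
        rw [ENNReal.tsum_mul_left, ENNReal.tsum_geometric, ENNReal.one_sub_inv_two, inv_inv,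
          mul_comm, mul_assoc 2, ENNReal.ofReal_mul (p := 2) (by norm_num)]
        simp

end IsDoublingMeasure

/-- The power of the Szegő-type kernel at `a`, with amplitude `κ`. -/
def testFunction (κ : ℝ) (n : ℕ) (a z : ℂ) : ℂ :=
  κ * ((1 - ‖a‖ : ℝ) / (1 - (starRingEnd ℂ) a * z)) ^ n

theorem norm_testFunction {κ : ℝ} (hκ : 0 ≤ κ) (n : ℕ) {a : ℂ} (ha : a ∈ disc) (z : ℂ) :
    ‖testFunction κ n a z‖ = κ * ((1 - ‖a‖) / ‖1 - (starRingEnd ℂ) a * z‖) ^ n := by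
  rw [testFunction, norm_mul, norm_pow, norm_div, Complex.norm_real, Complex.norm_real,
    Real.norm_of_nonneg hκ, Real.norm_of_nonneg (by linarith [mem_disc.1 ha])]

theorem differentiableOn_testFunction (κ : ℝ) (n : ℕ) {a : ℂ} (ha : a ∈ disc) :
    DifferentiableOn ℂ (testFunction κ n a) disc := by
  intro z hz
  have h1 := IsDoublingMeasure.one_sub_norm_le_norm_one_sub (a := a) hz
  have h2 : 1 - (starRingEnd ℂ) a * z ≠ 0 := by
    rw [← norm_pos_iff]; linarith [mem_disc.1 ha]
  unfold testFunction
  refine DifferentiableAt.differentiableWithinAt ?_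
  fun_prop (disch := exact h2)

/-- The amplitude M(t) = W(t)^(-1/p) makes |F_a|^p Ψ(|F_a|) of order 1/(t τ(t)) on S(a), and the
kernel makes it integrable elsewhere. The factor r is carried along because Ψ is not homogeneous:
for compactness the functions must fit into an arbitrarily small ball. -/
theorem IsDoublingMeasure.exists_testFunctions {ν : Measure ℂ} {g : ℝ → ℝ≥0∞} {τ : ℝ → ℝ}
    (h : IsDoublingMeasure ν g τ) {Ψ : ℝ → ℝ} (hΨ : IsSlow Ψ) {p : ℝ} (hp : 0 < p) :
    ∃ F : ℂ → ℂ → ℂ, (∀ a ∈ disc, DifferentiableOn ℂ (F a) disc) ∧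
      (∃ C : ℝ, 0 < C ∧ ∀ r : ℝ, 0 < r → r ≤ 1 → ∀ a ∈ disc,
        modular p Ψ ν (fun z => r * F a z) ≤ ENNReal.ofReal (C * r ^ (p / 2))) ∧
      (∀ z ∈ disc, Tendsto (fun a => F a z) (comap (fun a : ℂ => ‖a‖) (𝓝[<] 1)) (𝓝 0)) ∧
      (∀ (Φ : ℝ → ℝ) (q r : ℝ), IsSlow Φ → 0 < q → 0 < r → ∃ C : ℝ, 0 < C ∧
        ∀ a ∈ disc, ∀ z ∈ carlesonSquare a,
          Φ (1 / (1 - ‖a‖)) /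
            ((1 - ‖a‖) * τ (1 - ‖a‖) * Ψ (1 / (1 - ‖a‖))) ^ (q / p) ≤
          C * (‖r * F a z‖ ^ q * Φ ‖r * F a z‖)) := by
  obtain ⟨C₁, B, hC₁, hB, hW⟩ := h.weight_bounds hΨ
  obtain ⟨C₂, lam, hC₂, hlam, hker⟩ := h.lintegral_kernel_le
  set W : ℝ → ℝ := fun t => t * τ t * Ψ (1 / t) with hWdef
  set M : ℝ → ℝ := fun t => W t ^ (-(1 / p)) with hM
  have hWpos : ∀ t, 0 < t → t ≤ 1 → 0 < W t := fun t ht ht1 =>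
    mul_pos (mul_pos ht (h.pos t ht ht1)) (hΨ.pos _ (by positivity))
  have hMpos : ∀ t, 0 < t → t ≤ 1 → 0 < M t := fun t ht ht1 => Real.rpow_pos_of_pos (hWpos t ht ht1) _
  have hM1 : ∀ t, 0 < t → t ≤ 1 → C₁ ^ (-(1 / p)) * t ^ (-(1 / p)) ≤ M t := by
    intro t ht ht1
    rw [← Real.mul_rpow hC₁.le ht.le]
    exact Real.rpow_le_rpow_of_nonpos (hWpos t ht ht1) (hW t ht ht1).1
      (by rw [neg_nonpos]; positivity)
  have hM2 : ∀ t, 0 < t → t ≤ 1 → M t ≤ C₁ ^ (1 / p) * t ^ (-(B / p)) := by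
    intro t ht ht1
    have h1 : C₁⁻¹ * t ^ B ≤ W t := by
      rw [inv_mul_le_iff₀ hC₁]; exact (hW t ht ht1).2
    calc M t ≤ (C₁⁻¹ * t ^ B) ^ (-(1 / p)) :=
          Real.rpow_le_rpow_of_nonpos (by positivity) h1 (by rw [neg_nonpos]; positivity)
      _ = _ := by
          rw [Real.mul_rpow (by positivity) (by positivity), ← Real.rpow_mul ht.le,
            Real.inv_rpow hC₁.le, Real.rpow_neg hC₁.le, inv_inv]
          ring_nf
  have hcmpM : ∀ Θ : ℝ → ℝ, IsSlow Θ → ∃ C : ℝ, 0 < C ∧ ∀ t, 0 < t → t ≤ 1 →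
      Θ (M t) ≤ C * Θ (1 / t) ∧ Θ (1 / t) ≤ C * Θ (M t) := by
    intro Θ hΘ
    obtain ⟨C, hC, hc⟩ := hΘ.comparable_inv_of_between (a := C₁ ^ (-(1 / p))) (A := C₁ ^ (1 / p))
      (ε := 1 / p) (B := B / p) (by positivity) (by positivity) (by positivity)
    exact ⟨C, hC, fun t ht ht1 => hc t (M t) ht ht1 (hM1 t ht ht1) (hM2 t ht ht1)⟩
  -- The first condition lets half of the p-th power dominate the kernel power; the second makes
  -- M(t) t^n tend to 0.
  obtain ⟨n, hn⟩ := exists_nat_gt (max (lam / (p / 2)) (B / p))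
  have hn1 : lam ≤ n * (p / 2) := by
    have := (le_max_left _ _).trans hn.le
    rwa [div_le_iff₀ (by positivity)] at this
  have hn2 : B / p < n := (le_max_right _ _).trans_lt hn
  have ht : ∀ a ∈ disc, 0 < 1 - ‖a‖ ∧ 1 - ‖a‖ ≤ 1 := fun a ha =>
    ⟨by linarith [mem_disc.1 ha], by linarith [norm_nonneg a]⟩
  have hnorm : ∀ a ∈ disc, ∀ r : ℝ, 0 < r → ∀ z : ℂ, ‖r * testFunction (M (1 - ‖a‖)) n a z‖ =
      r * M (1 - ‖a‖) * ((1 - ‖a‖) / ‖1 - (starRingEnd ℂ) a * z‖) ^ n := by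
    intro a ha r hr z
    rw [norm_mul, Complex.norm_real, Real.norm_of_nonneg hr.le,
      norm_testFunction (hMpos _ (ht a ha).1 (ht a ha).2).le n ha, mul_assoc]
  refine ⟨fun a => testFunction (M (1 - ‖a‖)) n a,
    fun a ha => differentiableOn_testFunction _ n ha, ?_, ?_, ?_⟩
  · obtain ⟨C₃, hC₃, h3⟩ := hΨ.rpow_mul_le (half_pos hp)
    obtain ⟨C₄, hC₄, h4⟩ := hcmpM Ψ hΨ
    refine ⟨C₃ * C₄ * C₂, by positivity, fun r hr hr1 a ha => ?_⟩
    obtain ⟨ht0, ht1⟩ := ht a ha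
    set t := 1 - ‖a‖ with htdef
    have hMt := hMpos t ht0 ht1
    have hτ := h.pos t ht0 ht1
    have hψ := hΨ.pos (1 / t) (by positivity)
    have hMp : M t ^ p = (W t)⁻¹ := by
      simp only [hM]
      rw [← Real.rpow_mul (hWpos t ht0 ht1).le, neg_mul, one_div_mul_cancel hp.ne',
        Real.rpow_neg_one]
    have hpt : ∀ z ∈ disc, ENNReal.ofReal (‖r * testFunction (M t) n a z‖ ^ p *
        Ψ ‖r * testFunction (M t) n a z‖) ≤ ENNReal.ofReal (C₃ * C₄ * r ^ (p / 2) / (t * τ t)) *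
          ENNReal.ofReal ((t / ‖1 - (starRingEnd ℂ) a * z‖) ^ lam) := by
      intro z hz
      have h1 := one_sub_norm_le_norm_one_sub (a := a) hz
      have hpos : 0 < ‖1 - (starRingEnd ℂ) a * z‖ := ht0.trans_le h1
      rw [hnorm a ha r hr z, ← htdef, ← ENNReal.ofReal_mul (by positivity)]
      refine ENNReal.ofReal_le_ofReal ?_
      set s := t / ‖1 - (starRingEnd ℂ) a * z‖ with hs
      have hs0 : 0 < s := by positivity
      have hs1 : s ≤ 1 := (div_le_one hpos).2 h1
      have hsn : s ^ n ≤ 1 := pow_le_one₀ hs0.le hs1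
      have hle : r * M t * s ^ n ≤ M t := by
        calc r * M t * s ^ n ≤ 1 * M t * 1 := by gcongr
          _ = _ := by ring
      have hx0 : 0 < r * M t * s ^ n := by positivity
      have hsl : (s ^ n) ^ (p / 2) ≤ s ^ lam := by
        rw [← Real.rpow_natCast, ← Real.rpow_mul hs0.le]
        exact Real.rpow_le_rpow_of_exponent_ge hs0 hs1 hn1
      have hsplit : ∀ x : ℝ, 0 < x → x ^ p = x ^ (p / 2) * x ^ (p / 2) := fun x hx => by
        rw [← Real.rpow_add hx, add_halves]
      -- Half of the power makes x^(p/2) Ψ(x) almost increasing, so that it can be evaluated at M(t)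
      -- instead; the other half retains r^(p/2) and the kernel decay.
      calc (r * M t * s ^ n) ^ p * Ψ (r * M t * s ^ n)
          = (r * M t * s ^ n) ^ (p / 2) *
            ((r * M t * s ^ n) ^ (p / 2) * Ψ (r * M t * s ^ n)) := by
            rw [hsplit _ hx0]; ring
        _ ≤ (r ^ (p / 2) * M t ^ (p / 2) * s ^ lam) * (C₃ * (M t ^ (p / 2) * (C₄ * Ψ (1 / t)))) := by
            have e1 : (r * M t * s ^ n) ^ (p / 2) = r ^ (p / 2) * M t ^ (p / 2) * (s ^ n) ^ (p / 2) := by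
              rw [Real.mul_rpow (by positivity) (by positivity), Real.mul_rpow hr.le hMt.le]
            have e2 := h3 _ _ hx0.le hle
            have e3 := (h4 t ht0 ht1).1
            have e4 : (0 : ℝ) < (r * M t * s ^ n) ^ (p / 2) * Ψ (r * M t * s ^ n) :=
              mul_pos (by positivity) (hΨ.pos _ hx0.le)
            refine mul_le_mul (by rw [e1]; gcongr) (e2.trans (by gcongr)) e4.le (by positivity)
        _ = C₃ * C₄ * r ^ (p / 2) * Ψ (1 / t) * M t ^ p * s ^ lam := by
            rw [hsplit _ hMt]; ring
        _ = _ := by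
            rw [hMp, hWdef]; field_simp
    calc modular p Ψ ν (fun z => r * testFunction (M t) n a z)
        ≤ ∫⁻ z in disc, ENNReal.ofReal (C₃ * C₄ * r ^ (p / 2) / (t * τ t)) *
          ENNReal.ofReal ((t / ‖1 - (starRingEnd ℂ) a * z‖) ^ lam) ∂ν :=
          setLIntegral_mono' measurableSet_disc hpt
      _ ≤ ENNReal.ofReal (C₃ * C₄ * r ^ (p / 2) / (t * τ t)) *
          ENNReal.ofReal (C₂ * (t * τ t)) := by
          rw [lintegral_const_mul' _ _ ENNReal.ofReal_ne_top]
          gcongr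
          exact hker a ha
      _ = _ := by
          rw [← ENNReal.ofReal_mul (by positivity)]
          congr 1
          field_simp
  · intro z hz
    have hz1 := mem_disc.1 hz
    have hlim : Tendsto (fun a : ℂ => C₁ ^ (1 / p) * (1 - ‖a‖) ^ ((n : ℝ) - B / p) / (1 - ‖z‖) ^ n)
        (comap (fun a : ℂ => ‖a‖) (𝓝[<] 1)) (𝓝 0) := by
      have h1 : Tendsto (fun x : ℝ => C₁ ^ (1 / p) * (1 - x) ^ ((n : ℝ) - B / p) / (1 - ‖z‖) ^ n)
          (𝓝[<] 1) (𝓝 (C₁ ^ (1 / p) * (1 - 1) ^ ((n : ℝ) - B / p) / (1 - ‖z‖) ^ n)) := by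
        refine Tendsto.mono_left ?_ nhdsWithin_le_nhds
        refine ContinuousAt.tendsto ?_
        have : ContinuousAt (fun x : ℝ => (1 - x) ^ ((n : ℝ) - B / p)) 1 :=
          (continuousAt_const.sub continuousAt_id).rpow_const (Or.inr (by linarith))
        exact (continuousAt_const.mul this).div_const _
      rw [sub_self, Real.zero_rpow (by linarith), mul_zero, zero_div] at h1
      exact h1.comp tendsto_comap
    refine squeeze_zero_norm' ?_ hlim
    have hev : ∀ᶠ a : ℂ in comap (fun a : ℂ => ‖a‖) (𝓝[<] 1), ‖a‖ < 1 :=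
      tendsto_comap.eventually self_mem_nhdsWithin
    filter_upwards [hev] with a ha1
    have ha : a ∈ disc := mem_disc.2 ha1
    obtain ⟨ht0, ht1⟩ := ht a ha
    rw [norm_testFunction (hMpos _ ht0 ht1).le n ha]
    have h2 : 1 - ‖z‖ ≤ ‖1 - (starRingEnd ℂ) a * z‖ := by
      have h1 := norm_sub_norm_le (1 : ℂ) ((starRingEnd ℂ) a * z)
      rw [norm_one, norm_mul, RCLike.norm_conj] at h1
      have := mul_le_of_le_one_left (norm_nonneg z) ha1.le
      linarith
    have hz0 : 0 < 1 - ‖z‖ := by linarith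
    calc M (1 - ‖a‖) * ((1 - ‖a‖) / ‖1 - (starRingEnd ℂ) a * z‖) ^ n
        ≤ (C₁ ^ (1 / p) * (1 - ‖a‖) ^ (-(B / p))) * ((1 - ‖a‖) / (1 - ‖z‖)) ^ n := by
          gcongr
          exact hM2 _ ht0 ht1
      _ = _ := by
          rw [div_pow, ← Real.rpow_natCast (1 - ‖a‖) n,
            show (n : ℝ) - B / p = -(B / p) + n by ring, Real.rpow_add ht0]
          ring
  · intro Φ q r hΦ hq hr
    obtain ⟨C₄, hC₄, h4⟩ := hcmpM Φ hΦ
    -- On S(a) one has |1 - āz| ≤ 3t, so M(t) ≤ (3^n / r) |r F_a(z)|.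
    obtain ⟨C₅, hC₅, h5⟩ := hΦ.rpow_mul_le_of_le_mul hq (L := max 1 (3 ^ n / r)) (le_max_left _ _)
    refine ⟨C₄ * C₅, by positivity, fun a ha z hz => ?_⟩
    obtain ⟨ht0, ht1⟩ := ht a ha
    rw [hnorm a ha r hr z]
    have hup := norm_one_sub_conj_mul_le ha hz
    have h1 := one_sub_norm_le_norm_one_sub (a := a) (carlesonSquare_subset_disc a hz)
    set t := 1 - ‖a‖ with htdef
    have hMt := hMpos t ht0 ht1
    have hpos : 0 < ‖1 - (starRingEnd ℂ) a * z‖ := ht0.trans_le h1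
    set s := t / ‖1 - (starRingEnd ℂ) a * z‖ with hs
    have hs0 : 0 < s := by positivity
    have hs3 : 1 ≤ 3 * s := by
      rw [hs, ← mul_div_assoc, le_div_iff₀ hpos]; linarith
    have hle : M t ≤ max 1 (3 ^ n / r) * (r * M t * s ^ n) := by
      calc M t ≤ (3 * s) ^ n * M t := le_mul_of_one_le_left hMt.le (one_le_pow₀ hs3)
        _ = 3 ^ n / r * (r * M t * s ^ n) := by rw [mul_pow]; field_simp
        _ ≤ _ := by gcongr; exact le_max_right _ _
    have hWq : (W t ^ (q / p))⁻¹ = M t ^ q := by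
      simp only [hM]
      rw [← Real.rpow_mul (hWpos t ht0 ht1).le, ← Real.rpow_neg (hWpos t ht0 ht1).le]
      congr 1; ring
    calc Φ (1 / t) / W t ^ (q / p) = M t ^ q * Φ (1 / t) := by
          rw [div_eq_mul_inv, hWq, mul_comm]
      _ ≤ M t ^ q * (C₄ * Φ (M t)) := by
          gcongr; exact (h4 t ht0 ht1).2
      _ = C₄ * (M t ^ q * Φ (M t)) := by ring
      _ ≤ C₄ * (C₅ * ((r * M t * s ^ n) ^ q * Φ (r * M t * s ^ n))) := by
          gcongr C₄ * ?_
          exact h5 _ _ hMt.le (by positivity) hle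
      _ = _ := by ring

/-! ### Freezing the slow factor at 1/(1 - |z|) -/

theorem isSlow_one : IsSlow fun _ => 1 where
  measurable := measurable_const
  pos _ _ := one_pos
  comparable _ _ := ⟨1, one_pos, fun _ _ _ _ _ _ => by norm_num⟩
  upper ε hε := ⟨1, one_pos, fun x hx => by
    rw [one_mul]; exact Real.one_le_rpow (by linarith) hε.le⟩
  lower ε hε := ⟨1, one_pos, fun x hx => by
    rw [one_mul, mul_one]; exact Real.one_le_rpow (by linarith) hε.le⟩

theorem IsSlow.measurable_inv {Ψ : ℝ → ℝ} (h : IsSlow Ψ) : Measurable fun t : ℝ => Ψ (1 / t) := by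
  have := h.measurable
  exact this.comp (measurable_const.div measurable_id)

/-- If x ≥ t^(-δ), then x and 1/t are polynomially related and Θ does not distinguish them. If x <
t^(-δ), both products are O(t^(-ε)). This removes the nonlinearity of the modular at the price of an
integrable error. -/
theorem IsSlow.rpow_mul_split {Θ : ℝ → ℝ} (h : IsSlow Θ) {r A B ε : ℝ} (hr : 0 < r)
    (hB : 0 ≤ B) (hε : 0 < ε) : ∃ C : ℝ, 0 < C ∧ ∀ t x : ℝ, 0 < t → t ≤ 1 → 0 ≤ x →
      x ≤ A * t ^ (-B) →
      x ^ r * Θ (1 / t) ≤ C * (x ^ r * Θ x + t ^ (-ε)) ∧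
      x ^ r * Θ x ≤ C * (x ^ r * Θ (1 / t) + t ^ (-ε)) := by
  -- For x < t^(-δ) this gives x^r ≤ t^(-ε/2), leaving t^(-ε/2) for the slow factor.
  set δ := ε / (2 * r) with hδ
  have hδ0 : 0 < δ := by positivity
  obtain ⟨C₁, hC₁, h1⟩ := h.comparable_inv_of_between (a := 1) (A := A) one_pos hδ0 hB
  obtain ⟨C₂, hC₂, h2⟩ := h.inv_le (half_pos hε)
  obtain ⟨C₃, hC₃, h3⟩ := h.rpow_mul_le hr
  obtain ⟨C₄, hC₄, h4⟩ := h.comparable_inv_of_between (a := 1) (A := 1) one_pos hδ0 hδ0.le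
  refine ⟨C₁ + C₂ + C₃ * C₄ * C₂, by positivity, fun t x ht ht1 hx hxA => ?_⟩
  have hΘt := h.pos (1 / t) (by positivity)
  have hΘx := h.pos x hx
  have hxr : 0 ≤ x ^ r := by positivity
  have htε : 0 < t ^ (-ε) := by positivity
  have hp3 : 0 < C₃ * C₄ * C₂ := by positivity
  rcases le_or_gt (t ^ (-δ)) x with hle | hlt
  · obtain ⟨e1, e2⟩ := h1 t x ht ht1 (by rwa [one_mul]) hxA
    constructor
    · calc x ^ r * Θ (1 / t) ≤ x ^ r * (C₁ * Θ x) := by gcongr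
        _ = C₁ * (x ^ r * Θ x + 0) := by ring
        _ ≤ _ := by gcongr; linarith
    · calc x ^ r * Θ x ≤ x ^ r * (C₁ * Θ (1 / t)) := by gcongr
        _ = C₁ * (x ^ r * Θ (1 / t) + 0) := by ring
        _ ≤ _ := by gcongr; linarith
  · have e0 : (t ^ (-δ)) ^ r = t ^ (-(ε / 2)) := by
      rw [← Real.rpow_mul ht.le, hδ]; congr 1; field_simp
    have e3 : t ^ (-(ε / 2)) * t ^ (-(ε / 2)) = t ^ (-ε) := by
      rw [← Real.rpow_add ht]; congr 1; ring
    have e4 : x ^ r ≤ t ^ (-(ε / 2)) := by rw [← e0]; gcongr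
    have e5 := h2 t ht ht1
    constructor
    · calc x ^ r * Θ (1 / t) ≤ t ^ (-(ε / 2)) * (C₂ * t ^ (-(ε / 2))) := by gcongr
        _ = C₂ * (0 + t ^ (-ε)) := by rw [← e3]; ring
        _ ≤ _ := by
          have : 0 ≤ x ^ r * Θ x := by positivity
          gcongr; linarith
    · have e6 := (h4 t (t ^ (-δ)) ht ht1 (by rw [one_mul]) (by rw [one_mul])).1
      calc x ^ r * Θ x ≤ C₃ * ((t ^ (-δ)) ^ r * Θ (t ^ (-δ))) := h3 x _ hx hlt.le
        _ ≤ C₃ * (t ^ (-(ε / 2)) * (C₄ * (C₂ * t ^ (-(ε / 2))))) := by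
          rw [e0]
          gcongr
          exact e6.trans (by gcongr)
        _ = C₃ * C₄ * C₂ * (0 + t ^ (-ε)) := by rw [← e3]; ring
        _ ≤ _ := by
          have : 0 ≤ x ^ r * Θ (1 / t) := by positivity
          gcongr; linarith

/-- On the layer 1 - |z| ≈ 2^(-k) the integrand is about 2^(kβ/2) and the mass at most C 2^(-kβ);
the products form a convergent geometric series. -/
theorem lintegral_rpow_neg_lt_top {η : Measure ℂ} {C β : ℝ} (hβ : 0 < β)
    (h : ∀ t : ℝ, 0 < t → t ≤ 1 → η {z ∈ disc | 1 - ‖z‖ ≤ t} ≤ ENNReal.ofReal (C * t ^ β)) :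
    ∫⁻ z in disc, ENNReal.ofReal ((1 - ‖z‖) ^ (-(β / 2))) ∂η < ∞ := by
  set E : ℕ → Set ℂ := fun k => {z ∈ disc | 1 - ‖z‖ ≤ (2 ^ k)⁻¹} with hE
  have hEm : ∀ k, MeasurableSet (E k) := fun k =>
    measurableSet_disc.inter (measurableSet_le (f := fun z : ℂ => 1 - ‖z‖)
      (by fun_prop) measurable_const)
  have hpt : ∀ z ∈ disc, ENNReal.ofReal ((1 - ‖z‖) ^ (-(β / 2))) ≤
      ∑' k : ℕ, ENNReal.ofReal (((2 : ℝ) ^ (k + 1)) ^ (β / 2)) * (E k).indicator 1 z := by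
    intro z hz
    have hpos : 0 < 1 - ‖z‖ := by linarith [mem_disc.1 hz]
    obtain ⟨k, hk1, hk2⟩ := exists_nat_pow_near
      ((one_le_div hpos).2 (by linarith [norm_nonneg z] : 1 - ‖z‖ ≤ 1)) (one_lt_two : (1 : ℝ) < 2)
    have hzE : z ∈ E k := by
      refine ⟨hz, ?_⟩
      rw [le_div_iff₀ hpos] at hk1
      rw [← one_div, le_div_iff₀ (by positivity)]
      linarith
    refine le_trans ?_ (ENNReal.le_tsum k)
    rw [Set.indicator_of_mem hzE, Pi.one_apply, mul_one]
    refine ENNReal.ofReal_le_ofReal ?_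
    rw [Real.rpow_neg hpos.le, ← Real.inv_rpow hpos.le, ← one_div]
    gcongr
  set ρ : ℝ := (2 : ℝ) ^ (-(β / 2)) with hρ
  have hρ1 : ρ < 1 := Real.rpow_lt_one_of_one_lt_of_neg (by norm_num) (by linarith)
  have hρ0 : 0 < ρ := by positivity
  calc _ ≤ ∫⁻ z in disc, ∑' k : ℕ, ENNReal.ofReal (((2 : ℝ) ^ (k + 1)) ^ (β / 2)) *
          (E k).indicator 1 z ∂η := setLIntegral_mono' measurableSet_disc hpt
    _ ≤ ∫⁻ z, ∑' k : ℕ, ENNReal.ofReal (((2 : ℝ) ^ (k + 1)) ^ (β / 2)) *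
          (E k).indicator 1 z ∂η := setLIntegral_le_lintegral _ _
    _ = ∑' k : ℕ, ENNReal.ofReal (((2 : ℝ) ^ (k + 1)) ^ (β / 2)) * η (E k) := by
        rw [lintegral_tsum fun k => ((measurable_one.indicator (hEm k)).const_mul _).aemeasurable]
        congr 1
        ext k
        rw [lintegral_const_mul _ (measurable_one.indicator (hEm k)),
          lintegral_indicator_one (hEm k)]
    _ ≤ ∑' k : ℕ, ENNReal.ofReal (2 ^ (β / 2) * |C|) * ENNReal.ofReal ρ ^ k := by
        refine ENNReal.tsum_le_tsum fun k => ?_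
        have h2k : (0 : ℝ) < 2 ^ k := by positivity
        calc _ ≤ ENNReal.ofReal (((2 : ℝ) ^ (k + 1)) ^ (β / 2)) *
              ENNReal.ofReal (|C| * ((2 ^ k)⁻¹ : ℝ) ^ β) := by
              gcongr
              refine (h _ (by positivity) (inv_le_one_of_one_le₀ (one_le_pow₀ (by norm_num)))).trans ?_
              refine ENNReal.ofReal_le_ofReal ?_
              gcongr
              exact le_abs_self C
          _ = _ := by
              rw [← ENNReal.ofReal_pow hρ0.le, ← ENNReal.ofReal_mul (by positivity),
                ← ENNReal.ofReal_mul (by positivity)]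
              congr 1
              have e1 : ((2 : ℝ) ^ (k + 1)) ^ (β / 2) = ((2 : ℝ) ^ k) ^ (β / 2) * 2 ^ (β / 2) := by
                rw [pow_succ, Real.mul_rpow (by positivity) (by norm_num)]
              have e2 : ((2 ^ k)⁻¹ : ℝ) ^ β = (((2 : ℝ) ^ k) ^ (β / 2))⁻¹ * (((2 : ℝ) ^ k) ^ (β / 2))⁻¹ := by
                rw [Real.inv_rpow h2k.le, ← mul_inv, ← Real.rpow_add h2k, add_halves]
              have e3 : ρ ^ k = (((2 : ℝ) ^ k) ^ (β / 2))⁻¹ := by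
                rw [hρ, ← Real.rpow_natCast, ← Real.rpow_mul (by norm_num), ← Real.rpow_natCast 2 k,
                  ← Real.rpow_mul (by norm_num), ← Real.rpow_neg (by norm_num)]
                congr 1; ring
              have : ((2 : ℝ) ^ k) ^ (β / 2) ≠ 0 := by positivity
              rw [e1, e2, e3]
              field_simp
    _ < ∞ := by
        rw [ENNReal.tsum_mul_left, ENNReal.tsum_geometric]
        refine ENNReal.mul_lt_top ENNReal.ofReal_lt_top ?_
        rw [ENNReal.inv_lt_top, tsub_pos_iff_lt]
        rw [← ENNReal.ofReal_one]
        exact (ENNReal.ofReal_lt_ofReal_iff one_pos).2 hρ1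

namespace IsDoublingMeasure

variable {ν : Measure ℂ} {g : ℝ → ℝ≥0∞} {τ : ℝ → ℝ}

theorem measure_disc_lt_top (h : IsDoublingMeasure ν g τ) : ν disc < ∞ := by
  obtain ⟨C, _, hS⟩ := h.measure_carlesonSquare
  have := (hS 0 (by simp [mem_disc])).1
  rw [carlesonSquare_zero] at this
  exact this.trans_lt ENNReal.ofReal_lt_top

theorem exists_lintegral_rpow_neg_lt_top (h : IsDoublingMeasure ν g τ) : ∃ ε : ℝ, 0 < ε ∧
    ∫⁻ z in disc, ENNReal.ofReal ((1 - ‖z‖) ^ (-ε)) ∂ν < ∞ := by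
  obtain ⟨C, hC, hS⟩ := h.measure_carlesonSquare
  obtain ⟨D, β, hD, hβ, hd⟩ := h.decay
  refine ⟨β / 2, by positivity, lintegral_rpow_neg_lt_top (C := 16 * C * D) hβ fun t ht ht1 => ?_⟩
  have hdt := hd t ht ht1
  rcases ht1.eq_or_lt with rfl | hlt
  · refine (measure_mono (Set.sep_subset disc fun z => 1 - ‖z‖ ≤ 1)).trans ?_
    have := (hS 0 (by simp [mem_disc])).1
    rw [carlesonSquare_zero, norm_zero, sub_zero, one_mul] at this
    refine this.trans (ENNReal.ofReal_le_ofReal ?_)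
    rw [Real.one_rpow] at hdt ⊢
    nlinarith [mul_pos hC hD]
  · have hM : ∀ a : ℂ, ‖a‖ = 1 - t → ν (carlesonSquare a) ≤ ENNReal.ofReal (C * (t * (D * t ^ β))) := by
      intro a ha
      refine (hS a (mem_disc.2 (by rw [ha]; linarith))).1.trans (ENNReal.ofReal_le_ofReal ?_)
      rw [ha, sub_sub_cancel]
      gcongr
    refine (measure_annulus_le ht hlt hM).trans (le_of_eq ?_)
    rw [← ENNReal.ofReal_mul (by positivity)]
    congr 1
    field_simp

theorem near_le (h : IsDoublingMeasure ν g τ) {Ψ : ℝ → ℝ} (hΨ : IsSlow Ψ) :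
    ∃ C : ℝ, 0 < C ∧ ∀ t s : ℝ, 0 < t → t ≤ 1 → 0 < s → s ≤ 1 → t ≤ 2 * s → s ≤ 2 * t →
      Ψ (1 / t) * τ t / t ≤ C * (Ψ (1 / s) * τ s / s) := by
  obtain ⟨C, B, hC, hB, hup⟩ := h.upper
  obtain ⟨D, hD, hc⟩ := hΨ.comparable_inv 2
  refine ⟨D * (1 + C * 2 ^ B) * 2, by positivity, fun t s ht ht1 hs hs1 hts hst => ?_⟩
  have hτt := h.pos t ht ht1
  have hτs := h.pos s hs hs1
  have hψt := hΨ.pos (1 / t) (by positivity)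
  have hψs := hΨ.pos (1 / s) (by positivity)
  have h1 : τ t ≤ (1 + C * 2 ^ B) * τ s := by
    rcases le_total t s with hle | hle
    · have := h.mono t s ht hle hs1
      have : 0 ≤ C * 2 ^ B * τ s := by positivity
      linarith
    · have h2 : τ t ≤ C * 2 ^ B * τ s := by
        refine (hup s t hs hle ht1).trans ?_
        gcongr
        rwa [div_le_iff₀ hs]
      linarith
  have h2 := hc t s ht hs hts hst
  have h3 : 1 / t ≤ 2 / s := by
    rw [div_le_div_iff₀ ht hs]; linarith
  calc Ψ (1 / t) * τ t / t = Ψ (1 / t) * τ t * (1 / t) := by ring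
    _ ≤ (D * Ψ (1 / s)) * ((1 + C * 2 ^ B) * τ s) * (2 / s) := by gcongr
    _ = _ := by ring

/-- Area sub-mean value on the disc of radius t/8, with t = 1 - |z|; there 1 - |w| is comparable to
t, so the weight can be moved under the integral. -/
theorem norm_rpow_mul_le (h : IsDoublingMeasure ν g τ) {Ψ : ℝ → ℝ} (hΨ : IsSlow Ψ) {p : ℝ}
    (hp : 0 < p) : ∃ C : ℝ, 0 < C ∧ ∀ f : ℂ → ℂ, Measurable f → DifferentiableOn ℂ f disc →
      ∀ z ∈ disc, ENNReal.ofReal (‖f z‖ ^ p * ((1 - ‖z‖) * τ (1 - ‖z‖) * Ψ (1 / (1 - ‖z‖)))) ≤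
        ENNReal.ofReal C * ∫⁻ w in Metric.ball z ((1 - ‖z‖) / 8),
          ENNReal.ofReal (Ψ (1 / (1 - ‖w‖)) * τ (1 - ‖w‖) / (1 - ‖w‖)) *
          ENNReal.ofReal (‖f w‖ ^ p) := by
  obtain ⟨C, hC, hnear⟩ := h.near_le hΨ
  have hπ := Real.pi_pos
  refine ⟨64 / Real.pi * C, by positivity, fun f hfm hf z hz => ?_⟩
  have hz1 := mem_disc.1 hz
  set t := 1 - ‖z‖ with ht
  have ht0 : 0 < t := by linarith
  have ht1 : t ≤ 1 := by linarith [norm_nonneg z]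
  have hτ := h.pos t ht0 ht1
  have hψ := hΨ.pos (1 / t) (by positivity)
  have hball : ∀ w ∈ Metric.ball z (t / 8), |‖w‖ - ‖z‖| < t / 8 := fun w hw => by
    rw [mem_ball_iff_norm] at hw
    exact (abs_norm_sub_norm_le w z).trans_lt hw
  have hsub : Metric.ball z (t / 8) ⊆ disc := fun w hw => by
    have := abs_lt.1 (hball w hw)
    rw [mem_disc]; linarith [this.2]
  have h1 := norm_rpow_le_setLIntegral_ball hfm hp (by positivity : 0 < t / 8) (hf.mono hsub)
  calc ENNReal.ofReal (‖f z‖ ^ p * (t * τ t * Ψ (1 / t)))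
      = ENNReal.ofReal (64 / Real.pi * (Ψ (1 / t) * τ t / t)) *
        (ENNReal.ofReal (Real.pi * (t / 8) ^ 2) * ENNReal.ofReal (‖f z‖ ^ p)) := by
        rw [← ENNReal.ofReal_mul (by positivity), ← ENNReal.ofReal_mul (by positivity)]
        congr 1
        field_simp
        ring
    _ ≤ ENNReal.ofReal (64 / Real.pi * (Ψ (1 / t) * τ t / t)) *
        ∫⁻ w in Metric.ball z (t / 8), ENNReal.ofReal (‖f w‖ ^ p) := by gcongr
    _ = ENNReal.ofReal (64 / Real.pi) * ∫⁻ w in Metric.ball z (t / 8),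
        ENNReal.ofReal (Ψ (1 / t) * τ t / t) * ENNReal.ofReal (‖f w‖ ^ p) := by
        rw [lintegral_const_mul' _ _ ENNReal.ofReal_ne_top, ← mul_assoc,
          ← ENNReal.ofReal_mul (by positivity)]
    _ ≤ ENNReal.ofReal (64 / Real.pi) * ∫⁻ w in Metric.ball z (t / 8), ENNReal.ofReal C *
        (ENNReal.ofReal (Ψ (1 / (1 - ‖w‖)) * τ (1 - ‖w‖) / (1 - ‖w‖)) *
          ENNReal.ofReal (‖f w‖ ^ p)) := by
        gcongr ENNReal.ofReal (64 / Real.pi) * ?_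
        refine setLIntegral_mono' Metric.isOpen_ball.measurableSet fun w hw => ?_
        have hw1 := abs_lt.1 (hball w hw)
        rw [← mul_assoc, ← ENNReal.ofReal_mul hC.le]
        gcongr
        exact hnear t _ ht0 ht1 (by linarith [hw1.2]) (by linarith [norm_nonneg w])
          (by linarith [hw1.2]) (by linarith [hw1.1])
    _ = _ := by
        rw [lintegral_const_mul' _ _ ENNReal.ofReal_ne_top, ← mul_assoc,
          ← ENNReal.ofReal_mul (by positivity)]

theorem setLIntegral_slow_tail_le (h : IsDoublingMeasure ν g τ) {Ψ : ℝ → ℝ} (hΨ : IsSlow Ψ)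
    {p : ℝ} (hp : 0 < p) : ∃ C : ℝ, 0 < C ∧ ∀ f : ℂ → ℂ, Measurable f → DifferentiableOn ℂ f disc →
      ∫⁻ w in disc, ENNReal.ofReal (Ψ (1 / (1 - ‖w‖)) * τ (1 - ‖w‖) / (1 - ‖w‖)) *
        ENNReal.ofReal (‖f w‖ ^ p) ≤
      ENNReal.ofReal C * ∫⁻ w in disc, ENNReal.ofReal (‖f w‖ ^ p * Ψ (1 / (1 - ‖w‖))) ∂ν := by
  obtain ⟨C, hC, hh⟩ := h.setLIntegral_tail_le (ψ := fun t => Ψ (1 / t)) hΨ.measurable_inv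
    (fun t ht _ => hΨ.pos _ (by positivity)) (fun L => by
      obtain ⟨C, hC, hc⟩ := hΨ.comparable_inv (max 1 L)
      refine ⟨C, hC, fun t s ht hts hs hsL => hc s t (ht.trans_le hts) ht ?_ ?_⟩
      · exact hsL.trans (by gcongr; exact le_max_right _ _)
      · exact hts.trans (le_mul_of_one_le_left (ht.le.trans hts) (le_max_left _ _))) hp
  refine ⟨C, hC, fun f hfm hf => (hh f hfm hf).trans (le_of_eq ?_)⟩
  congr 1
  conv_lhs => rw [← h.restrict_disc]
  refine lintegral_congr fun w => ?_
  rw [mul_comm, ENNReal.ofReal_mul (by positivity)]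

theorem norm_rpow_mul_le_lintegral (h : IsDoublingMeasure ν g τ) {Ψ : ℝ → ℝ} (hΨ : IsSlow Ψ)
    {p : ℝ} (hp : 0 < p) : ∃ C : ℝ, 0 < C ∧ ∀ f : ℂ → ℂ, Measurable f →
      DifferentiableOn ℂ f disc → ∀ z ∈ disc,
        ENNReal.ofReal (‖f z‖ ^ p * ((1 - ‖z‖) * τ (1 - ‖z‖) * Ψ (1 / (1 - ‖z‖)))) ≤
        ENNReal.ofReal C * ∫⁻ w in disc, ENNReal.ofReal (‖f w‖ ^ p * Ψ (1 / (1 - ‖w‖))) ∂ν := by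
  obtain ⟨C, hC, h1⟩ := h.norm_rpow_mul_le hΨ hp
  obtain ⟨D, hD, h2⟩ := h.setLIntegral_slow_tail_le hΨ hp
  refine ⟨C * D, by positivity, fun f hfm hf z hz => (h1 f hfm hf z hz).trans ?_⟩
  rw [ENNReal.ofReal_mul hC.le, mul_assoc]
  gcongr
  refine le_trans (lintegral_mono_set fun w hw => ?_) (h2 f hfm hf)
  rw [mem_ball_iff_norm] at hw
  have := norm_sub_norm_le w z
  have := mem_disc.1 hz
  rw [mem_disc]; linarith

/-- A bound on the modular gives polynomial growth and a bound with a frozen slow factor. -/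
theorem growth_of_modular_le (h : IsDoublingMeasure ν g τ) {Ψ : ℝ → ℝ} (hΨ : IsSlow Ψ) {p : ℝ}
    (hp : 0 < p) : ∃ B : ℝ, 0 < B ∧ ∀ N : ℝ, ∃ A : ℝ, 0 < A ∧ ∀ f : ℂ → ℂ, Measurable f →
      DifferentiableOn ℂ f disc → modular p Ψ ν f ≤ ENNReal.ofReal N →
      (∀ z ∈ disc, ‖f z‖ ≤ A * (1 - ‖z‖) ^ (-B)) ∧
      ∫⁻ z in disc, ENNReal.ofReal (‖f z‖ ^ p * Ψ (1 / (1 - ‖z‖))) ∂ν ≤ ENNReal.ofReal A := by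
  obtain ⟨C₁, hC₁, h1⟩ := h.norm_rpow_mul_le_lintegral isSlow_one (half_pos hp)
  obtain ⟨C₂, B, hC₂, hB, h2⟩ := h.weight_bounds isSlow_one
  obtain ⟨C₃, hC₃, h3⟩ := hΨ.lower (p / 2) (half_pos hp)
  obtain ⟨ε, hε, hεint⟩ := h.exists_lintegral_rpow_neg_lt_top
  refine ⟨B * (2 / p), by positivity, fun N => ?_⟩
  set V := (ν disc).toReal with hV
  have hVν : ν disc = ENNReal.ofReal V := (ENNReal.ofReal_toReal h.measure_disc_lt_top.ne).symm
  set I := (∫⁻ z in disc, ENNReal.ofReal ((1 - ‖z‖) ^ (-ε)) ∂ν).toReal with hI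
  have hIν : ∫⁻ z in disc, ENNReal.ofReal ((1 - ‖z‖) ^ (-ε)) ∂ν = ENNReal.ofReal I :=
    (ENNReal.ofReal_toReal hεint.ne).symm
  -- Since Ψ(x) ≥ c (1 + x)^(-p/2), the modular controls the unweighted p/2-mean. No slow factor is
  -- left in it, so the point evaluation estimate with the constant function 1 applies and yields
  -- the growth.
  have hx : ∀ x : ℝ, 0 ≤ x → x ^ (p / 2) ≤ 1 + C₃ * 2 ^ (p / 2) * (x ^ p * Ψ x) := by
    intro x hx
    have hψ := hΨ.pos x hx
    rcases le_or_gt x 1 with hx1 | hx1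
    · have : x ^ (p / 2) ≤ 1 := Real.rpow_le_one hx hx1 (by positivity)
      have : 0 ≤ C₃ * 2 ^ (p / 2) * (x ^ p * Ψ x) := by positivity
      linarith
    · have hsplit : x ^ p = x ^ (p / 2) * x ^ (p / 2) := by
        rw [← Real.rpow_add (by linarith), add_halves]
      have e1 : (1 + x) ^ (p / 2) ≤ 2 ^ (p / 2) * x ^ (p / 2) := by
        rw [← Real.mul_rpow (by norm_num) hx]
        gcongr; linarith
      calc x ^ (p / 2) ≤ x ^ (p / 2) * (C₃ * (1 + x) ^ (p / 2) * Ψ x) :=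
            le_mul_of_one_le_right (by positivity) (h3 x hx)
        _ ≤ x ^ (p / 2) * (C₃ * (2 ^ (p / 2) * x ^ (p / 2)) * Ψ x) := by gcongr
        _ = C₃ * 2 ^ (p / 2) * (x ^ p * Ψ x) := by rw [hsplit]; ring
        _ ≤ _ := by linarith
  set N₁ := V + C₃ * 2 ^ (p / 2) * |N| with hN₁
  have hN₁0 : 0 ≤ N₁ := by have : 0 ≤ V := ENNReal.toReal_nonneg; positivity
  set A₁ := (C₂ * (C₁ * N₁)) ^ (2 / p) with hA₁
  -- Once the growth is known, Ψ(|f|) can be exchanged for Ψ(1/(1 - |z|)).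
  obtain ⟨C₄, hC₄, h4⟩ := hΨ.rpow_mul_split (A := A₁) (B := B * (2 / p)) (ε := ε) hp
    (by positivity) hε
  have hI0 : 0 ≤ I := ENNReal.toReal_nonneg
  have hA₁0 : 0 ≤ A₁ := by positivity
  refine ⟨A₁ + C₄ * (|N| + I) + 1, by positivity, fun f hfm hf hfN => ?_⟩
  have hhalf : ∫⁻ w in disc, ENNReal.ofReal (‖f w‖ ^ (p / 2) * 1) ∂ν ≤ ENNReal.ofReal N₁ := by
    calc _ ≤ ∫⁻ w in disc, (1 + ENNReal.ofReal (C₃ * 2 ^ (p / 2)) *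
          ENNReal.ofReal (‖f w‖ ^ p * Ψ ‖f w‖)) ∂ν := by
          refine lintegral_mono fun w => ?_
          have hψ := hΨ.pos _ (norm_nonneg (f w))
          rw [mul_one, ← ENNReal.ofReal_mul (by positivity), ← ENNReal.ofReal_one,
            ← ENNReal.ofReal_add zero_le_one (by positivity)]
          exact ENNReal.ofReal_le_ofReal (hx _ (norm_nonneg _))
      _ = ν disc + ENNReal.ofReal (C₃ * 2 ^ (p / 2)) * modular p Ψ ν f := by
          rw [lintegral_add_left measurable_const, setLIntegral_one,
            lintegral_const_mul' _ _ ENNReal.ofReal_ne_top]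
          rfl
      _ ≤ ENNReal.ofReal V + ENNReal.ofReal (C₃ * 2 ^ (p / 2)) * ENNReal.ofReal |N| := by
          rw [hVν]
          gcongr
          exact hfN.trans (ENNReal.ofReal_le_ofReal (le_abs_self N))
      _ = _ := by
          rw [← ENNReal.ofReal_mul (by positivity), ← ENNReal.ofReal_add
            ENNReal.toReal_nonneg (by positivity)]
  have hgrow : ∀ z ∈ disc, ‖f z‖ ≤ A₁ * (1 - ‖z‖) ^ (-(B * (2 / p))) := by
    intro z hz
    have ht0 : 0 < 1 - ‖z‖ := by linarith [mem_disc.1 hz]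
    have ht1 : 1 - ‖z‖ ≤ 1 := by linarith [norm_nonneg z]
    have e1 := (h1 f hfm hf z hz).trans (mul_le_mul_right hhalf _)
    rw [← ENNReal.ofReal_mul hC₁.le, ENNReal.ofReal_le_ofReal_iff (by positivity)] at e1
    have e2 := (h2 _ ht0 ht1).2
    set t := 1 - ‖z‖ with ht
    have e3 : ‖f z‖ ^ (p / 2) ≤ C₂ * (C₁ * N₁) * t ^ (-B) := by
      have e4 : ‖f z‖ ^ (p / 2) * t ^ B ≤ C₂ * (C₁ * N₁) := by
        calc ‖f z‖ ^ (p / 2) * t ^ B ≤ ‖f z‖ ^ (p / 2) * (C₂ * (t * τ t * 1)) := by gcongr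
          _ = C₂ * (‖f z‖ ^ (p / 2) * (t * τ t * 1)) := by ring
          _ ≤ _ := by gcongr
      rw [Real.rpow_neg ht0.le, ← div_eq_mul_inv, le_div_iff₀ (by positivity)]
      exact e4
    calc ‖f z‖ = (‖f z‖ ^ (p / 2)) ^ (2 / p) := by
          rw [← Real.rpow_mul (norm_nonneg _), div_mul_div_cancel₀ (by norm_num : (2:ℝ) ≠ 0),
            div_self hp.ne', Real.rpow_one]
      _ ≤ (C₂ * (C₁ * N₁) * t ^ (-B)) ^ (2 / p) := by gcongr
      _ = _ := by
          rw [Real.mul_rpow (by positivity) (by positivity), ← Real.rpow_mul ht0.le]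
          congr 2; ring
  constructor
  · intro z hz
    have ht0 : 0 < 1 - ‖z‖ := by linarith [mem_disc.1 hz]
    refine (hgrow z hz).trans ?_
    gcongr
    have : 0 ≤ C₄ * (|N| + I) := by positivity
    linarith
  · calc _ ≤ ∫⁻ z in disc, ENNReal.ofReal C₄ * (ENNReal.ofReal (‖f z‖ ^ p * Ψ ‖f z‖) +
          ENNReal.ofReal ((1 - ‖z‖) ^ (-ε))) ∂ν := by
          refine setLIntegral_mono' measurableSet_disc fun z hz => ?_
          have ht0 : 0 < 1 - ‖z‖ := by linarith [mem_disc.1 hz]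
          have ht1 : 1 - ‖z‖ ≤ 1 := by linarith [norm_nonneg z]
          have hψ := hΨ.pos _ (norm_nonneg (f z))
          rw [← ENNReal.ofReal_add (by positivity) (by positivity), ← ENNReal.ofReal_mul hC₄.le]
          exact ENNReal.ofReal_le_ofReal (h4 _ _ ht0 ht1 (norm_nonneg _) (hgrow z hz)).1
      _ = ENNReal.ofReal C₄ * (modular p Ψ ν f + ENNReal.ofReal I) := by
          have hm : Measurable fun z : ℂ => ENNReal.ofReal ((1 - ‖z‖) ^ (-ε)) := by fun_prop
          rw [lintegral_const_mul' _ _ ENNReal.ofReal_ne_top, lintegral_add_right _ hm, hIν]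
          rfl
      _ ≤ ENNReal.ofReal C₄ * (ENNReal.ofReal |N| + ENNReal.ofReal I) := by
          gcongr
          exact hfN.trans (ENNReal.ofReal_le_ofReal (le_abs_self N))
      _ = ENNReal.ofReal (C₄ * (|N| + I)) := by
          rw [← ENNReal.ofReal_add (abs_nonneg N) hI0, ← ENNReal.ofReal_mul hC₄.le]
      _ ≤ _ := ENNReal.ofReal_le_ofReal (by linarith)

end IsDoublingMeasure

/-! ### The Carleson embedding -/

/-- The Carleson condition with constant `Λ` on the squares of height at most `δ`. -/
def CarlesonBound (p q : ℝ) (Φ Ψ τ : ℝ → ℝ) (μ : Measure ℂ) (δ Λ : ℝ) : Prop :=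
  ∀ a ∈ disc, 1 - ‖a‖ ≤ δ → μ.real (carlesonSquare a) * Φ (1 / (1 - ‖a‖)) ≤
    Λ * ((1 - ‖a‖) * τ (1 - ‖a‖) * Ψ (1 / (1 - ‖a‖))) ^ (q / p)

theorem measurableSet_annulus (δ : ℝ) : MeasurableSet {z ∈ disc | 1 - ‖z‖ ≤ δ} :=
  measurableSet_disc.inter (measurableSet_le (f := fun z : ℂ => 1 - ‖z‖)
    (by fun_prop) measurable_const)

namespace IsDoublingMeasure

variable {ν : Measure ℂ} {g : ℝ → ℝ≥0∞} {τ : ℝ → ℝ} {Φ Ψ : ℝ → ℝ} {p q : ℝ}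

/-- The range 27 = 24·9/8 comes from the squares of `mem_carlesonSquare_of_near`: their height is at
most 24(1 - |w|), and 1 - |w| ≤ (9/8)(1 - |z|) when w is in the small disc of z. -/
theorem carleson_kernel_le (h : IsDoublingMeasure ν g τ) (hΦ : IsSlow Φ) (hΨ : IsSlow Ψ)
    (hp : 0 < p) (hq : 0 < q) : ∃ C : ℝ, 0 < C ∧ ∀ t s : ℝ, 0 < t → t ≤ s → s ≤ 1 → s ≤ 27 * t →
      Φ (1 / t) / (t * τ t * Ψ (1 / t)) ^ (q / p) ≤
        C * (Φ (1 / s) / (s * τ s * Ψ (1 / s)) ^ (q / p)) := by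
  obtain ⟨C₁, B, hC₁, hB, h1⟩ := h.mul_tail_le
  obtain ⟨C₂, hC₂, h2⟩ := hΦ.comparable_inv 27
  obtain ⟨C₃, hC₃, h3⟩ := hΨ.comparable_inv 27
  set D := C₁ * 27 ^ B * C₃ with hD
  have hD0 : 0 < D := by positivity
  refine ⟨C₂ * D ^ (q / p), by positivity, fun t s ht hts hs hst => ?_⟩
  have hs0 : 0 < s := ht.trans_le hts
  have hτt := h.pos t ht (hts.trans hs)
  have hτs := h.pos s hs0 hs
  have hΨt := hΨ.pos (1 / t) (by positivity)
  have hΨs := hΨ.pos (1 / s) (by positivity)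
  have hΦt := hΦ.pos (1 / t) (by positivity)
  have hΦs := hΦ.pos (1 / s) (by positivity)
  have e1 : s * τ s * Ψ (1 / s) ≤ D * (t * τ t * Ψ (1 / t)) := by
    calc s * τ s * Ψ (1 / s) ≤ C₁ * (s / t) ^ B * (t * τ t) * (C₃ * Ψ (1 / t)) := by
          exact mul_le_mul (h1 t s ht hts hs) (h3 s t hs0 ht hst (by linarith)) hΨs.le
            (by positivity)
      _ ≤ C₁ * 27 ^ B * (t * τ t) * (C₃ * Ψ (1 / t)) := by
          gcongr
          rwa [div_le_iff₀ ht]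
      _ = _ := by ring
  have e2 : (s * τ s * Ψ (1 / s)) ^ (q / p) ≤ D ^ (q / p) * (t * τ t * Ψ (1 / t)) ^ (q / p) := by
    rw [← Real.mul_rpow hD0.le (by positivity)]
    gcongr
  rw [mul_div_assoc', div_le_div_iff₀ (by positivity) (by positivity)]
  calc Φ (1 / t) * (s * τ s * Ψ (1 / s)) ^ (q / p)
      ≤ (C₂ * Φ (1 / s)) * (D ^ (q / p) * (t * τ t * Ψ (1 / t)) ^ (q / p)) := by
        gcongr
        exact h2 t s ht hs0 (by linarith) hst
    _ = _ := by ring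

/-- All contributing z lie in one square S(b) of comparable height. The kernel is bounded there by a
multiple of its value at height 1 - |b|, and the Carleson condition at b is exactly what bounds the
product with μ(S(b)). -/
theorem lintegral_carleson_kernel_le (h : IsDoublingMeasure ν g τ) (hΦ : IsSlow Φ)
    (hΨ : IsSlow Ψ) (hp : 0 < p) (hq : 0 < q) : ∃ C : ℝ, 0 < C ∧ ∀ (μ : Measure ℂ)
      [IsFiniteMeasure μ] (δ Λ : ℝ), 0 ≤ Λ → CarlesonBound p q Φ Ψ τ μ (27 * δ) Λ → ∀ w ∈ disc,
      ∫⁻ z in {z ∈ disc | 1 - ‖z‖ ≤ δ}, (Metric.ball z ((1 - ‖z‖) / 8)).indicator (fun _ =>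
        ENNReal.ofReal (Φ (1 / (1 - ‖z‖)) /
          ((1 - ‖z‖) * τ (1 - ‖z‖) * Ψ (1 / (1 - ‖z‖))) ^ (q / p))) w ∂μ ≤
        ENNReal.ofReal (C * Λ) := by
  obtain ⟨C, hC, hκ⟩ := h.carleson_kernel_le hΦ hΨ hp hq
  refine ⟨C, hC, fun μ _ δ Λ hΛ hcar w hw => ?_⟩
  obtain ⟨b, hb, hbt, hS⟩ := mem_carlesonSquare_of_near hw
  have hw1 := mem_disc.1 hw
  set T := {z ∈ disc | 1 - ‖z‖ ≤ δ} with hT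
  set κ : ℝ → ℝ := fun t => Φ (1 / t) / (t * τ t * Ψ (1 / t)) ^ (q / p) with hκdef
  have hfact : ∀ z ∈ T, w ∈ Metric.ball z ((1 - ‖z‖) / 8) → z ∈ carlesonSquare b ∧
      1 - ‖z‖ ≤ 1 - ‖b‖ ∧ 1 - ‖b‖ ≤ 27 * (1 - ‖z‖) := by
    intro z hz hwz
    rw [mem_ball_iff_norm] at hwz
    have hz1 := mem_disc.1 hz.1
    have e1 := abs_lt.1 ((abs_norm_sub_norm_le w z).trans_lt hwz)
    refine ⟨hS z hz.1 hwz, ?_, ?_⟩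
    · rw [hbt, le_min_iff]
      exact ⟨by linarith [norm_nonneg z], by linarith [e1.2]⟩
    · rw [hbt]
      exact (min_le_right _ _).trans (by linarith [e1.1])
  have hb1 := mem_disc.1 hb
  have hb0 : 0 < 1 - ‖b‖ := by linarith
  have hb2 : 1 - ‖b‖ ≤ 1 := by linarith [norm_nonneg b]
  have hτb := h.pos _ hb0 hb2
  have hΨb := hΨ.pos (1 / (1 - ‖b‖)) (by positivity)
  have hΦb := hΦ.pos (1 / (1 - ‖b‖)) (by positivity)
  by_cases hne : ∃ z ∈ T, w ∈ Metric.ball z ((1 - ‖z‖) / 8)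
  · obtain ⟨z₀, hz₀, hwz₀⟩ := hne
    have hbδ : 1 - ‖b‖ ≤ 27 * δ := by
      have := (hfact z₀ hz₀ hwz₀).2.2
      linarith [hz₀.2]
    calc _ ≤ ∫⁻ z in T, (carlesonSquare b).indicator
          (fun _ => ENNReal.ofReal (C * κ (1 - ‖b‖))) z ∂μ := by
          refine setLIntegral_mono' (measurableSet_annulus δ) fun z hz => ?_
          refine Set.indicator_apply_le' (fun hwz => ?_) (fun _ => zero_le)
          obtain ⟨f1, f2, f3⟩ := hfact z hz hwz
          rw [Set.indicator_of_mem f1]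
          exact ENNReal.ofReal_le_ofReal
            (hκ _ _ (by linarith [mem_disc.1 hz.1]) f2 hb2 f3)
      _ ≤ ∫⁻ z, (carlesonSquare b).indicator
          (fun _ => ENNReal.ofReal (C * κ (1 - ‖b‖))) z ∂μ := setLIntegral_le_lintegral _ _
      _ = ENNReal.ofReal (C * κ (1 - ‖b‖)) * μ (carlesonSquare b) :=
          lintegral_indicator_const (measurableSet_carlesonSquare b) _
      _ = ENNReal.ofReal (C * κ (1 - ‖b‖) * μ.real (carlesonSquare b)) := by
          rw [ENNReal.ofReal_mul (q := μ.real _) (by positivity), ofReal_measureReal]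
      _ ≤ _ := by
          refine ENNReal.ofReal_le_ofReal ?_
          rw [mul_assoc]
          gcongr
          rw [hκdef, div_mul_eq_mul_div, div_le_iff₀ (by positivity), mul_comm (Φ _)]
          exact hcar b hb hbδ
  · refine le_trans (le_of_eq ?_) (zero_le)
    rw [setLIntegral_congr_fun (g := fun _ => 0) (measurableSet_annulus δ) fun z hz => ?_]
    · simp
    · exact Set.indicator_of_notMem (fun hwz => hne ⟨z, hz, hwz⟩) _

/-- The Carleson embedding with frozen slow factors, on an annulus. -/
theorem carleson_embedding (h : IsDoublingMeasure ν g τ) (hΦ : IsSlow Φ)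
    (hΨ : IsSlow Ψ) (hp : 0 < p) (hpq : p ≤ q) : ∃ C : ℝ, 0 < C ∧ ∀ (μ : Measure ℂ)
      [IsFiniteMeasure μ] (δ Λ N : ℝ), 0 ≤ Λ → 0 ≤ N → CarlesonBound p q Φ Ψ τ μ (27 * δ) Λ →
      ∀ f : ℂ → ℂ, Measurable f → DifferentiableOn ℂ f disc →
      ∫⁻ z in disc, ENNReal.ofReal (‖f z‖ ^ p * Ψ (1 / (1 - ‖z‖))) ∂ν ≤ ENNReal.ofReal N →
      ∫⁻ z in {z ∈ disc | 1 - ‖z‖ ≤ δ}, ENNReal.ofReal (‖f z‖ ^ q * Φ (1 / (1 - ‖z‖))) ∂μ ≤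
        ENNReal.ofReal (C * (N ^ (q / p - 1) * N) * Λ) := by
  have hq : 0 < q := hp.trans_le hpq
  obtain ⟨C₁, hC₁, h1⟩ := h.norm_rpow_mul_le_lintegral hΨ hp
  obtain ⟨C₂, hC₂, h2⟩ := h.norm_rpow_mul_le hΨ hp
  obtain ⟨C₃, hC₃, h3⟩ := h.setLIntegral_slow_tail_le hΨ hp
  obtain ⟨C₄, hC₄, h4⟩ := h.lintegral_carleson_kernel_le hΦ hΨ hp hq
  refine ⟨C₁ ^ (q / p - 1) * C₂ * C₃ * C₄, by positivity,
    fun μ _ δ Λ N hΛ hN hcar f hfm hf hfN => ?_⟩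
  set T := {z ∈ disc | 1 - ‖z‖ ≤ δ} with hT
  set W : ℂ → ℝ := fun z => (1 - ‖z‖) * τ (1 - ‖z‖) * Ψ (1 / (1 - ‖z‖)) with hW
  set κ : ℂ → ℝ≥0∞ := fun z => ENNReal.ofReal (Φ (1 / (1 - ‖z‖)) / W z ^ (q / p)) with hκ
  set k : ℂ → ℝ≥0∞ := fun w =>
    ENNReal.ofReal (Ψ (1 / (1 - ‖w‖)) * τ (1 - ‖w‖) / (1 - ‖w‖)) *
      ENNReal.ofReal (‖f w‖ ^ p) with hk
  have htm : Measurable fun z : ℂ => 1 - ‖z‖ := by fun_prop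
  have hΨm : Measurable fun z : ℂ => Ψ (1 / (1 - ‖z‖)) := hΨ.measurable_inv.comp htm
  have hΦm : Measurable fun z : ℂ => Φ (1 / (1 - ‖z‖)) := hΦ.measurable_inv.comp htm
  have hτm : Measurable fun z : ℂ => τ (1 - ‖z‖) := h.measurable_tail.comp htm
  have hWm : Measurable W := (htm.mul hτm).mul hΨm
  have hκm : Measurable κ := (hΦm.div (hWm.pow_const _)).ennreal_ofReal
  have hkm : Measurable k :=
    ((hΨm.mul hτm).div htm).ennreal_ofReal.mul (hfm.norm.pow_const _).ennreal_ofReal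
  -- The pointwise bound |f|^p W ≤ C₁ N is raised to the power q/p - 1 ≥ 0, which is where p ≤ q
  -- enters; one factor |f|^p W remains for the sub-mean value estimate.
  set E : ℝ := (C₁ * N) ^ (q / p - 1) with hE
  have hE0 : 0 ≤ E := by positivity
  have hpt : ∀ z ∈ T, ENNReal.ofReal (‖f z‖ ^ q * Φ (1 / (1 - ‖z‖))) ≤
      ENNReal.ofReal (E * C₂) *
        ∫⁻ w in disc, (Metric.ball z ((1 - ‖z‖) / 8)).indicator (fun _ => κ z) w * k w := by
    intro z hz
    have hz1 := mem_disc.1 hz.1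
    have ht0 : 0 < 1 - ‖z‖ := by linarith
    have hτz := h.pos _ ht0 (by linarith [norm_nonneg z])
    have hΨz := hΨ.pos (1 / (1 - ‖z‖)) (by positivity)
    have hΦz := hΦ.pos (1 / (1 - ‖z‖)) (by positivity)
    have hWz : 0 < W z := by positivity
    have e1 : ‖f z‖ ^ p * W z ≤ C₁ * N := by
      have := (h1 f hfm hf z hz.1).trans (mul_le_mul_right hfN _)
      rwa [← ENNReal.ofReal_mul hC₁.le, ENNReal.ofReal_le_ofReal_iff (by positivity)] at this
    have e2 : ‖f z‖ ^ q * Φ (1 / (1 - ‖z‖)) ≤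
        E * (Φ (1 / (1 - ‖z‖)) / W z ^ (q / p)) * (‖f z‖ ^ p * W z) := by
      have e3 : ‖f z‖ ^ q * W z ^ (q / p) = (‖f z‖ ^ p * W z) ^ (q / p) := by
        rw [Real.mul_rpow (by positivity) hWz.le, ← Real.rpow_mul (norm_nonneg _),
          mul_div_cancel₀ _ hp.ne']
      have e4 : (‖f z‖ ^ p * W z) ^ (q / p) ≤ E * (‖f z‖ ^ p * W z) := by
        have hqp : 0 ≤ q / p - 1 := by
          rw [sub_nonneg, one_le_div hp]; exact hpq
        calc (‖f z‖ ^ p * W z) ^ (q / p)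
            = (‖f z‖ ^ p * W z) ^ (q / p - 1) * (‖f z‖ ^ p * W z) := by
              conv_lhs => rw [← sub_add_cancel (q / p) 1,
                Real.rpow_add_of_nonneg (by positivity) hqp zero_le_one, Real.rpow_one]
          _ ≤ _ := by
              gcongr ?_ * _
              exact Real.rpow_le_rpow (by positivity) e1 hqp
      calc ‖f z‖ ^ q * Φ (1 / (1 - ‖z‖))
          = ‖f z‖ ^ q * W z ^ (q / p) * (Φ (1 / (1 - ‖z‖)) / W z ^ (q / p)) := by
            have : W z ^ (q / p) ≠ 0 := by positivity
            field_simp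
        _ ≤ E * (‖f z‖ ^ p * W z) * (Φ (1 / (1 - ‖z‖)) / W z ^ (q / p)) := by
            rw [e3]; gcongr
        _ = _ := by ring
    calc _ ≤ ENNReal.ofReal (E * (Φ (1 / (1 - ‖z‖)) / W z ^ (q / p)) * (‖f z‖ ^ p * W z)) :=
          ENNReal.ofReal_le_ofReal e2
      _ = ENNReal.ofReal E * κ z * ENNReal.ofReal (‖f z‖ ^ p * W z) := by
          rw [ENNReal.ofReal_mul (by positivity), ENNReal.ofReal_mul hE0]
      _ ≤ ENNReal.ofReal E * κ z * (ENNReal.ofReal C₂ *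
          ∫⁻ w in Metric.ball z ((1 - ‖z‖) / 8), k w) := by
          gcongr
          exact h2 f hfm hf z hz.1
      _ = ENNReal.ofReal (E * C₂) * ∫⁻ w in Metric.ball z ((1 - ‖z‖) / 8), κ z * k w := by
          rw [lintegral_const_mul _ hkm, ENNReal.ofReal_mul hE0]
          ring
      _ = ENNReal.ofReal (E * C₂) * ∫⁻ w,
          (Metric.ball z ((1 - ‖z‖) / 8)).indicator (fun _ => κ z) w * k w := by
          rw [← lintegral_indicator Metric.isOpen_ball.measurableSet]
          congr 2
          ext w
          by_cases hw : w ∈ Metric.ball z ((1 - ‖z‖) / 8) <;> simp [hw]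
      _ = _ := by
          congr 1
          rw [← lintegral_indicator measurableSet_disc]
          congr 1
          ext w
          by_cases hw : w ∈ disc
          · simp [hw]
          · have : w ∉ Metric.ball z ((1 - ‖z‖) / 8) := fun hwz => hw <| by
              rw [mem_ball_iff_norm] at hwz
              have := norm_sub_norm_le w z
              rw [mem_disc]; linarith
            rw [Set.indicator_of_notMem hw, Set.indicator_of_notMem this, zero_mul]
  -- Joint measurability for Tonelli; with w fixed, the z-integral is the one bounded by
  -- `lintegral_carleson_kernel_le`.
  have hmeas : Measurable fun x : ℂ × ℂ =>
      (Metric.ball x.1 ((1 - ‖x.1‖) / 8)).indicator (fun _ => κ x.1) x.2 * k x.2 := by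
    have hs : MeasurableSet {x : ℂ × ℂ | dist x.2 x.1 < (1 - ‖x.1‖) / 8} :=
      measurableSet_lt (f := fun x : ℂ × ℂ => dist x.2 x.1)
        (g := fun x : ℂ × ℂ => (1 - ‖x.1‖) / 8) (by fun_prop) (by fun_prop)
    have : (fun x : ℂ × ℂ => (Metric.ball x.1 ((1 - ‖x.1‖) / 8)).indicator (fun _ => κ x.1) x.2) =
        {x : ℂ × ℂ | dist x.2 x.1 < (1 - ‖x.1‖) / 8}.indicator fun x => κ x.1 := by
      ext x
      simp only [Set.indicator, Metric.mem_ball, Set.mem_ofPred_eq]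
    have h5 : Measurable fun x : ℂ × ℂ =>
        (Metric.ball x.1 ((1 - ‖x.1‖) / 8)).indicator (fun _ => κ x.1) x.2 := by
      rw [this]
      exact (hκm.comp measurable_fst).indicator hs
    exact h5.mul (hkm.comp measurable_snd)
  calc _ ≤ ∫⁻ z in T, ENNReal.ofReal (E * C₂) *
        (∫⁻ w in disc, (Metric.ball z ((1 - ‖z‖) / 8)).indicator (fun _ => κ z) w * k w) ∂μ :=
        setLIntegral_mono' (measurableSet_annulus δ) hpt
    _ = ENNReal.ofReal (E * C₂) * ∫⁻ w in disc, ∫⁻ z in T,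
        (Metric.ball z ((1 - ‖z‖) / 8)).indicator (fun _ => κ z) w * k w ∂μ := by
        rw [lintegral_const_mul' _ _ ENNReal.ofReal_ne_top, lintegral_lintegral_swap]
        exact hmeas.aemeasurable
    _ ≤ ENNReal.ofReal (E * C₂) * ∫⁻ w in disc, ENNReal.ofReal (C₄ * Λ) * k w := by
        gcongr ENNReal.ofReal (E * C₂) * ?_
        refine setLIntegral_mono' measurableSet_disc fun w hw => ?_
        have hm : Measurable fun z : ℂ =>
            (Metric.ball z ((1 - ‖z‖) / 8)).indicator (fun _ => κ z) w := by
          have hs : MeasurableSet {z : ℂ | dist w z < (1 - ‖z‖) / 8} :=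
            measurableSet_lt (f := fun z : ℂ => dist w z)
              (g := fun z : ℂ => (1 - ‖z‖) / 8) (by fun_prop) (by fun_prop)
          exact hκm.indicator hs
        rw [lintegral_mul_const _ hm]
        gcongr
        exact h4 μ δ Λ hΛ hcar w hw
    _ = ENNReal.ofReal (E * C₂) * (ENNReal.ofReal (C₄ * Λ) * ∫⁻ w in disc, k w) := by
        rw [lintegral_const_mul _ hkm]
    _ ≤ ENNReal.ofReal (E * C₂) * (ENNReal.ofReal (C₄ * Λ) *
        (ENNReal.ofReal C₃ * ENNReal.ofReal N)) := by
        gcongr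
        exact (h3 f hfm hf).trans (mul_le_mul_right hfN _)
    _ = _ := by
        rw [← ENNReal.ofReal_mul hC₃.le, ← ENNReal.ofReal_mul (by positivity),
          ← ENNReal.ofReal_mul (by positivity), hE, Real.mul_rpow hC₁.le hN]
        ring_nf

/-- The Carleson condition makes μ(S(a)) smaller than t by a positive power: W(t) = O(t^(1+β/2)),
the exponent q/p ≥ 1 does no harm, and dividing by Φ(1/t) costs little. Summing over a cover of the
annulus gives power decay. The exponent ε does not depend on μ. -/
theorem exists_carleson_lintegral_rpow_neg_lt_top (h : IsDoublingMeasure ν g τ) (hΦ : IsSlow Φ)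
    (hΨ : IsSlow Ψ) (hp : 0 < p) (hpq : p ≤ q) : ∃ ε : ℝ, 0 < ε ∧ ∀ (μ : Measure ℂ)
      [IsFiniteMeasure μ] (Λ : ℝ), 0 ≤ Λ → CarlesonBound p q Φ Ψ τ μ 1 Λ →
      ∫⁻ z in disc, ENNReal.ofReal ((1 - ‖z‖) ^ (-ε)) ∂μ < ∞ := by
  obtain ⟨C₁, β, hC₁, hβ, h1⟩ := h.decay
  obtain ⟨C₂, hC₂, h2⟩ := hΨ.inv_le (half_pos hβ)
  obtain ⟨C₃, hC₃, h3⟩ := hΦ.le_inv (ε := β / 4) (by positivity)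
  set D := (C₁ * C₂) ^ (q / p) * C₃ with hD
  have hD0 : 0 < D := by positivity
  have hqp : 1 ≤ q / p := by rw [one_le_div hp]; exact hpq
  -- Of the decay β, the factor Ψ takes β/2 and Φ takes β/4; half of the remaining β/4 is given up
  -- in summing the layers.
  refine ⟨β / 4 / 2, by positivity, fun μ _ Λ hΛ hcar => ?_⟩
  refine lintegral_rpow_neg_lt_top (C := 16 * (D * Λ) + μ.real Set.univ) (by positivity)
    fun t ht ht1 => ?_
  have htβ : 0 < t ^ (β / 4) := by positivity
  rcases ht1.eq_or_lt with rfl | hlt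
  · rw [Real.one_rpow, mul_one]
    refine (measure_mono (Set.subset_univ _)).trans ?_
    rw [← ofReal_measureReal]
    exact ENNReal.ofReal_le_ofReal (by linarith [mul_nonneg hD0.le hΛ])
  · have hM : ∀ a : ℂ, ‖a‖ = 1 - t →
        μ (carlesonSquare a) ≤ ENNReal.ofReal (D * Λ * (t * t ^ (β / 4))) := by
      intro a ha
      have := hcar a (mem_disc.2 (by rw [ha]; linarith)) (by rw [ha]; linarith)
      rw [ha, sub_sub_cancel] at this
      rw [← ofReal_measureReal]
      refine ENNReal.ofReal_le_ofReal ?_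
      have hτ := h.pos t ht ht1
      have hψ := hΨ.pos (1 / t) (by positivity)
      have hφ := hΦ.pos (1 / t) (by positivity)
      have e1 : (t * τ t * Ψ (1 / t)) ^ (q / p) ≤ (C₁ * C₂) ^ (q / p) * (t * t ^ (β / 2)) := by
        have e2 : t * τ t * Ψ (1 / t) ≤ C₁ * C₂ * (t * t ^ (β / 2)) := by
          calc t * τ t * Ψ (1 / t) ≤ t * (C₁ * t ^ β) * (C₂ * t ^ (-(β / 2))) := by
                gcongr
                · exact h1 t ht ht1
                · exact h2 t ht ht1
            _ = C₁ * C₂ * (t * (t ^ β * t ^ (-(β / 2)))) := by ring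
            _ = _ := by rw [← Real.rpow_add ht]; congr 3; ring
        calc _ ≤ (C₁ * C₂ * (t * t ^ (β / 2))) ^ (q / p) := by gcongr
          _ = (C₁ * C₂) ^ (q / p) * (t * t ^ (β / 2)) ^ (q / p) :=
              Real.mul_rpow (by positivity) (by positivity)
          _ ≤ _ := by
              gcongr
              have : t * t ^ (β / 2) ≤ 1 :=
                mul_le_one₀ ht1 (by positivity) (Real.rpow_le_one ht.le ht1 (by positivity))
              calc _ ≤ (t * t ^ (β / 2)) ^ (1 : ℝ) :=
                    Real.rpow_le_rpow_of_exponent_ge (by positivity) this hqp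
                _ = _ := Real.rpow_one _
      calc μ.real (carlesonSquare a) = μ.real (carlesonSquare a) * t ^ (β / 4) * t ^ (-(β / 4)) := by
            rw [Real.rpow_neg ht.le]; field_simp
        _ ≤ μ.real (carlesonSquare a) * (C₃ * Φ (1 / t)) * t ^ (-(β / 4)) := by
            gcongr
            exact h3 t ht ht1
        _ = C₃ * (μ.real (carlesonSquare a) * Φ (1 / t)) * t ^ (-(β / 4)) := by ring
        _ ≤ C₃ * (Λ * ((C₁ * C₂) ^ (q / p) * (t * t ^ (β / 2)))) * t ^ (-(β / 4)) := by
            gcongr C₃ * ?_ * _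
            exact this.trans (by gcongr)
        _ = D * Λ * (t * (t ^ (β / 2) * t ^ (-(β / 4)))) := by rw [hD]; ring
        _ = _ := by rw [← Real.rpow_add ht]; congr 3; ring
    refine (measure_annulus_le ht hlt hM).trans ?_
    rw [← ENNReal.ofReal_mul (by positivity)]
    refine ENNReal.ofReal_le_ofReal ?_
    have e3 : 16 / t * (D * Λ * (t * t ^ (β / 4))) = 16 * (D * Λ) * t ^ (β / 4) := by
      field_simp
    rw [e3]
    gcongr
    linarith [measureReal_nonneg (μ := μ) (s := Set.univ)]

/-- The Carleson embedding for functions of polynomial growth, on an annulus. -/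
theorem carleson_embedding_of_growth (h : IsDoublingMeasure ν g τ) (hΦ : IsSlow Φ)
    (hΨ : IsSlow Ψ) (hp : 0 < p) (hpq : p ≤ q) {A B N ε : ℝ} (hB : 0 ≤ B) (hN : 0 ≤ N)
    (hε : 0 < ε) :
    ∃ C : ℝ, 0 < C ∧ ∀ (μ : Measure ℂ) [IsFiniteMeasure μ] (δ Λ : ℝ), 0 ≤ Λ →
      CarlesonBound p q Φ Ψ τ μ (27 * δ) Λ →
      ∀ f : ℂ → ℂ, Measurable f → DifferentiableOn ℂ f disc →
      (∀ z ∈ disc, ‖f z‖ ≤ A * (1 - ‖z‖) ^ (-B)) →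
      ∫⁻ z in disc, ENNReal.ofReal (‖f z‖ ^ p * Ψ (1 / (1 - ‖z‖))) ∂ν ≤ ENNReal.ofReal N →
      ∫⁻ z in {z ∈ disc | 1 - ‖z‖ ≤ δ}, ENNReal.ofReal (‖f z‖ ^ q * Φ ‖f z‖) ∂μ ≤
        ENNReal.ofReal C * (ENNReal.ofReal Λ +
          ∫⁻ z in {z ∈ disc | 1 - ‖z‖ ≤ δ}, ENNReal.ofReal ((1 - ‖z‖) ^ (-ε)) ∂μ) := by
  have hq : 0 < q := hp.trans_le hpq
  obtain ⟨C₁, hC₁, h1⟩ := h.carleson_embedding hΦ hΨ hp hpq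
  obtain ⟨C₂, hC₂, h2⟩ := hΦ.rpow_mul_split (A := A) hq hB hε
  set D := C₁ * (N ^ (q / p - 1) * N) with hD
  have hD0 : 0 ≤ D := by positivity
  refine ⟨C₂ * (D + 1), by positivity, fun μ _ δ Λ hΛ hcar f hfm hf hgrow hfN => ?_⟩
  have hm : Measurable fun z : ℂ => ENNReal.ofReal ((1 - ‖z‖) ^ (-ε)) := by fun_prop
  calc _ ≤ ∫⁻ z in {z ∈ disc | 1 - ‖z‖ ≤ δ}, ENNReal.ofReal C₂ *
        (ENNReal.ofReal (‖f z‖ ^ q * Φ (1 / (1 - ‖z‖))) +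
          ENNReal.ofReal ((1 - ‖z‖) ^ (-ε))) ∂μ := by
        refine setLIntegral_mono' (measurableSet_annulus δ) fun z hz => ?_
        have ht0 : 0 < 1 - ‖z‖ := by linarith [mem_disc.1 hz.1]
        have ht1 : 1 - ‖z‖ ≤ 1 := by linarith [norm_nonneg z]
        have hφ := hΦ.pos (1 / (1 - ‖z‖)) (by positivity)
        rw [← ENNReal.ofReal_add (by positivity) (by positivity), ← ENNReal.ofReal_mul hC₂.le]
        exact ENNReal.ofReal_le_ofReal (h2 _ _ ht0 ht1 (norm_nonneg _) (hgrow z hz.1)).2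
    _ = ENNReal.ofReal C₂ * (∫⁻ z in {z ∈ disc | 1 - ‖z‖ ≤ δ},
          ENNReal.ofReal (‖f z‖ ^ q * Φ (1 / (1 - ‖z‖))) ∂μ +
          ∫⁻ z in {z ∈ disc | 1 - ‖z‖ ≤ δ}, ENNReal.ofReal ((1 - ‖z‖) ^ (-ε)) ∂μ) := by
        rw [lintegral_const_mul' _ _ ENNReal.ofReal_ne_top, lintegral_add_right _ hm]
    _ ≤ ENNReal.ofReal C₂ * (ENNReal.ofReal (D * Λ) +
          ∫⁻ z in {z ∈ disc | 1 - ‖z‖ ≤ δ}, ENNReal.ofReal ((1 - ‖z‖) ^ (-ε)) ∂μ) := by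
        gcongr
        exact h1 μ δ Λ N hΛ hN hcar f hfm hf hfN
    _ ≤ ENNReal.ofReal C₂ * (ENNReal.ofReal (D + 1) * ENNReal.ofReal Λ + ENNReal.ofReal (D + 1) *
          ∫⁻ z in {z ∈ disc | 1 - ‖z‖ ≤ δ}, ENNReal.ofReal ((1 - ‖z‖) ^ (-ε)) ∂μ) := by
        rw [ENNReal.ofReal_mul hD0]
        gcongr
        · linarith
        · refine le_mul_of_one_le_left (zero_le) ?_
          rw [← ENNReal.ofReal_one]
          exact ENNReal.ofReal_le_ofReal (by linarith)
    _ = _ := by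
        rw [ENNReal.ofReal_mul hC₂.le]
        ring

end IsDoublingMeasure

/-! ### Quasi-metrics and compactness -/

/-- A symmetric quasi-metric with values in `[0, ∞]` generating the topology. -/
structure IsQuasiMetric {X : Type*} [TopologicalSpace X] (d : X → X → ℝ≥0∞) : Prop where
  self : ∀ x, d x x = 0
  symm : ∀ x y, d x y = d y x
  triangle : ∃ K : ℝ≥0∞, K ≠ ∞ ∧ ∀ x y z, d x z ≤ K * (d x y + d y z)
  isOpen_iff : ∀ s : Set X, IsOpen s ↔ ∀ x ∈ s, ∃ ε : ℝ≥0∞, 0 < ε ∧ ∀ y, d x y < ε → y ∈ s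

namespace IsQuasiMetric

variable {X : Type*} [TopologicalSpace X] {d : X → X → ℝ≥0∞}

theorem exists_half (h : IsQuasiMetric d) {ε : ℝ≥0∞} (hε : 0 < ε) :
    ∃ δ : ℝ≥0∞, 0 < δ ∧ ∀ x y z, d x y < δ → d y z < δ → d x z < ε := by
  obtain ⟨K, hK, htri⟩ := h.triangle
  have hlim : Tendsto (fun m : ℝ≥0∞ => K * (m + m)) (𝓝 0) (𝓝 0) := by
    have : Tendsto (fun m : ℝ≥0∞ => K * (m + m)) (𝓝 0) (𝓝 (K * (0 + 0))) :=
      ENNReal.Tendsto.const_mul (tendsto_id.add tendsto_id) (Or.inr hK)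
    simpa using this
  obtain ⟨δ, hδ, hsub⟩ := ENNReal.nhds_zero_basis.eventually_iff.1 (hlim.eventually_lt_const hε)
  refine ⟨δ, hδ, fun x y z hxy hyz => lt_of_le_of_lt ?_ (hsub (max_lt hxy hyz))⟩
  refine (htri x y z).trans ?_
  gcongr
  · exact le_max_left _ _
  · exact le_max_right _ _

/-- The uniformity of a quasi-metric. -/
def core (h : IsQuasiMetric d) : UniformSpace.Core X where
  uniformity := comap (fun x : X × X => d x.1 x.2) (𝓝 0)
  refl := by
    intro s hs
    obtain ⟨ε, hε, hsub⟩ := (ENNReal.nhds_zero_basis.comap _).mem_iff.1 hs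
    intro x hx
    refine hsub ?_
    have : x.1 = x.2 := hx
    simpa [this, h.self] using hε
  symm := by
    rw [tendsto_comap_iff]
    have : (fun x : X × X => d x.1 x.2) ∘ Prod.swap = fun x => d x.1 x.2 := by
      ext x; exact h.symm _ _
    rw [this]
    exact tendsto_comap
  comp := by
    intro s hs
    obtain ⟨ε, hε, hsub⟩ := (ENNReal.nhds_zero_basis.comap _).mem_iff.1 hs
    obtain ⟨δ, hδ, htri⟩ := h.exists_half hε
    refine Filter.mem_of_superset (Filter.mem_lift' (preimage_mem_comap
      (ENNReal.nhds_zero_basis.mem_of_mem hδ))) fun x hx => ?_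
    obtain ⟨y, h1, h2⟩ := hx
    exact hsub (htri _ _ _ h1 h2)

/-- Balls of a quasi-metric need not be open, so it is not obvious that they are neighbourhoods of
their centres. The quasi-triangle inequality makes them a basis of a uniformity, and its topology
has the same open sets. -/
theorem eq_toTopologicalSpace (h : IsQuasiMetric d) :
    ‹TopologicalSpace X› = h.core.toTopologicalSpace := by
  refine TopologicalSpace.ext_iff.2 fun s => ?_
  rw [h.isOpen_iff, @isOpen_iff_mem_nhds X h.core.toTopologicalSpace]
  refine forall₂_congr fun x hx => ?_
  rw [h.core.nhds_toTopologicalSpace]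
  have : comap (Prod.mk x) h.core.uniformity = comap (d x) (𝓝 0) := comap_comap
  rw [this, (ENNReal.nhds_zero_basis.comap (d x)).mem_iff]
  rfl

theorem nhds_eq (h : IsQuasiMetric d) (x : X) : 𝓝 x = comap (d x) (𝓝 0) := by
  have : 𝓝 x = @nhds X h.core.toTopologicalSpace x := by rw [← h.eq_toTopologicalSpace]
  rw [this, h.core.nhds_toTopologicalSpace]
  exact comap_comap

theorem tendsto_iff (h : IsQuasiMetric d) {ι : Type*} {l : Filter ι} {u : ι → X} {x : X} :
    Tendsto u l (𝓝 x) ↔ Tendsto (fun i => d x (u i)) l (𝓝 0) := by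
  rw [h.nhds_eq, tendsto_comap_iff]
  rfl

theorem exists_subseq_tendsto (h : IsQuasiMetric d) {K : Set X} (hK : IsCompact K) {u : ℕ → X}
    (hu : ∀ n, u n ∈ K) : ∃ x ∈ K, ∃ φ : ℕ → ℕ, StrictMono φ ∧
      Tendsto (fun n => d x (u (φ n))) atTop (𝓝 0) := by
  have : FirstCountableTopology X := ⟨fun x => by rw [h.nhds_eq]; infer_instance⟩
  obtain ⟨x, hx, φ, hφ, hlim⟩ := hK.isSeqCompact hu
  exact ⟨x, hx, φ, hφ, h.tendsto_iff.1 hlim⟩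

/-- The uniformity is the pullback of the neighbourhoods of 0 and thus countably generated, so
sequential compactness of K implies compactness. Working with a larger set K frees the limits from
having to lie in S or its closure. -/
theorem isCompact_closure (h : IsQuasiMetric d) {S K : Set X} (hSK : S ⊆ K)
    (hK : ∀ u : ℕ → X, (∀ n, u n ∈ K) → ∃ x ∈ K, ∃ φ : ℕ → ℕ, StrictMono φ ∧
      Tendsto (fun n => d x (u (φ n))) atTop (𝓝 0)) : IsCompact (closure S) := by
  let _ : UniformSpace X := UniformSpace.ofCoreEq h.core _ h.eq_toTopologicalSpace
  have : (uniformity X).IsCountablyGenerated :=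
    inferInstanceAs (comap (fun x : X × X => d x.1 x.2) (𝓝 0)).IsCountablyGenerated
  have hseq : IsSeqCompact K := fun u hu => by
    obtain ⟨x, hx, φ, hφ, hlim⟩ := hK u hu
    exact ⟨x, hx, φ, hφ, h.tendsto_iff.2 hlim⟩
  exact hseq.isCompact.closure_of_subset hSK

end IsQuasiMetric

/-! ### The modular as a quasi-metric -/

theorem modular_le_of_le_mul {Φ Φ₀ : ℝ → ℝ} {C : ℝ} (hC : 0 < C)
    (h : ∀ x : ℝ, 0 ≤ x → Φ x ≤ C * Φ₀ x) (q : ℝ) (μ : Measure ℂ) (f : ℂ → ℂ) :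
    modular q Φ μ f ≤ ENNReal.ofReal C * modular q Φ₀ μ f := by
  unfold modular
  rw [← lintegral_const_mul' _ _ ENNReal.ofReal_ne_top]
  refine lintegral_mono fun z => ?_
  rw [← ENNReal.ofReal_mul hC.le]
  refine ENNReal.ofReal_le_ofReal ?_
  calc _ ≤ ‖f z‖ ^ q * (C * Φ₀ ‖f z‖) := by
        gcongr
        exact h _ (norm_nonneg _)
    _ = _ := by ring

theorem modular_congr {q : ℝ} {Φ : ℝ → ℝ} {μ : Measure ℂ} {f g : ℂ → ℂ}
    (h : f =ᵐ[μ.restrict disc] g) : modular q Φ μ f = modular q Φ μ g := by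
  refine lintegral_congr_ae ?_
  filter_upwards [h] with z hz
  rw [hz]

theorem zygmundNorm_eq (p : ℝ) (Ψ : ℝ → ℝ) (μ : Measure ℂ) (f : ℂ → ℂ) :
    zygmundNorm p Ψ μ f = modular p Ψ μ f ^ (1 / p) := rfl

theorem zygmundNorm_lt_top_iff {p : ℝ} (hp : 0 < p) {Ψ : ℝ → ℝ} {μ : Measure ℂ} {f : ℂ → ℂ} :
    zygmundNorm p Ψ μ f < ∞ ↔ modular p Ψ μ f < ∞ := by
  rw [zygmundNorm_eq, ENNReal.rpow_lt_top_iff_of_pos (by positivity)]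

theorem zygmundNorm_lt_iff {p : ℝ} (hp : 0 < p) {Ψ : ℝ → ℝ} {μ : Measure ℂ} {f : ℂ → ℂ}
    {ε : ℝ≥0∞} : zygmundNorm p Ψ μ f < ε ↔ modular p Ψ μ f < ε ^ p := by
  rw [zygmundNorm_eq, one_div, ENNReal.rpow_inv_lt_iff hp]

theorem zygmundNorm_le_iff {p : ℝ} (hp : 0 < p) {Ψ : ℝ → ℝ} {μ : Measure ℂ} {f : ℂ → ℂ}
    {ε : ℝ≥0∞} : zygmundNorm p Ψ μ f ≤ ε ↔ modular p Ψ μ f ≤ ε ^ p := by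
  rw [zygmundNorm_eq, one_div, ENNReal.rpow_inv_le_iff hp]

/-- At each point |f| is at most twice the larger of |f₁| and |f₂|, and x^q Φ(x) is almost
increasing and doubling. -/
theorem IsSlow.modular_add_le {Φ : ℝ → ℝ} (h : IsSlow Φ) {q : ℝ} (hq : 0 < q) :
    ∃ C : ℝ, 0 < C ∧ ∀ (μ : Measure ℂ) (f f₁ f₂ : ℂ → ℂ),
      AEStronglyMeasurable f₁ (μ.restrict disc) →
      (∀ᵐ z ∂μ.restrict disc, ‖f z‖ ≤ ‖f₁ z‖ + ‖f₂ z‖) →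
      modular q Φ μ f ≤ ENNReal.ofReal C * (modular q Φ μ f₁ + modular q Φ μ f₂) := by
  obtain ⟨C, hC, hle⟩ := h.rpow_mul_le_of_le_mul hq (L := 2) one_le_two
  refine ⟨C, hC, fun μ f f₁ f₂ hf₁ hf => ?_⟩
  have hm : AEMeasurable (fun z => ENNReal.ofReal (‖f₁ z‖ ^ q * Φ ‖f₁ z‖)) (μ.restrict disc) := by
    have h1 : AEMeasurable (fun z => ‖f₁ z‖) (μ.restrict disc) := hf₁.norm.aemeasurable
    exact ((h1.pow_const q).mul (h.measurable.comp_aemeasurable h1)).ennreal_ofReal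
  unfold modular
  rw [← lintegral_add_left' hm, ← lintegral_const_mul' _ _ ENNReal.ofReal_ne_top]
  refine lintegral_mono_ae ?_
  filter_upwards [hf] with z hz
  have hp1 : 0 ≤ ‖f₁ z‖ ^ q * Φ ‖f₁ z‖ :=
    mul_nonneg (by positivity) (h.pos _ (norm_nonneg _)).le
  have hp2 : 0 ≤ ‖f₂ z‖ ^ q * Φ ‖f₂ z‖ :=
    mul_nonneg (by positivity) (h.pos _ (norm_nonneg _)).le
  rw [← ENNReal.ofReal_add hp1 hp2, ← ENNReal.ofReal_mul hC.le]
  refine ENNReal.ofReal_le_ofReal ?_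
  rcases le_total ‖f₁ z‖ ‖f₂ z‖ with h12 | h12
  · refine (hle ‖f z‖ ‖f₂ z‖ (norm_nonneg _) (norm_nonneg _) (by linarith)).trans ?_
    gcongr; linarith
  · refine (hle ‖f z‖ ‖f₁ z‖ (norm_nonneg _) (norm_nonneg _) (by linarith)).trans ?_
    gcongr; linarith

/-- The modular without its 1/q-th power has the same balls after a change of radius. The triangle
inequality is obtained for a measurable slow function comparable to Φ and transferred back. -/
theorem isQuasiMetric_modular {Φ : ℝ → ℝ} (hΦ : ClassL Φ) {q : ℝ} (hq : 0 < q) (μ : Measure ℂ) :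
    IsQuasiMetric fun F G : LebesgueZygmund q Φ μ => modular q Φ μ ⇑(G.1 - F.1) where
  self F := by
    have : ⇑(F.1 - F.1) =ᵐ[μ.restrict disc] fun _ => 0 := by
      rw [sub_self]; exact AEEqFun.coeFn_zero
    rw [modular_congr this]
    simp [modular, Real.zero_rpow hq.ne']
  symm F G := by
    have : ∀ᵐ z ∂μ.restrict disc, ‖(G.1 - F.1) z‖ = ‖(F.1 - G.1) z‖ := by
      filter_upwards [AEEqFun.coeFn_sub F.1 G.1, AEEqFun.coeFn_sub G.1 F.1] with z h1 h2
      rw [h1, h2, Pi.sub_apply, Pi.sub_apply, norm_sub_rev]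
    refine lintegral_congr_ae ?_
    filter_upwards [this] with z hz
    rw [hz]
  triangle := by
    obtain ⟨Φ₀, hΦ₀, C, hC, hcomp⟩ := hΦ.exists_isSlow
    obtain ⟨D, hD, hadd⟩ := hΦ₀.modular_add_le hq
    refine ⟨ENNReal.ofReal C * (ENNReal.ofReal D * ENNReal.ofReal C), by finiteness,
      fun F G H => ?_⟩
    have h1 := modular_le_of_le_mul hC (fun x hx => (hcomp x hx).1) q μ
    have h2 := modular_le_of_le_mul hC (fun x hx => (hcomp x hx).2) q μ
    refine (h1 _).trans ?_
    rw [mul_assoc, mul_assoc]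
    gcongr
    refine (hadd μ _ ⇑(G.1 - F.1) ⇑(H.1 - G.1) (G.1 - F.1).aestronglyMeasurable ?_).trans ?_
    · filter_upwards [AEEqFun.coeFn_sub H.1 F.1, AEEqFun.coeFn_sub G.1 F.1,
        AEEqFun.coeFn_sub H.1 G.1] with z e1 e2 e3
      rw [e1, e2, e3, Pi.sub_apply, Pi.sub_apply, Pi.sub_apply, add_comm]
      exact norm_sub_le_norm_sub_add_norm_sub _ _ _
    · gcongr ENNReal.ofReal D * ?_
      rw [mul_add]
      gcongr
      · exact h2 _
      · exact h2 _
  isOpen_iff s := by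
    refine forall₂_congr fun F _ => ⟨?_, ?_⟩
    · rintro ⟨ε, hε, hs⟩
      exact ⟨ε ^ q, ENNReal.rpow_pos_of_nonneg hε hq.le,
        fun G hG => hs G ((zygmundNorm_lt_iff hq).2 hG)⟩
    · rintro ⟨ε, hε, hs⟩
      refine ⟨ε ^ q⁻¹, ENNReal.rpow_pos_of_nonneg hε (by positivity), fun G hG => hs G ?_⟩
      have := (zygmundNorm_lt_iff hq).1 hG
      rwa [← ENNReal.rpow_mul, inv_mul_cancel₀ hq.ne', ENNReal.rpow_one] at this

/-! ### Normal families and sequential compactness -/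

/-- Montel's theorem on the disc, with pointwise convergence. -/
theorem exists_subseq_tendsto_of_bounded {f : ℕ → ℂ → ℂ}
    (hf : ∀ n, DifferentiableOn ℂ (f n) disc)
    (hbound : ∀ r : ℝ, 0 < r → r < 1 → ∃ M : ℝ, ∀ n, ∀ z : ℂ, ‖z‖ ≤ r → ‖f n z‖ ≤ M) :
    ∃ g : ℂ → ℂ, DifferentiableOn ℂ g disc ∧ ∃ φ : ℕ → ℕ, StrictMono φ ∧
      ∀ z ∈ disc, Tendsto (fun n => f (φ n) z) atTop (𝓝 (g z)) := by
  -- The argument runs on Taylor coefficients: Cauchy estimates on radii r < 1 bound them uniformly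
  -- in n and supply geometric majorants for the series.
  set c : ℕ → ℕ → ℂ := fun n k => (k.factorial : ℂ)⁻¹ * iteratedDeriv k (f n) 0 with hc
  have hsum : ∀ n, ∀ z ∈ disc, HasSum (fun k => c n k * z ^ k) (f n z) := by
    intro n z hz
    have := Complex.hasSum_taylorSeries_on_ball (hf n) hz
    have e : (fun k => c n k * z ^ k) = fun k : ℕ =>
        (k.factorial : ℂ)⁻¹ • (z - 0) ^ k • iteratedDeriv k (f n) 0 := by
      ext k
      rw [sub_zero, smul_eq_mul, smul_eq_mul, hc]
      ring
    rw [e]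
    exact this
  have hcoef : ∀ r : ℝ, 0 < r → r < 1 → ∃ M : ℝ, 0 ≤ M ∧ ∀ n k, ‖c n k‖ ≤ M / r ^ k := by
    intro r hr hr1
    obtain ⟨M, hM⟩ := hbound r hr hr1
    refine ⟨M, (norm_nonneg _).trans (hM 0 0 (by simpa using hr.le)), fun n k => ?_⟩
    have hdc : DiffContOnCl ℂ (f n) (Metric.ball 0 r) := by
      refine DifferentiableOn.diffContOnCl ((hf n).mono ?_)
      rw [closure_ball _ hr.ne']
      exact Metric.closedBall_subset_ball hr1
    have := Complex.norm_iteratedDeriv_le_of_forall_mem_sphere_norm_le k hr hdc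
      (fun z hz => hM n z (by simpa using (mem_sphere_iff_norm.1 hz).le))
    have hk : (0 : ℝ) < k.factorial := by positivity
    rw [hc]
    simp only [norm_mul, norm_inv, Complex.norm_natCast]
    rw [inv_mul_le_iff₀ hk, mul_div_assoc']
    exact this
  obtain ⟨M₀, -, hM₀⟩ := hcoef (1 / 2) (by norm_num) (by norm_num)
  -- Sequential compactness of a countable product of closed discs takes the place of the diagonal
  -- argument; one radius is enough to confine the coefficients.
  have hK : IsCompact (Set.pi Set.univ fun k : ℕ =>
      Metric.closedBall (0 : ℂ) (M₀ / (1 / 2) ^ k)) :=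
    isCompact_univ_pi fun k => isCompact_closedBall _ _
  obtain ⟨b, -, φ, hφ, hlim⟩ := hK.isSeqCompact (x := c) fun n k _ => by
    rw [mem_closedBall_zero_iff]; exact hM₀ n k
  have hlim' : ∀ k, Tendsto (fun n => c (φ n) k) atTop (𝓝 (b k)) := fun k =>
    (tendsto_pi_nhds.1 hlim) k
  have hb : ∀ r : ℝ, 0 < r → r < 1 → ∃ M : ℝ, 0 ≤ M ∧ (∀ n k, ‖c n k‖ ≤ M / r ^ k) ∧
      ∀ k, ‖b k‖ ≤ M / r ^ k := by
    intro r hr hr1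
    obtain ⟨M, hM0, hM⟩ := hcoef r hr hr1
    exact ⟨M, hM0, hM, fun k => le_of_tendsto (hlim' k).norm (Eventually.of_forall fun n => hM _ k)⟩
  refine ⟨fun z => ∑' k, b k * z ^ k, fun z hz => ?_, φ, hφ, fun z hz => ?_⟩
  · have hz1 := mem_disc.1 hz
    obtain ⟨s, hzs, hs1⟩ := exists_between hz1
    obtain ⟨r, hsr, hr1⟩ := exists_between hs1
    have hs0 : 0 ≤ s := (norm_nonneg z).trans hzs.le
    have hr0 : 0 < r := hs0.trans_lt hsr
    obtain ⟨M, hM0, -, hM⟩ := hb r hr0 hr1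
    have hsumm : Summable fun k : ℕ => M * (s / r) ^ k :=
      (summable_geometric_of_lt_one (by positivity) ((div_lt_one hr0).2 hsr)).mul_left M
    have := Complex.differentiableOn_tsum_of_summable_norm (F := fun k z => b k * z ^ k)
      (U := Metric.ball 0 s) hsumm (fun k => by fun_prop) Metric.isOpen_ball (fun k w hw => by
        rw [mem_ball_zero_iff] at hw
        rw [norm_mul, norm_pow, div_pow, mul_div_assoc', mul_div_right_comm]
        gcongr
        exact hM k)
    exact (this.differentiableAt (Metric.isOpen_ball.mem_nhds (by simpa using hzs)))
      |>.differentiableWithinAt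
  · have hz1 := mem_disc.1 hz
    obtain ⟨r, hzr, hr1⟩ := exists_between hz1
    have hr0 : 0 < r := (norm_nonneg z).trans_lt hzr
    obtain ⟨M, hM0, hM, -⟩ := hb r hr0 hr1
    have hsumm : Summable fun k : ℕ => M * (‖z‖ / r) ^ k :=
      (summable_geometric_of_lt_one (by positivity) ((div_lt_one hr0).2 hzr)).mul_left M
    have := tendsto_tsum_of_dominated_convergence (f := fun n k => c (φ n) k * z ^ k)
      (g := fun k => b k * z ^ k) hsumm (fun k => (hlim' k).mul_const _)
      (Eventually.of_forall fun n k => by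
        rw [norm_mul, norm_pow, div_pow, mul_div_assoc', mul_div_right_comm]
        gcongr
        exact hM _ k)
    simpa only [(hsum _ z hz).tsum_eq] using this

theorem lintegral_le_of_tendsto {α : Type*} [MeasurableSpace α] {η : Measure α}
    {F : ℕ → α → ℝ≥0∞} {G : α → ℝ≥0∞} {c : ℝ≥0∞} (hF : ∀ n, AEMeasurable (F n) η)
    (hlim : ∀ᵐ x ∂η, Tendsto (fun n => F n x) atTop (𝓝 (G x)))
    (hle : ∀ n, ∫⁻ x, F n x ∂η ≤ c) : ∫⁻ x, G x ∂η ≤ c := by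
  calc ∫⁻ x, G x ∂η = ∫⁻ x, liminf (fun n => F n x) atTop ∂η := by
        refine lintegral_congr_ae ?_
        filter_upwards [hlim] with x hx
        exact hx.liminf_eq.symm
    _ ≤ liminf (fun n => ∫⁻ x, F n x ∂η) atTop := lintegral_liminf_le' hF
    _ ≤ liminf (fun _ : ℕ => c) atTop := liminf_le_liminf (Eventually.of_forall hle)
    _ = c := liminf_const c

theorem measurable_indicator_disc {f : ℂ → ℂ} (hf : DifferentiableOn ℂ f disc) :
    Measurable (disc.indicator f) := by
  classical
  have := hf.continuousOn.measurable_piecewise (g := fun _ => (0 : ℂ)) continuousOn_const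
    measurableSet_disc
  have e : disc.piecewise f (fun _ => 0) = disc.indicator f := Set.piecewise_eq_indicator
  rwa [e] at this

theorem tendsto_setLIntegral_annulus {μ : Measure ℂ} [IsFiniteMeasure μ] {G : ℂ → ℝ≥0∞}
    (hG : ∫⁻ z in disc, G z ∂μ < ∞) {η : ℝ≥0∞} (hη : 0 < η) :
    ∃ δ : ℝ, 0 < δ ∧ ∫⁻ z in {z ∈ disc | 1 - ‖z‖ ≤ δ}, G z ∂μ < η := by
  set E : ℕ → Set ℂ := fun n => {z ∈ disc | 1 - ‖z‖ ≤ 1 / (n + 1 : ℝ)} with hE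
  have hanti : Antitone E := fun m n hmn z hz =>
    ⟨hz.1, hz.2.trans (one_div_le_one_div_of_le (by positivity) (by exact_mod_cast Nat.succ_le_succ hmn))⟩
  have hempty : ⋂ n, E n = ∅ := by
    refine Set.eq_empty_of_forall_notMem fun z hz => ?_
    rw [Set.mem_iInter] at hz
    have hz1 := mem_disc.1 (hz 0).1
    obtain ⟨n, hn⟩ := exists_nat_one_div_lt (sub_pos.2 hz1)
    exact absurd (hz n).2 (not_le.2 hn)
  have h1 : Tendsto ((μ.restrict disc) ∘ E) atTop (𝓝 0) := by
    have := tendsto_measure_iInter_atTop (μ := μ.restrict disc) (s := E)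
      (fun n => (measurableSet_annulus (1 / (n + 1 : ℝ))).nullMeasurableSet) hanti
      ⟨0, measure_ne_top _ _⟩
    rwa [hempty, measure_empty] at this
  have h2 := tendsto_setLIntegral_zero hG.ne h1
  obtain ⟨n, hn⟩ := (h2.eventually_lt_const hη).exists
  refine ⟨1 / (n + 1 : ℝ), by positivity, ?_⟩
  rwa [Measure.restrict_restrict (measurableSet_annulus _),
    Set.inter_eq_left.2 (Set.sep_subset _ _)] at hn

theorem rpow_add_le_two_rpow_mul {x y p : ℝ} (hx : 0 ≤ x) (hy : 0 ≤ y) (hp : 0 < p) :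
    (x + y) ^ p ≤ 2 ^ p * (x ^ p + y ^ p) := by
  have key : ∀ a b : ℝ, 0 ≤ a → a ≤ b → (a + b) ^ p ≤ 2 ^ p * b ^ p := fun a b ha hab => by
    rw [← Real.mul_rpow (by norm_num) (ha.trans hab)]
    exact Real.rpow_le_rpow (by linarith) (by linarith) hp.le
  have hxp : 0 ≤ x ^ p := by positivity
  have hyp : 0 ≤ y ^ p := by positivity
  rcases le_total x y with h | h
  · refine (key x y hx h).trans ?_
    gcongr; linarith
  · rw [add_comm x y]
    refine (key y x hy h).trans ?_
    gcongr; linarith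

namespace IsDoublingMeasure

variable {ν : Measure ℂ} {g : ℝ → ℝ≥0∞} {τ : ℝ → ℝ} {Φ Ψ : ℝ → ℝ} {p q : ℝ}

/-- On the annulus 1 - |z| ≤ δ the embedding gives a bound that is small uniformly in n, since both
Λ and the μ-integral of (1 - |z|)^(-ε) are small there. On the rest of the disc the functions are
uniformly bounded and dominated convergence applies. -/
theorem tendsto_modular_zero (h : IsDoublingMeasure ν g τ) (hΦ : IsSlow Φ) (hΨ : IsSlow Ψ)
    (hp : 0 < p) (hpq : p ≤ q) {μ : Measure ℂ} [IsFiniteMeasure μ]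
    (hcar : ∃ Λ, 0 ≤ Λ ∧ CarlesonBound p q Φ Ψ τ μ 1 Λ)
    (hvan : ∀ Λ, 0 < Λ → ∃ δ, 0 < δ ∧ CarlesonBound p q Φ Ψ τ μ δ Λ) {A B N : ℝ} (hB : 0 ≤ B)
    (hN : 0 ≤ N) {f : ℕ → ℂ → ℂ} (hfm : ∀ n, Measurable (f n))
    (hf : ∀ n, DifferentiableOn ℂ (f n) disc)
    (hgrow : ∀ n, ∀ z ∈ disc, ‖f n z‖ ≤ A * (1 - ‖z‖) ^ (-B))
    (hfN : ∀ n, ∫⁻ z in disc, ENNReal.ofReal (‖f n z‖ ^ p * Ψ (1 / (1 - ‖z‖))) ∂ν ≤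
      ENNReal.ofReal N)
    (hlim : ∀ z ∈ disc, Tendsto (fun n => f n z) atTop (𝓝 0)) :
    Tendsto (fun n => modular q Φ μ (f n)) atTop (𝓝 0) := by
  have hq : 0 < q := hp.trans_le hpq
  obtain ⟨ε, hε, hint⟩ := h.exists_carleson_lintegral_rpow_neg_lt_top hΦ hΨ hp hpq
  obtain ⟨Λ₁, hΛ₁, hcar₁⟩ := hcar
  have hint := hint μ Λ₁ hΛ₁ hcar₁
  obtain ⟨C, hC, hemb⟩ := h.carleson_embedding_of_growth (A := A) hΦ hΨ hp hpq hB hN hε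
  obtain ⟨C₁, hC₁, hup⟩ := hΦ.upper 1 one_pos
  refine ENNReal.tendsto_nhds_zero.2 fun η hη => ?_
  obtain ⟨θ, hθ, hθη⟩ : ∃ θ : ℝ, 0 < θ ∧
      ENNReal.ofReal C * (ENNReal.ofReal θ + ENNReal.ofReal θ) < η / 2 := by
    have hl : Tendsto (fun θ : ℝ => ENNReal.ofReal C * (ENNReal.ofReal θ + ENNReal.ofReal θ))
        (𝓝[>] 0) (𝓝 0) := by
      have h0 : Tendsto (fun θ : ℝ => ENNReal.ofReal θ) (𝓝[>] 0) (𝓝 0) := by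
        have := (ENNReal.continuous_ofReal.tendsto 0).mono_left
          (nhdsWithin_le_nhds (s := Set.Ioi (0 : ℝ)))
        rwa [ENNReal.ofReal_zero] at this
      have := ENNReal.Tendsto.const_mul (h0.add h0) (Or.inr (ENNReal.ofReal_ne_top (r := C)))
      simpa using this
    obtain ⟨θ, h1, h2⟩ := ((hl.eventually_lt_const (ENNReal.half_pos hη.ne')).and
      self_mem_nhdsWithin).exists
    exact ⟨θ, h2, h1⟩
  obtain ⟨δ₁, hδ₁, hcδ⟩ := hvan θ hθ
  obtain ⟨δ₂, hδ₂, hintδ⟩ := tendsto_setLIntegral_annulus hint (ENNReal.ofReal_pos.2 hθ)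
  -- The embedding on height δ uses the Carleson condition up to height 27δ.
  set δ := min (δ₁ / 27) δ₂ with hδ
  have hδ0 : 0 < δ := by positivity
  have hδ₁' : 27 * δ ≤ δ₁ := by linarith [min_le_left (δ₁ / 27) δ₂]
  set T := {z ∈ disc | 1 - ‖z‖ ≤ δ} with hT
  have htail : ∀ n, ∫⁻ z in T, ENNReal.ofReal (‖f n z‖ ^ q * Φ ‖f n z‖) ∂μ ≤ η / 2 := by
    intro n
    refine (hemb μ δ θ hθ.le (fun a ha hat => hcδ a ha (hat.trans hδ₁')) (f n) (hfm n) (hf n)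
      (hgrow n) (hfN n)).trans (le_trans ?_ hθη.le)
    gcongr
    refine (lintegral_mono_set fun z hz => ?_).trans hintδ.le
    exact ⟨hz.1, hz.2.trans (min_le_right _ _)⟩
  have hmain : Tendsto (fun n => ∫⁻ z in disc \ T, ENNReal.ofReal (‖f n z‖ ^ q * Φ ‖f n z‖) ∂μ)
      atTop (𝓝 0) := by
    have hm : ∀ n, Measurable fun z => ENNReal.ofReal (‖f n z‖ ^ q * Φ ‖f n z‖) := fun n =>
      (((hfm n).norm.pow_const q).mul (hΦ.measurable.comp (hfm n).norm)).ennreal_ofReal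
    have hmeas : MeasurableSet (disc \ T) := measurableSet_disc.diff (measurableSet_annulus δ)
    set R := |A| * δ ^ (-B) with hR
    have hR0 : 0 ≤ R := by positivity
    have := tendsto_lintegral_of_dominated_convergence' (μ := μ.restrict (disc \ T))
      (F := fun n z => ENNReal.ofReal (‖f n z‖ ^ q * Φ ‖f n z‖)) (f := fun _ => 0)
      (fun _ => ENNReal.ofReal (R ^ q * (C₁ * (1 + R) ^ (1 : ℝ)))) (fun n => (hm n).aemeasurable)
      (fun n => ?_) ?_ ?_
    · simpa using this
    · filter_upwards [ae_restrict_mem hmeas] with z hz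
      have ht : δ < 1 - ‖z‖ := by
        by_contra hcon
        exact hz.2 ⟨hz.1, not_lt.1 hcon⟩
      have hfz : ‖f n z‖ ≤ R := by
        refine (hgrow n z hz.1).trans ?_
        have h2 : (1 - ‖z‖) ^ (-B) ≤ δ ^ (-B) :=
          Real.rpow_le_rpow_of_nonpos hδ0 ht.le (by linarith)
        have : 0 < 1 - ‖z‖ := by linarith
        have h3 : 0 ≤ (1 - ‖z‖) ^ (-B) := by positivity
        calc A * (1 - ‖z‖) ^ (-B) ≤ |A| * (1 - ‖z‖) ^ (-B) := by gcongr; exact le_abs_self A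
          _ ≤ _ := mul_le_mul_of_nonneg_left h2 (abs_nonneg A)
      have hφ := hΦ.pos _ (norm_nonneg (f n z))
      refine ENNReal.ofReal_le_ofReal ?_
      calc ‖f n z‖ ^ q * Φ ‖f n z‖ ≤ ‖f n z‖ ^ q * (C₁ * (1 + ‖f n z‖) ^ (1 : ℝ)) := by
            gcongr
            exact hup _ (norm_nonneg _)
        _ ≤ _ := by
            rw [Real.rpow_one, Real.rpow_one]
            gcongr
    · rw [lintegral_const]
      exact ENNReal.mul_ne_top ENNReal.ofReal_ne_top (measure_ne_top _ _)
    · filter_upwards [ae_restrict_mem hmeas] with z hz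
      have h1 : Tendsto (fun n => ‖f n z‖) atTop (𝓝 0) := by
        simpa using (hlim z hz.1).norm
      have h2 : Tendsto (fun n => ‖f n z‖ ^ q * (C₁ * (1 + ‖f n z‖) ^ (1 : ℝ))) atTop (𝓝 0) := by
        have := (h1.rpow_const (p := q) (Or.inr hq.le)).mul
          (((h1.const_add 1).rpow_const (p := 1) (Or.inr zero_le_one)).const_mul C₁)
        simpa [Real.zero_rpow hq.ne'] using this
      have h3 : Tendsto (fun n => ‖f n z‖ ^ q * Φ ‖f n z‖) atTop (𝓝 0) := by
        refine squeeze_zero (fun n => ?_) (fun n => ?_) h2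
        · exact mul_nonneg (by positivity) (hΦ.pos _ (norm_nonneg _)).le
        · gcongr
          exact hup _ (norm_nonneg _)
      simpa using ENNReal.tendsto_ofReal h3
  filter_upwards [ENNReal.tendsto_nhds_zero.1 hmain (η / 2) (ENNReal.half_pos hη.ne')] with n hn
  calc modular q Φ μ (f n)
      = ∫⁻ z in disc ∩ T, ENNReal.ofReal (‖f n z‖ ^ q * Φ ‖f n z‖) ∂μ +
        ∫⁻ z in disc \ T, ENNReal.ofReal (‖f n z‖ ^ q * Φ ‖f n z‖) ∂μ :=
        (lintegral_inter_add_sdiff _ _ (measurableSet_annulus δ)).symm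
    _ ≤ η / 2 + η / 2 := by
        refine add_le_add ?_ hn
        rw [Set.inter_eq_right.2 (Set.sep_subset _ _)]
        exact htail n
    _ = η := ENNReal.add_halves η

/-- Sequential compactness, in the Lebesgue--Zygmund modular, of sets of analytic functions of
bounded growth, under the vanishing Carleson condition. -/
theorem exists_subseq_tendsto_modular (h : IsDoublingMeasure ν g τ) (hΦ : IsSlow Φ)
    (hΨ : IsSlow Ψ) (hp : 0 < p) (hpq : p ≤ q) {μ : Measure ℂ} [IsFiniteMeasure μ]
    (hcar : ∃ Λ, 0 ≤ Λ ∧ CarlesonBound p q Φ Ψ τ μ 1 Λ)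
    (hvan : ∀ Λ, 0 < Λ → ∃ δ, 0 < δ ∧ CarlesonBound p q Φ Ψ τ μ δ Λ) {A B N : ℝ} (hB : 0 ≤ B)
    (hN : 0 ≤ N) {f : ℕ → ℂ → ℂ} (hfm : ∀ n, Measurable (f n))
    (hf : ∀ n, DifferentiableOn ℂ (f n) disc)
    (hgrow : ∀ n, ∀ z ∈ disc, ‖f n z‖ ≤ A * (1 - ‖z‖) ^ (-B))
    (hfN : ∀ n, ∫⁻ z in disc, ENNReal.ofReal (‖f n z‖ ^ p * Ψ (1 / (1 - ‖z‖))) ∂ν ≤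
      ENNReal.ofReal N) :
    ∃ G : ℂ → ℂ, Measurable G ∧ DifferentiableOn ℂ G disc ∧
      (∀ z ∈ disc, ‖G z‖ ≤ A * (1 - ‖z‖) ^ (-B)) ∧
      ∫⁻ z in disc, ENNReal.ofReal (‖G z‖ ^ p * Ψ (1 / (1 - ‖z‖))) ∂ν ≤ ENNReal.ofReal N ∧
      ∃ φ : ℕ → ℕ, StrictMono φ ∧
        Tendsto (fun n => modular q Φ μ (fun z => f (φ n) z - G z)) atTop (𝓝 0) := by
  obtain ⟨G₀, hG₀, φ, hφ, hlim₀⟩ := exists_subseq_tendsto_of_bounded hf fun r hr hr1 => by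
    refine ⟨|A| * (1 - r) ^ (-B), fun n z hz => ?_⟩
    have hzd : z ∈ disc := mem_disc.2 (by linarith)
    refine (hgrow n z hzd).trans ?_
    have h2 : (1 - ‖z‖) ^ (-B) ≤ (1 - r) ^ (-B) :=
      Real.rpow_le_rpow_of_nonpos (by linarith) (by linarith) (by linarith)
    have : 0 < 1 - ‖z‖ := by linarith
    calc A * (1 - ‖z‖) ^ (-B) ≤ |A| * (1 - ‖z‖) ^ (-B) := by gcongr; exact le_abs_self A
      _ ≤ _ := by gcongr
  -- The limit is only controlled in the disc; cutting it off makes it globally measurable.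
  set G := disc.indicator G₀ with hG
  have hGeq : ∀ z ∈ disc, G z = G₀ z := fun z hz => Set.indicator_of_mem hz _
  have hGd : DifferentiableOn ℂ G disc := hG₀.congr hGeq
  have hGm : Measurable G := measurable_indicator_disc hG₀
  have hlim : ∀ z ∈ disc, Tendsto (fun n => f (φ n) z) atTop (𝓝 (G z)) := fun z hz => by
    rw [hGeq z hz]; exact hlim₀ z hz
  have hGgrow : ∀ z ∈ disc, ‖G z‖ ≤ A * (1 - ‖z‖) ^ (-B) := fun z hz =>
    le_of_tendsto (hlim z hz).norm (Eventually.of_forall fun n => hgrow _ z hz)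
  have hΨm : Measurable fun z : ℂ => Ψ (1 / (1 - ‖z‖)) :=
    hΨ.measurable_inv.comp (by fun_prop : Measurable fun z : ℂ => 1 - ‖z‖)
  have hm : ∀ F : ℂ → ℂ, Measurable F →
      Measurable fun z => ENNReal.ofReal (‖F z‖ ^ p * Ψ (1 / (1 - ‖z‖))) := fun F hF =>
    ((hF.norm.pow_const p).mul hΨm).ennreal_ofReal
  have hGN : ∫⁻ z in disc, ENNReal.ofReal (‖G z‖ ^ p * Ψ (1 / (1 - ‖z‖))) ∂ν ≤
      ENNReal.ofReal N := by
    refine lintegral_le_of_tendsto (fun n => (hm _ (hfm (φ n))).aemeasurable) ?_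
      (fun n => hfN (φ n))
    filter_upwards [ae_restrict_mem measurableSet_disc] with z hz
    exact ENNReal.tendsto_ofReal
      (((hlim z hz).norm.rpow_const (Or.inr hp.le)).mul_const _)
  refine ⟨G, hGm, hGd, hGgrow, hGN, φ, hφ, ?_⟩
  refine h.tendsto_modular_zero hΦ hΨ hp hpq hcar hvan (A := 2 * A) (N := 2 ^ p * (N + N)) hB
    (by positivity) (fun n => (hfm _).sub hGm) (fun n => (hf _).sub hGd) (fun n z hz => ?_)
    (fun n => ?_) (fun z hz => ?_)
  · have h1 := hgrow (φ n) z hz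
    have h2 := hGgrow z hz
    have h3 := norm_sub_le (f (φ n) z) (G z)
    linarith
  · calc _ ≤ ∫⁻ z in disc, ENNReal.ofReal (2 ^ p) *
          (ENNReal.ofReal (‖f (φ n) z‖ ^ p * Ψ (1 / (1 - ‖z‖))) +
            ENNReal.ofReal (‖G z‖ ^ p * Ψ (1 / (1 - ‖z‖)))) ∂ν := by
          refine setLIntegral_mono' measurableSet_disc fun z hz => ?_
          have ht0 : 0 < 1 - ‖z‖ := by linarith [mem_disc.1 hz]
          have hψ := hΨ.pos (1 / (1 - ‖z‖)) (by positivity)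
          rw [← ENNReal.ofReal_add (by positivity) (by positivity),
            ← ENNReal.ofReal_mul (by positivity)]
          refine ENNReal.ofReal_le_ofReal ?_
          rw [← add_mul, ← mul_assoc]
          gcongr
          refine le_trans ?_ (rpow_add_le_two_rpow_mul (norm_nonneg _) (norm_nonneg _) hp)
          gcongr
          exact norm_sub_le _ _
      _ ≤ ENNReal.ofReal (2 ^ p) * (ENNReal.ofReal N + ENNReal.ofReal N) := by
          rw [lintegral_const_mul' _ _ ENNReal.ofReal_ne_top, lintegral_add_left (hm _ (hfm _))]
          gcongr
          exact hfN _
      _ = _ := by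
          rw [← ENNReal.ofReal_add hN hN, ← ENNReal.ofReal_mul (by positivity)]
  · have := (hlim z hz).sub_const (G z)
    rwa [sub_self] at this

end IsDoublingMeasure

/-! ### Tools for both directions -/

theorem eventually_boundary_iff {P : ℂ → Prop} :
    (∀ᶠ a in comap (fun a : ℂ => ‖a‖) (𝓝[<] 1), P a) ↔
      ∃ δ : ℝ, 0 < δ ∧ ∀ a ∈ disc, 1 - ‖a‖ ≤ δ → P a := by
  rw [eventually_comap]
  constructor
  · intro h
    obtain ⟨l, hl, hs⟩ := (mem_nhdsLT_iff_exists_Ico_subset).1 h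
    refine ⟨1 - l, sub_pos.2 hl, fun a ha hat => hs ⟨by linarith, mem_disc.1 ha⟩ a rfl⟩
  · rintro ⟨δ, hδ, hP⟩
    filter_upwards [Ioo_mem_nhdsLT (sub_lt_self 1 hδ)] with x hx a ha
    exact hP a (mem_disc.2 (ha ▸ hx.2)) (by rw [ha]; linarith [hx.1])

/-- The modular limit and the pointwise limit must agree. Since Φ need not be continuous, Fatou is
applied to the continuous minorant m(s) = s^q (1 + s)^(-q/2) of a multiple of s^q Φ(s), which
vanishes only at 0. -/
theorem ae_eq_zero_of_tendsto_modular {Φ : ℝ → ℝ} (hΦ : IsSlow Φ) {q : ℝ} (hq : 0 < q)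
    {μ : Measure ℂ} {u : ℕ → ℂ →ₘ[μ.restrict disc] ℂ} {x : ℂ →ₘ[μ.restrict disc] ℂ}
    (hmod : Tendsto (fun n => modular q Φ μ ⇑(u n - x)) atTop (𝓝 0))
    (hlim : ∀ᵐ z ∂μ.restrict disc, Tendsto (fun n => u n z) atTop (𝓝 0)) :
    x =ᵐ[μ.restrict disc] 0 := by
  obtain ⟨C, hC, hlow⟩ := hΦ.lower (q / 2) (half_pos hq)
  set m : ℝ → ℝ := fun s => s ^ q * (1 + s) ^ (-(q / 2)) with hm
  have hmle : ∀ s : ℝ, 0 ≤ s → m s ≤ C * (s ^ q * Φ s) := by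
    intro s hs
    have h1 := hlow s hs
    have h2 : 0 < (1 + s) ^ (q / 2) := by positivity
    have h3 : (1 + s) ^ (-(q / 2)) ≤ C * Φ s := by
      rw [Real.rpow_neg (by positivity), inv_le_iff_one_le_mul₀ h2]
      linarith
    calc m s ≤ s ^ q * (C * Φ s) := mul_le_mul_of_nonneg_left h3 (by positivity)
      _ = _ := by ring
  have hmcont : ∀ s : ℝ, 0 ≤ s → ContinuousAt m s := fun s hs =>
    (continuousAt_id.rpow_const (Or.inr hq.le)).mul
      ((continuousAt_const.add continuousAt_id).rpow_const (Or.inl (by simp; positivity)))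
  have hmmeas : Measurable m := by fun_prop
  have hle : ∀ n, ∫⁻ z in disc, ENNReal.ofReal (m ‖(u n - x) z‖) ∂μ ≤
      ENNReal.ofReal C * modular q Φ μ ⇑(u n - x) := fun n => by
    unfold modular
    rw [← lintegral_const_mul' _ _ ENNReal.ofReal_ne_top]
    refine lintegral_mono fun z => ?_
    rw [← ENNReal.ofReal_mul hC.le]
    exact ENNReal.ofReal_le_ofReal (hmle _ (norm_nonneg _))
  have hzero : Tendsto (fun n => ENNReal.ofReal C * modular q Φ μ ⇑(u n - x)) atTop (𝓝 0) := by
    simpa using ENNReal.Tendsto.const_mul hmod (Or.inr (ENNReal.ofReal_ne_top (r := C)))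
  have hFm : ∀ n, AEMeasurable (fun z => ENNReal.ofReal (m ‖(u n - x) z‖)) (μ.restrict disc) :=
    fun n => (hmmeas.comp_aemeasurable (u n - x).aestronglyMeasurable.norm.aemeasurable).ennreal_ofReal
  have hsub : ∀ᵐ z ∂μ.restrict disc, ∀ n, (u n - x) z = u n z - x z :=
    ae_all_iff.2 fun n => AEEqFun.coeFn_sub (u n) x
  have hint : ∫⁻ z in disc, ENNReal.ofReal (m ‖x z‖) ∂μ ≤ 0 := by
    refine ENNReal.le_of_forall_pos_le_add fun ε hε _ => ?_
    obtain ⟨k, hk⟩ := eventually_atTop.1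
      (ENNReal.tendsto_nhds_zero.1 hzero ε (by exact_mod_cast hε))
    rw [zero_add]
    refine lintegral_le_of_tendsto (fun n => hFm (n + k)) ?_
      (fun n => (hle (n + k)).trans (hk _ (Nat.le_add_left _ _)))
    filter_upwards [hlim, hsub] with z hz hs
    have h1 : Tendsto (fun n => ‖(u (n + k) - x) z‖) atTop (𝓝 ‖x z‖) := by
      have := ((hz.comp (tendsto_add_atTop_nat k)).sub_const (x z)).norm
      rw [zero_sub, norm_neg] at this
      refine this.congr fun n => ?_
      rw [hs]; rfl
    exact ENNReal.tendsto_ofReal ((hmcont _ (norm_nonneg _)).tendsto.comp h1)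
  have hxm : AEMeasurable (fun z => ENNReal.ofReal (m ‖x z‖)) (μ.restrict disc) :=
    (hmmeas.comp_aemeasurable x.aestronglyMeasurable.norm.aemeasurable).ennreal_ofReal
  have := (lintegral_eq_zero_iff' hxm).1 (le_antisymm hint zero_le)
  filter_upwards [this] with z hz
  by_contra hne
  have hpos : 0 < ‖x z‖ := norm_pos_iff.2 hne
  have h1 : 0 < m ‖x z‖ := by rw [hm]; positivity
  exact (ENNReal.ofReal_pos.2 h1).ne' hz

theorem modular_indicator_disc (p : ℝ) (Ψ : ℝ → ℝ) (μ : Measure ℂ) (f : ℂ → ℂ) :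
    modular p Ψ μ (disc.indicator f) = modular p Ψ μ f := by
  refine modular_congr ?_
  filter_upwards [ae_restrict_mem measurableSet_disc] with z hz
  exact Set.indicator_of_mem hz f

theorem CarlesonBound.mono_left {p q : ℝ} {Φ Ψ τ : ℝ → ℝ} {μ : Measure ℂ} {δ Λ : ℝ}
    (h : CarlesonBound p q Φ Ψ τ μ 1 Λ) : CarlesonBound p q Φ Ψ τ μ δ Λ := fun a ha _ =>
  h a ha (by linarith [norm_nonneg a])

theorem mul_measureReal_le_of_modular_le {Φ : ℝ → ℝ} {q κ C Λ : ℝ} (hC : 0 < C)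
    (hκ : 0 ≤ κ) (hΛ : 0 ≤ Λ) {μ : Measure ℂ} [IsFiniteMeasure μ] {a : ℂ} {f : ℂ → ℂ}
    (hlow : ∀ z ∈ carlesonSquare a, κ ≤ C * (‖f z‖ ^ q * Φ ‖f z‖))
    (hf : modular q Φ μ f ≤ ENNReal.ofReal Λ) : κ * μ.real (carlesonSquare a) ≤ C * Λ := by
  have : ENNReal.ofReal (κ * μ.real (carlesonSquare a)) ≤ ENNReal.ofReal (C * Λ) := by
    calc _ = ∫⁻ _ in carlesonSquare a, ENNReal.ofReal κ ∂μ := by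
          rw [setLIntegral_const, ENNReal.ofReal_mul hκ, ofReal_measureReal]
      _ ≤ ∫⁻ z in carlesonSquare a, ENNReal.ofReal C *
            ENNReal.ofReal (‖f z‖ ^ q * Φ ‖f z‖) ∂μ := by
          refine setLIntegral_mono' (measurableSet_carlesonSquare a) fun z hz => ?_
          rw [← ENNReal.ofReal_mul hC.le]
          exact ENNReal.ofReal_le_ofReal (hlow z hz)
      _ ≤ ENNReal.ofReal C * modular q Φ μ f := by
          rw [lintegral_const_mul' _ _ ENNReal.ofReal_ne_top]
          gcongr ENNReal.ofReal C * ?_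
          exact lintegral_mono_set (carlesonSquare_subset_disc a)
      _ ≤ ENNReal.ofReal C * ENNReal.ofReal Λ := by gcongr
      _ = _ := (ENNReal.ofReal_mul hC.le).symm
  rwa [ENNReal.ofReal_le_ofReal_iff (by positivity)] at this

namespace IsDoublingMeasure

variable {ν : Measure ℂ} {g : ℝ → ℝ≥0∞} {τ : ℝ → ℝ} {Φ Ψ : ℝ → ℝ} {p q : ℝ}

/-- Growth of f, freezing of the slow factors and the embedding with δ = 1, where the annulus is the
whole disc. Values of f outside the disc are cut off to have a measurable function. -/
theorem modular_le_of_carlesonBound (h : IsDoublingMeasure ν g τ) (hΦ : IsSlow Φ)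
    (hΨ : IsSlow Ψ) (hp : 0 < p) (hpq : p ≤ q) {μ : Measure ℂ} [IsFiniteMeasure μ]
    (hcar : ∃ Λ, 0 ≤ Λ ∧ CarlesonBound p q Φ Ψ τ μ 1 Λ) (N : ℝ) :
    ∃ M : ℝ, ∀ f : ℂ → ℂ, DifferentiableOn ℂ f disc → modular p Ψ ν f ≤ ENNReal.ofReal N →
      modular q Φ μ f ≤ ENNReal.ofReal M := by
  obtain ⟨Λ, hΛ, hcar⟩ := hcar
  obtain ⟨B, hB, hgr⟩ := h.growth_of_modular_le hΨ hp
  obtain ⟨A, hA, hgr⟩ := hgr N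
  obtain ⟨ε, hε, hint⟩ := h.exists_carleson_lintegral_rpow_neg_lt_top hΦ hΨ hp hpq
  have hint := hint μ Λ hΛ hcar
  obtain ⟨C, hC, hemb⟩ := h.carleson_embedding_of_growth (A := A) hΦ hΨ hp hpq hB.le hA.le hε
  set T := ENNReal.ofReal C * (ENNReal.ofReal Λ +
    ∫⁻ z in disc, ENNReal.ofReal ((1 - ‖z‖) ^ (-ε)) ∂μ) with hT
  have hTtop : T ≠ ∞ := ENNReal.mul_ne_top ENNReal.ofReal_ne_top
    (ENNReal.add_ne_top.2 ⟨ENNReal.ofReal_ne_top, hint.ne⟩)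
  refine ⟨T.toReal, fun f hf hfN => ?_⟩
  rw [ENNReal.ofReal_toReal hTtop]
  have hfd : DifferentiableOn ℂ (disc.indicator f) disc :=
    hf.congr fun z hz => Set.indicator_of_mem hz f
  have hfm := measurable_indicator_disc hf
  obtain ⟨h1, h2⟩ := hgr _ hfm hfd (by rwa [modular_indicator_disc])
  have hdisc : {z ∈ disc | 1 - ‖z‖ ≤ 1} = disc :=
    Set.sep_eq_self_iff_mem_true.2 fun z _ => by linarith [norm_nonneg z]
  have := hemb μ 1 Λ hΛ hcar.mono_left _ hfm hfd h1 h2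
  rw [hdisc] at this
  rw [← modular_indicator_disc]
  exact this

/-- Squares of height above δ pose no problem: μ is finite, Φ(1/t) is at most a multiple of δ^(-1),
and the weight is at least a multiple of δ^B. -/
theorem exists_carlesonBound_of_vanishing (h : IsDoublingMeasure ν g τ) (hΦ : IsSlow Φ)
    (hΨ : IsSlow Ψ) (hp : 0 < p) (hpq : p ≤ q) {μ : Measure ℂ} [IsFiniteMeasure μ]
    (hvan : ∀ Λ, 0 < Λ → ∃ δ, 0 < δ ∧ CarlesonBound p q Φ Ψ τ μ δ Λ) :
    ∃ Λ, 0 ≤ Λ ∧ CarlesonBound p q Φ Ψ τ μ 1 Λ := by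
  obtain ⟨δ, hδ, hcar⟩ := hvan 1 one_pos
  obtain ⟨C, B, hC, hB, hw⟩ := h.weight_bounds hΨ
  obtain ⟨D, hD, hφ⟩ := hΦ.inv_le one_pos
  have hq : 0 < q := hp.trans_le hpq
  set E := μ.real Set.univ * (D * δ ^ (-(1 : ℝ))) / (δ ^ B / C) ^ (q / p) with hE
  have hE0 : 0 ≤ E := by positivity
  refine ⟨1 + E, by positivity, fun a ha _ => ?_⟩
  have ht0 : 0 < 1 - ‖a‖ := by linarith [mem_disc.1 ha]
  have ht1 : 1 - ‖a‖ ≤ 1 := by linarith [norm_nonneg a]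
  have hτ := h.pos _ ht0 ht1
  have hψ := hΨ.pos (1 / (1 - ‖a‖)) (by positivity)
  have hφa := hΦ.pos (1 / (1 - ‖a‖)) (by positivity)
  rcases le_or_gt (1 - ‖a‖) δ with hle | hlt
  · refine (hcar a ha hle).trans ?_
    gcongr
    linarith
  · set t := 1 - ‖a‖ with ht
    have e1 : Φ (1 / t) ≤ D * δ ^ (-(1 : ℝ)) := by
      refine (hφ t ht0 ht1).trans ?_
      gcongr ?_ * ?_
      exact Real.rpow_le_rpow_of_nonpos hδ hlt.le (by norm_num)
    have e2 : δ ^ B / C ≤ t * τ t * Ψ (1 / t) := by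
      rw [div_le_iff₀ hC, mul_comm]
      refine le_trans ?_ (hw t ht0 ht1).2
      gcongr
    have e3 : 0 < (δ ^ B / C) ^ (q / p) := by positivity
    calc μ.real (carlesonSquare a) * Φ (1 / t)
        ≤ μ.real Set.univ * (D * δ ^ (-(1 : ℝ))) := by
          exact mul_le_mul (measureReal_mono (Set.subset_univ _)) e1 hφa.le measureReal_nonneg
      _ = E * (δ ^ B / C) ^ (q / p) := by rw [hE, div_mul_cancel₀ _ e3.ne']
      _ ≤ (1 + E) * (t * τ t * Ψ (1 / t)) ^ (q / p) := by
          gcongr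
          linarith

end IsDoublingMeasure

/-! ### Comparison with the Carleson quotient of the statement -/

theorem mul_div_rpow_le {k φ φ' D D' c s : ℝ} (hk : 0 ≤ k) (hc : 0 < c) (hs : 0 < s)
    (hφ : φ ≤ c * φ') (hφ' : 0 < φ') (hD : 0 < D) (hD' : 0 < D') (h : D' ≤ c * D) :
    k * φ / D ^ s ≤ c * c ^ s * (k * φ' / D' ^ s) := by
  have h1 : D' ^ s ≤ c ^ s * D ^ s := by
    rw [← Real.mul_rpow hc.le hD.le]
    exact Real.rpow_le_rpow hD'.le h hs.le
  rw [mul_div_assoc', div_le_div_iff₀ (by positivity) (by positivity)]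
  calc k * φ * D' ^ s ≤ k * (c * φ') * (c ^ s * D ^ s) := by
        have : 0 ≤ D' ^ s := by positivity
        have : 0 ≤ k * (c * φ') := by positivity
        gcongr
    _ = _ := by ring

theorem modular_le_of_zygmundNorm_le {p : ℝ} (hp : 0 < p) {Ψ : ℝ → ℝ} {μ : Measure ℂ}
    {f : ℂ → ℂ} {M : ℝ≥0} (h : zygmundNorm p Ψ μ f ≤ M) :
    modular p Ψ μ f ≤ ENNReal.ofReal ((M : ℝ) ^ p) := by
  rw [zygmundNorm_le_iff hp] at h
  rwa [← ENNReal.ofReal_rpow_of_nonneg M.coe_nonneg hp.le, ENNReal.ofReal_coe_nnreal]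

theorem zygmundNorm_le_of_modular_le {p : ℝ} (hp : 0 < p) {Ψ : ℝ → ℝ} {μ : Measure ℂ}
    {f : ℂ → ℂ} {N : ℝ} (h : modular p Ψ μ f ≤ ENNReal.ofReal N) :
    zygmundNorm p Ψ μ f ≤ ((N.toNNReal ^ (1 / p) : ℝ≥0) : ℝ≥0∞) := by
  rw [zygmundNorm_eq, ENNReal.coe_rpow_of_nonneg _ (by positivity)]
  exact ENNReal.rpow_le_rpow h (by positivity)

theorem zygmundNorm_identityMap {p q : ℝ} {Φ Ψ : ℝ → ℝ} {ω : ℂ → ℝ} {μ : Measure ℂ}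
    (h : Contained p q Φ Ψ ω μ) (f : BergmanZygmund p Ψ ω) :
    zygmundNorm q Φ μ (identityMap h f).1 = zygmundNorm q Φ μ f.1 :=
  zygmundNorm_congr (AEEqFun.coeFn_mk _ _)

namespace IsDoublingMeasure

variable {g : ℝ → ℝ≥0∞} {τ : ℝ → ℝ} {ω : ℂ → ℝ} {Φ Ψ Φ₀ Ψ₀ : ℝ → ℝ} {p q K L : ℝ}
  {μ : Measure ℂ}

/-- Since ω(S(a)) ≍ t τ(t) lies between constant multiples of t^B and t, its reciprocal is
polynomially related to 1/t, and slow functions do not see the difference. -/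
theorem carlesonQuotient_comparable (h : IsDoublingMeasure (weightMeasure ω) g τ)
    (hΦ : IsSlow Φ₀) (hΨ : IsSlow Ψ₀) (hΦp : ∀ x, 0 ≤ x → 0 < Φ x) (hΨp : ∀ x, 0 ≤ x → 0 < Ψ x)
    (hK : 0 < K) (hΦK : ∀ x, 0 ≤ x → Φ x ≤ K * Φ₀ x ∧ Φ₀ x ≤ K * Φ x)
    (hL : 0 < L) (hΨL : ∀ x, 0 ≤ x → Ψ x ≤ L * Ψ₀ x ∧ Ψ₀ x ≤ L * Ψ x)
    (hp : 0 < p) (hq : 0 < q) (μ : Measure ℂ) : ∃ C : ℝ, 0 < C ∧ ∀ a ∈ disc,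
      0 ≤ carlesonQuotient p q Φ Ψ ω μ a ∧
      carlesonQuotient p q Φ Ψ ω μ a ≤ C * (μ.real (carlesonSquare a) * Φ₀ (1 / (1 - ‖a‖)) /
        ((1 - ‖a‖) * τ (1 - ‖a‖) * Ψ₀ (1 / (1 - ‖a‖))) ^ (q / p)) ∧
      μ.real (carlesonSquare a) * Φ₀ (1 / (1 - ‖a‖)) /
        ((1 - ‖a‖) * τ (1 - ‖a‖) * Ψ₀ (1 / (1 - ‖a‖))) ^ (q / p) ≤
        C * carlesonQuotient p q Φ Ψ ω μ a := by
  obtain ⟨C₁, hC₁, hS⟩ := h.measure_carlesonSquare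
  obtain ⟨C₂, B, hC₂, hB, hw⟩ := h.weight_bounds isSlow_one
  obtain ⟨C₃, hC₃, h3⟩ := hΦ.comparable_inv_of_between (a := 1 / (C₁ * C₂)) (A := C₁ * C₂)
    (by positivity) one_pos hB.le
  obtain ⟨C₄, hC₄, h4⟩ := hΨ.comparable_inv_of_between (a := 1 / (C₁ * C₂)) (A := C₁ * C₂)
    (by positivity) one_pos hB.le
  set c := K * C₃ + C₁ * (L * C₄) with hc
  have hcpos : 0 < c := by positivity
  have hcK : K * C₃ ≤ c := by rw [hc]; linarith [(by positivity : 0 < C₁ * (L * C₄))]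
  have hcL : C₁ * (L * C₄) ≤ c := by rw [hc]; linarith [(by positivity : 0 < K * C₃)]
  refine ⟨c * c ^ (q / p), by positivity, fun a ha => ?_⟩
  have ht0 : 0 < 1 - ‖a‖ := by linarith [mem_disc.1 ha]
  have ht1 : 1 - ‖a‖ ≤ 1 := by linarith [norm_nonneg a]
  have hSa := hS a ha
  set t := 1 - ‖a‖ with ht
  set m := squareMass ω a with hm
  have hτ := h.pos t ht0 ht1
  have hne : weightMeasure ω (carlesonSquare a) ≠ ∞ := ne_top_of_le_ne_top ENNReal.ofReal_ne_top hSa.1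
  have hmν : weightMeasure ω (carlesonSquare a) = ENNReal.ofReal m :=
    (ENNReal.ofReal_toReal hne).symm
  rw [hmν] at hSa
  have hm0 : 0 ≤ m := measureReal_nonneg
  have e1 : m ≤ C₁ * (t * τ t) := (ENNReal.ofReal_le_ofReal_iff (by positivity)).1 hSa.1
  have e2 : t * τ t ≤ C₁ * m := by
    have := hSa.2
    rwa [← ENNReal.ofReal_mul hC₁.le, ENNReal.ofReal_le_ofReal_iff (by positivity)] at this
  have hmpos : 0 < m := by
    have : 0 < C₁ * m := lt_of_lt_of_le (by positivity) e2
    exact pos_of_mul_pos_right this hC₁.le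
  obtain ⟨w1, w2⟩ := hw t ht0 ht1
  rw [mul_one] at w1 w2
  have e3 : 1 / (C₁ * C₂) * t ^ (-(1 : ℝ)) ≤ 1 / m := by
    rw [Real.rpow_neg_one, ← one_div, div_mul_div_comm, mul_one]
    refine one_div_le_one_div_of_le hmpos ?_
    calc m ≤ C₁ * (t * τ t) := e1
      _ ≤ C₁ * (C₂ * t) := by gcongr
      _ = _ := by ring
  have e4 : 1 / m ≤ C₁ * C₂ * t ^ (-B) := by
    rw [Real.rpow_neg ht0.le, ← div_eq_mul_inv, div_le_div_iff₀ hmpos (by positivity), one_mul]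
    calc t ^ B ≤ C₂ * (t * τ t) := w2
      _ ≤ C₂ * (C₁ * m) := by gcongr
      _ = _ := by ring
  have hm1 : 0 ≤ 1 / m := by positivity
  have f1 := h3 t (1 / m) ht0 ht1 e3 e4
  have f2 := h4 t (1 / m) ht0 ht1 e3 e4
  have hφt := hΦ.pos (1 / t) (by positivity)
  have hψt := hΨ.pos (1 / t) (by positivity)
  have hφm := hΦp _ hm1
  have hψm := hΨp _ hm1
  have g1 : Φ (1 / m) ≤ c * Φ₀ (1 / t) := by
    calc _ ≤ K * Φ₀ (1 / m) := (hΦK _ hm1).1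
      _ ≤ K * (C₃ * Φ₀ (1 / t)) := by gcongr; exact f1.1
      _ = K * C₃ * Φ₀ (1 / t) := by ring
      _ ≤ _ := by gcongr
  have g2 : Φ₀ (1 / t) ≤ c * Φ (1 / m) := by
    calc _ ≤ C₃ * Φ₀ (1 / m) := f1.2
      _ ≤ C₃ * (K * Φ (1 / m)) := by gcongr; exact (hΦK _ hm1).2
      _ = K * C₃ * Φ (1 / m) := by ring
      _ ≤ _ := by gcongr
  have g3 : m * Ψ (1 / m) ≤ c * (t * τ t * Ψ₀ (1 / t)) := by
    calc _ ≤ (C₁ * (t * τ t)) * (L * (C₄ * Ψ₀ (1 / t))) := by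
          gcongr
          exact ((hΨL _ hm1).1).trans (by gcongr; exact f2.1)
      _ = C₁ * (L * C₄) * (t * τ t * Ψ₀ (1 / t)) := by ring
      _ ≤ _ := by gcongr
  have g4 : t * τ t * Ψ₀ (1 / t) ≤ c * (m * Ψ (1 / m)) := by
    calc _ ≤ (C₁ * m) * (C₄ * (L * Ψ (1 / m))) := by
          refine mul_le_mul e2 ?_ hψt.le (by positivity)
          exact f2.2.trans (by gcongr; exact (hΨL _ hm1).2)
      _ = C₁ * (L * C₄) * (m * Ψ (1 / m)) := by ring
      _ ≤ _ := by gcongr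
  refine ⟨?_, ?_, ?_⟩
  · exact div_nonneg (mul_nonneg measureReal_nonneg hφm.le) (by positivity)
  · exact mul_div_rpow_le measureReal_nonneg hcpos (by positivity) g1 hφt (by positivity)
      (by positivity) g4
  · exact mul_div_rpow_le measureReal_nonneg hcpos (by positivity) g2 hφm (by positivity)
      (by positivity) g3

theorem carlesonBound_iff (h : IsDoublingMeasure (weightMeasure ω) g τ) (hΨ : IsSlow Ψ₀)
    {δ Λ : ℝ} : CarlesonBound p q Φ₀ Ψ₀ τ μ δ Λ ↔ ∀ a ∈ disc, 1 - ‖a‖ ≤ δ →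
      μ.real (carlesonSquare a) * Φ₀ (1 / (1 - ‖a‖)) /
        ((1 - ‖a‖) * τ (1 - ‖a‖) * Ψ₀ (1 / (1 - ‖a‖))) ^ (q / p) ≤ Λ := by
  refine forall₂_congr fun a ha => forall_congr' fun _ => ?_
  have ht0 : 0 < 1 - ‖a‖ := by linarith [mem_disc.1 ha]
  have hτ := h.pos _ ht0 (by linarith [norm_nonneg a])
  have hψ := hΨ.pos (1 / (1 - ‖a‖)) (by positivity)
  rw [div_le_iff₀ (by positivity)]

theorem bddAbove_carlesonQuotient_iff (h : IsDoublingMeasure (weightMeasure ω) g τ)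
    (hΦ : IsSlow Φ₀) (hΨ : IsSlow Ψ₀) (hΦp : ∀ x, 0 ≤ x → 0 < Φ x) (hΨp : ∀ x, 0 ≤ x → 0 < Ψ x)
    (hK : 0 < K) (hΦK : ∀ x, 0 ≤ x → Φ x ≤ K * Φ₀ x ∧ Φ₀ x ≤ K * Φ x)
    (hL : 0 < L) (hΨL : ∀ x, 0 ≤ x → Ψ x ≤ L * Ψ₀ x ∧ Ψ₀ x ≤ L * Ψ x)
    (hp : 0 < p) (hq : 0 < q) :
    BddAbove (carlesonQuotient p q Φ Ψ ω μ '' disc) ↔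
      ∃ Λ, 0 ≤ Λ ∧ CarlesonBound p q Φ₀ Ψ₀ τ μ 1 Λ := by
  obtain ⟨C, hC, hQ⟩ := h.carlesonQuotient_comparable hΦ hΨ hΦp hΨp hK hΦK hL hΨL hp hq μ
  simp only [h.carlesonBound_iff hΨ]
  constructor
  · rintro ⟨M, hM⟩
    refine ⟨C * |M|, by positivity, fun a ha _ => (hQ a ha).2.2.trans ?_⟩
    gcongr
    exact (hM (Set.mem_image_of_mem _ ha)).trans (le_abs_self M)
  · rintro ⟨Λ, -, hΛ⟩
    refine ⟨C * Λ, Set.forall_mem_image.2 fun a ha => (hQ a ha).2.1.trans ?_⟩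
    gcongr
    exact hΛ a ha (by linarith [norm_nonneg a])

theorem tendsto_carlesonQuotient_iff (h : IsDoublingMeasure (weightMeasure ω) g τ)
    (hΦ : IsSlow Φ₀) (hΨ : IsSlow Ψ₀) (hΦp : ∀ x, 0 ≤ x → 0 < Φ x) (hΨp : ∀ x, 0 ≤ x → 0 < Ψ x)
    (hK : 0 < K) (hΦK : ∀ x, 0 ≤ x → Φ x ≤ K * Φ₀ x ∧ Φ₀ x ≤ K * Φ x)
    (hL : 0 < L) (hΨL : ∀ x, 0 ≤ x → Ψ x ≤ L * Ψ₀ x ∧ Ψ₀ x ≤ L * Ψ x)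
    (hp : 0 < p) (hq : 0 < q) :
    Tendsto (carlesonQuotient p q Φ Ψ ω μ) (comap (fun a : ℂ => ‖a‖) (𝓝[<] 1)) (𝓝 0) ↔
      ∀ Λ, 0 < Λ → ∃ δ, 0 < δ ∧ CarlesonBound p q Φ₀ Ψ₀ τ μ δ Λ := by
  obtain ⟨C, hC, hQ⟩ := h.carlesonQuotient_comparable hΦ hΨ hΦp hΨp hK hΦK hL hΨL hp hq μ
  simp only [h.carlesonBound_iff hΨ]
  constructor
  · intro hlim Λ hΛ
    obtain ⟨δ, hδ, hP⟩ := eventually_boundary_iff.1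
      (hlim.eventually_lt_const (by positivity : 0 < Λ / C))
    refine ⟨δ, hδ, fun a ha hat => (hQ a ha).2.2.trans ?_⟩
    have := hP a ha hat
    rw [lt_div_iff₀ hC] at this
    linarith
  · intro hvan
    rw [Metric.tendsto_nhds]
    intro ε hε
    obtain ⟨δ, hδ, hP⟩ := hvan (ε / (2 * C)) (by positivity)
    refine eventually_boundary_iff.2 ⟨δ, hδ, fun a ha hat => ?_⟩
    rw [Real.dist_eq, sub_zero, abs_of_nonneg (hQ a ha).1]
    calc _ ≤ C * (ε / (2 * C)) := (hQ a ha).2.1.trans (mul_le_mul_of_nonneg_left (hP a ha hat) hC.le)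
      _ = ε / 2 := by field_simp
      _ < ε := by linarith

/-! ### Boundedness and compactness of the identity mapping -/

variable [IsFiniteMeasure μ]

theorem zygmundNorm_le_of_carlesonBound (h : IsDoublingMeasure (weightMeasure ω) g τ)
    (hΦ : IsSlow Φ₀) (hΨ : IsSlow Ψ₀)
    (hK : 0 < K) (hΦK : ∀ x, 0 ≤ x → Φ x ≤ K * Φ₀ x ∧ Φ₀ x ≤ K * Φ x)
    (hL : 0 < L) (hΨL : ∀ x, 0 ≤ x → Ψ x ≤ L * Ψ₀ x ∧ Ψ₀ x ≤ L * Ψ x)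
    (hp : 0 < p) (hpq : p ≤ q) (hcar : ∃ Λ, 0 ≤ Λ ∧ CarlesonBound p q Φ₀ Ψ₀ τ μ 1 Λ) (M : ℝ) :
    ∃ N : ℝ≥0, ∀ f : ℂ → ℂ, DifferentiableOn ℂ f disc →
      modular p Ψ (weightMeasure ω) f ≤ ENNReal.ofReal M → zygmundNorm q Φ μ f ≤ N := by
  obtain ⟨R, hR⟩ := h.modular_le_of_carlesonBound hΦ hΨ hp hpq hcar (L * M)
  refine ⟨(K * R).toNNReal ^ (1 / q), fun f hf hfM =>
    zygmundNorm_le_of_modular_le (hp.trans_le hpq) ?_⟩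
  refine (modular_le_of_le_mul hK (fun x hx => (hΦK x hx).1) q μ f).trans ?_
  rw [ENNReal.ofReal_mul hK.le]
  gcongr
  refine hR f hf ((modular_le_of_le_mul hL (fun x hx => (hΨL x hx).2) p _ f).trans ?_)
  rw [ENNReal.ofReal_mul hL.le]
  gcongr

theorem identityBounded_iff (h : IsDoublingMeasure (weightMeasure ω) g τ)
    (hΦ : IsSlow Φ₀) (hΨ : IsSlow Ψ₀)
    (hK : 0 < K) (hΦK : ∀ x, 0 ≤ x → Φ x ≤ K * Φ₀ x ∧ Φ₀ x ≤ K * Φ x)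
    (hL : 0 < L) (hΨL : ∀ x, 0 ≤ x → Ψ x ≤ L * Ψ₀ x ∧ Ψ₀ x ≤ L * Ψ x)
    (hp : 0 < p) (hpq : p ≤ q) :
    IdentityBounded p q Φ Ψ ω μ ↔ ∃ Λ, 0 ≤ Λ ∧ CarlesonBound p q Φ₀ Ψ₀ τ μ 1 Λ := by
  have hq : 0 < q := hp.trans_le hpq
  constructor
  · rintro ⟨hcont, hbdd⟩
    obtain ⟨F, hF, ⟨C, hC, hFm⟩, -, hFl⟩ := h.exists_testFunctions hΨ hp
    obtain ⟨D, hD, hlow⟩ := hFl Φ₀ q 1 hΦ hq one_pos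
    have hmod : ∀ a ∈ disc, modular p Ψ (weightMeasure ω) (fun z => ((1 : ℝ) : ℂ) * F a z) ≤
        ENNReal.ofReal (L * C) := fun a ha => by
      refine (modular_le_of_le_mul hL (fun x hx => (hΨL x hx).1) p _ _).trans ?_
      rw [ENNReal.ofReal_mul hL.le]
      gcongr
      simpa using hFm 1 one_pos le_rfl a ha
    -- The bounded set to test is a ball large enough to contain every F_a.
    obtain ⟨N, hN⟩ := hbdd {f | zygmundNorm p Ψ (weightMeasure ω) f.1 ≤
      (((L * C).toNNReal ^ (1 / p) : ℝ≥0) : ℝ≥0∞)} ⟨_, fun f hf => hf⟩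
    refine ⟨D * (K * (N : ℝ) ^ q), by positivity, (h.carlesonBound_iff hΨ).2 fun a ha _ => ?_⟩
    have ht0 : 0 < 1 - ‖a‖ := by linarith [mem_disc.1 ha]
    have hτ := h.pos _ ht0 (by linarith [norm_nonneg a])
    have hψ := hΨ.pos (1 / (1 - ‖a‖)) (by positivity)
    have hφ := hΦ.pos (1 / (1 - ‖a‖)) (by positivity)
    rw [mul_div_assoc, mul_comm]
    refine mul_measureReal_le_of_modular_le hD (by positivity) (by positivity) (hlow a ha) ?_
    refine (modular_le_of_le_mul hK (fun x hx => (hΦK x hx).2) q μ _).trans ?_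
    rw [ENNReal.ofReal_mul hK.le]
    gcongr
    have hnorm := zygmundNorm_le_of_modular_le hp (hmod a ha)
    refine modular_le_of_zygmundNorm_le hq ?_
    let f : BergmanZygmund p Ψ ω :=
      ⟨fun z => ((1 : ℝ) : ℂ) * F a z, (hF a ha).const_mul _, hnorm.trans_lt ENNReal.coe_lt_top⟩
    have := hN _ (Set.mem_image_of_mem (identityMap hcont) (show f ∈ _ from hnorm))
    rwa [zygmundNorm_identityMap hcont f] at this
  · intro hcar
    have hbd := h.zygmundNorm_le_of_carlesonBound hΦ hΨ hK hΦK hL hΨL hp hpq hcar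
    have hcont : Contained p q Φ Ψ ω μ := fun f => by
      have hf := (zygmundNorm_lt_top_iff hp).1 f.2.2
      obtain ⟨N, hN⟩ := hbd (modular p Ψ (weightMeasure ω) f.1).toReal
      exact (hN f.1 f.2.1 (ENNReal.ofReal_toReal hf.ne).ge).trans_lt ENNReal.coe_lt_top
    refine ⟨hcont, fun S ⟨M, hM⟩ => ?_⟩
    obtain ⟨N, hN⟩ := hbd ((M : ℝ) ^ p)
    refine ⟨N, Set.forall_mem_image.2 fun f hf => ?_⟩
    rw [zygmundNorm_identityMap]
    exact hN f.1 f.2.1 (modular_le_of_zygmundNorm_le hp (hM f hf))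

theorem identityCompact_of_vanishing (h : IsDoublingMeasure (weightMeasure ω) g τ)
    (hΦ : IsSlow Φ₀) (hΨ : IsSlow Ψ₀) (hΦL : ClassL Φ)
    (hK : 0 < K) (hΦK : ∀ x, 0 ≤ x → Φ x ≤ K * Φ₀ x ∧ Φ₀ x ≤ K * Φ x)
    (hL : 0 < L) (hΨL : ∀ x, 0 ≤ x → Ψ x ≤ L * Ψ₀ x ∧ Ψ₀ x ≤ L * Ψ x)
    (hp : 0 < p) (hpq : p ≤ q)
    (hvan : ∀ Λ, 0 < Λ → ∃ δ, 0 < δ ∧ CarlesonBound p q Φ₀ Ψ₀ τ μ δ Λ) :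
    IdentityCompact p q Φ Ψ ω μ := by
  have hq : 0 < q := hp.trans_le hpq
  have hcar := h.exists_carlesonBound_of_vanishing hΦ hΨ hp hpq hvan
  obtain ⟨hcont, -⟩ := (h.identityBounded_iff hΦ hΨ hK hΦK hL hΨL hp hpq).2 hcar
  obtain ⟨B, hB, hgr⟩ := h.growth_of_modular_le hΨ hp
  -- On the unit ball the modular with Ψ is at most 1, so the one with Ψ₀ is at most L.
  obtain ⟨A, hA, hgr⟩ := hgr L
  obtain ⟨D, hD, hadd⟩ := hΦ.modular_add_le hq
  refine ⟨hcont, {f | zygmundNorm p Ψ (weightMeasure ω) f.1 < ENNReal.ofReal 1},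
    ⟨1, one_pos, fun f hf => hf⟩, ?_⟩
  -- The growth bound and the integral with the frozen factor pass to pointwise limits, the latter
  -- by Fatou. The bound on the modular itself might not, as Ψ need not be continuous; hence the
  -- superset is described by the former.
  refine (isQuasiMetric_modular hΦL hq μ).isCompact_closure
    (K := {x | ∃ f : ℂ → ℂ, Measurable f ∧ DifferentiableOn ℂ f disc ∧
      (∀ z ∈ disc, ‖f z‖ ≤ A * (1 - ‖z‖) ^ (-B)) ∧
      ∫⁻ z in disc, ENNReal.ofReal (‖f z‖ ^ p * Ψ₀ (1 / (1 - ‖z‖))) ∂weightMeasure ω ≤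
        ENNReal.ofReal A ∧ x.1 =ᵐ[μ.restrict disc] f}) ?_ ?_
  · rintro _ ⟨f, hf, rfl⟩
    have hfd : DifferentiableOn ℂ (disc.indicator f.1) disc :=
      f.2.1.congr fun z hz => Set.indicator_of_mem hz f.1
    have hfm := measurable_indicator_disc f.2.1
    have hmod : modular p Ψ (weightMeasure ω) f.1 ≤ 1 := by
      have := (zygmundNorm_lt_iff hp).1 hf
      rw [ENNReal.ofReal_one, ENNReal.one_rpow] at this
      exact this.le
    obtain ⟨h1, h2⟩ := hgr _ hfm hfd (by
      rw [modular_indicator_disc]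
      refine (modular_le_of_le_mul hL (fun x hx => (hΨL x hx).2) p _ _).trans ?_
      exact mul_le_of_le_one_right zero_le hmod)
    refine ⟨_, hfm, hfd, h1, h2, ?_⟩
    filter_upwards [AEEqFun.coeFn_mk f.1 (f.2.1.continuousOn.aestronglyMeasurable
      Metric.isOpen_ball.measurableSet), ae_restrict_mem measurableSet_disc] with z hz hzd
    rw [Set.indicator_of_mem hzd]
    exact hz
  · intro u hu
    choose f hfm hfd hfgr hfN hfu using hu
    obtain ⟨G, hGm, hGd, hGgr, hGN, φ, hφ, hlim⟩ := h.exists_subseq_tendsto_modular hΦ hΨ hp hpq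
      hcar hvan hB.le hA.le hfm hfd hfgr hfN
    -- The limit belongs to the space because it differs from some member of the sequence by a
    -- function of finite modular.
    have hGfin : modular q Φ μ G < ∞ := by
      obtain ⟨n, hn⟩ := (ENNReal.tendsto_nhds_zero.1 hlim 1 one_pos).exists
      have h1 : modular q Φ₀ μ (f (φ n)) < ∞ := by
        rw [← modular_congr (hfu (φ n))]
        refine (modular_le_of_le_mul hK (fun x hx => (hΦK x hx).2) q μ _).trans_lt ?_
        exact ENNReal.mul_lt_top ENNReal.ofReal_lt_top
          ((zygmundNorm_lt_top_iff hq).1 (u (φ n)).2)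
      refine (modular_le_of_le_mul hK (fun x hx => (hΦK x hx).1) q μ _).trans_lt ?_
      refine ENNReal.mul_lt_top ENNReal.ofReal_lt_top ((hadd μ G (f (φ n))
        (fun z => f (φ n) z - G z) (hfm _).aestronglyMeasurable
        (Eventually.of_forall fun z => ?_)).trans_lt ?_)
      · have := norm_sub_le (f (φ n) z) (f (φ n) z - G z)
        rwa [sub_sub_cancel] at this
      · exact ENNReal.mul_lt_top ENNReal.ofReal_lt_top
          (ENNReal.add_lt_top.2 ⟨h1, hn.trans_lt ENNReal.one_lt_top⟩)
    have hGmk := AEEqFun.coeFn_mk (μ := μ.restrict disc) G hGm.aestronglyMeasurable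
    refine ⟨⟨AEEqFun.mk G hGm.aestronglyMeasurable, (zygmundNorm_lt_top_iff hq).2 (by
      rwa [modular_congr hGmk])⟩, ⟨G, hGm, hGd, hGgr, hGN, hGmk⟩, φ, hφ, ?_⟩
    have hzero : Tendsto (fun n => ENNReal.ofReal K *
        modular q Φ₀ μ (fun z => f (φ n) z - G z)) atTop (𝓝 0) := by
      simpa using ENNReal.Tendsto.const_mul hlim (Or.inr (ENNReal.ofReal_ne_top (r := K)))
    refine tendsto_of_tendsto_of_tendsto_of_le_of_le tendsto_const_nhds hzero
      (fun _ => zero_le) fun n => ?_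
    refine le_trans (le_of_eq (modular_congr ?_))
      (modular_le_of_le_mul hK (fun x hx => (hΦK x hx).1) q μ _)
    filter_upwards [AEEqFun.coeFn_sub (u (φ n)).1 (AEEqFun.mk G hGm.aestronglyMeasurable),
      hGmk, hfu (φ n)] with z h1 h2 h3
    rw [h1, Pi.sub_apply, h2, h3]

theorem vanishing_of_identityCompact (h : IsDoublingMeasure (weightMeasure ω) g τ)
    (hΦ : IsSlow Φ₀) (hΨ : IsSlow Ψ₀) (hΦL : ClassL Φ)
    (hK : 0 < K) (hΦK : ∀ x, 0 ≤ x → Φ x ≤ K * Φ₀ x ∧ Φ₀ x ≤ K * Φ x)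
    (hL : 0 < L) (hΨL : ∀ x, 0 ≤ x → Ψ x ≤ L * Ψ₀ x ∧ Ψ₀ x ≤ L * Ψ x)
    (hp : 0 < p) (hq : 0 < q) (hcomp : IdentityCompact p q Φ Ψ ω μ) :
    ∀ Λ, 0 < Λ → ∃ δ, 0 < δ ∧ CarlesonBound p q Φ₀ Ψ₀ τ μ δ Λ := by
  obtain ⟨hcont, U, ⟨ε, hε, hU⟩, hcl⟩ := hcomp
  obtain ⟨F, hF, ⟨C, hC, hFm⟩, hF0, hFl⟩ := h.exists_testFunctions hΨ hp
  -- All r F_a must lie in the given neighbourhood of the origin; the modular bound of order r^(p/2)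
  -- makes this possible.
  obtain ⟨r, hr0, hr1, hr⟩ : ∃ r : ℝ, 0 < r ∧ r ≤ 1 ∧ L * (C * r ^ (p / 2)) < ε ^ p := by
    have hl : Tendsto (fun r : ℝ => L * (C * r ^ (p / 2))) (𝓝[>] 0) (𝓝 0) := by
      have : Tendsto (fun r : ℝ => L * (C * r ^ (p / 2))) (𝓝 0) (𝓝 (L * (C * 0 ^ (p / 2)))) :=
        ((tendsto_id.rpow_const (Or.inr (by positivity))).const_mul C).const_mul L
      rw [Real.zero_rpow (by positivity), mul_zero, mul_zero] at this
      exact this.mono_left nhdsWithin_le_nhds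
    obtain ⟨r, h1, h2⟩ := ((hl.eventually_lt_const (by positivity : 0 < ε ^ p)).and
      (Ioc_mem_nhdsGT one_pos)).exists
    exact ⟨r, h2.1, h2.2, h1⟩
  obtain ⟨D, hD, hlow⟩ := hFl Φ₀ q r hΦ hq hr0
  set V : ℂ → ℂ → ℂ := fun a z => (r : ℂ) * F a z with hV
  have hVd : ∀ a ∈ disc, DifferentiableOn ℂ (V a) disc := fun a ha => (hF a ha).const_mul _
  have hVnorm : ∀ a ∈ disc, zygmundNorm p Ψ (weightMeasure ω) (V a) < ENNReal.ofReal ε :=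
    fun a ha => by
      rw [zygmundNorm_lt_iff hp, ENNReal.ofReal_rpow_of_pos hε]
      refine (modular_le_of_le_mul hL (fun x hx => (hΨL x hx).1) p _ _).trans_lt ?_
      refine lt_of_le_of_lt ?_ ((ENNReal.ofReal_lt_ofReal_iff (by positivity)).2 hr)
      rw [ENNReal.ofReal_mul hL.le]
      gcongr
      exact hFm r hr0 hr1 a ha
  have hlim : Tendsto (fun a => modular q Φ₀ μ (V a)) (comap (fun a : ℂ => ‖a‖) (𝓝[<] 1))
      (𝓝 0) := by
    -- It suffices to extract, from any sequence a tending to the boundary, a subsequence along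
    -- which the modular tends to 0. A shift by k puts all its points in the disc.
    refine tendsto_of_subseq_tendsto fun a ha => ?_
    obtain ⟨k, hk⟩ := eventually_atTop.1 (ha.eventually
      (eventually_boundary_iff.2 ⟨1, one_pos, fun a ha _ => ha⟩ :
        ∀ᶠ a in comap (fun a : ℂ => ‖a‖) (𝓝[<] 1), a ∈ disc))
    have hkd : ∀ n, a (n + k) ∈ disc := fun n => hk _ (Nat.le_add_left _ _)
    set v : ℕ → BergmanZygmund p Ψ ω := fun n =>
      ⟨V (a (n + k)), hVd _ (hkd n), (hVnorm _ (hkd n)).trans ENNReal.ofReal_lt_top⟩ with hv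
    obtain ⟨x, -, φ, hφ, hx⟩ := (isQuasiMetric_modular hΦL hq μ).exists_subseq_tendsto hcl
      (u := fun n => identityMap hcont (v n))
      (fun n => subset_closure (Set.mem_image_of_mem _ (hU _ (hVnorm _ (hkd n)))))
    have hu : ∀ n, (identityMap hcont (v n)).1 =ᵐ[μ.restrict disc] V (a (n + k)) := fun n =>
      AEEqFun.coeFn_mk _ _
    have hx₀ : Tendsto (fun n => modular q Φ₀ μ ⇑((identityMap hcont (v (φ n))).1 - x.1)) atTop
        (𝓝 0) := by
      have hzero : Tendsto (fun n => ENNReal.ofReal K *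
          modular q Φ μ ⇑((identityMap hcont (v (φ n))).1 - x.1)) atTop (𝓝 0) := by
        simpa using ENNReal.Tendsto.const_mul hx (Or.inr (ENNReal.ofReal_ne_top (r := K)))
      exact tendsto_of_tendsto_of_tendsto_of_le_of_le tendsto_const_nhds hzero
        (fun _ => zero_le) fun n => modular_le_of_le_mul hK (fun x hx => (hΦK x hx).2) q μ _
    have hseq : Tendsto (fun n => a (φ n + k)) atTop (comap (fun a : ℂ => ‖a‖) (𝓝[<] 1)) :=
      ha.comp ((tendsto_add_atTop_nat k).comp hφ.tendsto_atTop)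
    -- The test functions tend to 0 at every point of the disc, so their modular limit is the zero
    -- class.
    have hxz : x.1 =ᵐ[μ.restrict disc] 0 := by
      refine ae_eq_zero_of_tendsto_modular hΦ hq hx₀ ?_
      filter_upwards [ae_restrict_mem measurableSet_disc, ae_all_iff.2 hu] with z hz hzu
      have := ((hF0 z hz).comp hseq).const_mul (r : ℂ)
      rw [mul_zero] at this
      refine this.congr fun n => ?_
      rw [hzu (φ n)]
      rfl
    refine ⟨fun n => φ n + k, hx₀.congr fun n => modular_congr ?_⟩
    filter_upwards [AEEqFun.coeFn_sub (identityMap hcont (v (φ n))).1 x.1, hxz, hu (φ n)]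
      with z h1 h2 h3
    rw [h1, Pi.sub_apply, h2, h3, Pi.zero_apply, sub_zero]
  intro Λ hΛ
  obtain ⟨δ, hδ, hP⟩ := eventually_boundary_iff.1
    (ENNReal.tendsto_nhds_zero.1 hlim (ENNReal.ofReal (Λ / D)) (by
      rw [gt_iff_lt, ENNReal.ofReal_pos]; positivity))
  refine ⟨δ, hδ, (h.carlesonBound_iff hΨ).2 fun a ha hat => ?_⟩
  have ht0 : 0 < 1 - ‖a‖ := by linarith [mem_disc.1 ha]
  have hτ := h.pos _ ht0 (by linarith [norm_nonneg a])
  have hψ := hΨ.pos (1 / (1 - ‖a‖)) (by positivity)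
  have hφ := hΦ.pos (1 / (1 - ‖a‖)) (by positivity)
  rw [mul_div_assoc, mul_comm]
  refine (mul_measureReal_le_of_modular_le hD (by positivity) (by positivity) (hlow a ha)
    (hP a ha hat)).trans (le_of_eq ?_)
  field_simp

end IsDoublingMeasure

end DiscSpaces

end

theorem theorem1 (p q : ℝ) (hp : 0 < p) (hpq : p ≤ q)
    (ω : ℂ → ℝ) (hω : DiscSpaces.ClassD ω)
    (Φ Ψ : ℝ → ℝ) (hΦ : DiscSpaces.ClassL Φ) (hΨ : DiscSpaces.ClassL Ψ)
    (μ : Measure ℂ) [IsFiniteMeasure μ] (hμ : μ DiscSpaces.discᶜ = 0) :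
    (DiscSpaces.IdentityBounded p q Φ Ψ ω μ ↔
      BddAbove (DiscSpaces.carlesonQuotient p q Φ Ψ ω μ '' DiscSpaces.disc)) ∧
    (DiscSpaces.IdentityCompact p q Φ Ψ ω μ ↔
      Tendsto (DiscSpaces.carlesonQuotient p q Φ Ψ ω μ)
        (comap (fun a : ℂ => ‖a‖) (𝓝[<] 1)) (𝓝 0)) := by
  have hq : 0 < q := hp.trans_le hpq
  obtain ⟨g, τ, h⟩ := hω.exists_isDoublingMeasure
  obtain ⟨Φ₀, hΦ₀, K, hK, hΦK⟩ := hΦ.exists_isSlow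
  obtain ⟨Ψ₀, hΨ₀, L, hL, hΨL⟩ := hΨ.exists_isSlow
  constructor
  · rw [h.identityBounded_iff hΦ₀ hΨ₀ hK hΦK hL hΨL hp hpq,
      h.bddAbove_carlesonQuotient_iff hΦ₀ hΨ₀ hΦ.pos hΨ.pos hK hΦK hL hΨL hp hq]
  · rw [h.tendsto_carlesonQuotient_iff hΦ₀ hΨ₀ hΦ.pos hΨ.pos hK hΦK hL hΨL hp hq]
    exact ⟨h.vanishing_of_identityCompact hΦ₀ hΨ₀ hΦ hK hΦK hL hΨL hp hq,
      h.identityCompact_of_vanishing hΦ₀ hΨ₀ hΦ hK hΦK hL hΨL hp hpq⟩
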